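/- Conventions. A *building set* on a finite set $S$ is a collection $\mathcal{B}$ of non-empty subsets of $S$ that contains all singletons and contains $I\cup J$ whenever $I,J\in\mathcal{B}$ and $I\cap J\neq\emptyset$. For a finite simple graph $G$ with vertex set $V$, the *graphical building set* $\mathcal{B}(G)$ is the set of all non-empty $I\subseteq V$ such that the subgraph of $G$ induced on $I$ is connected. The *nestohedron* of $\mathcal{B}$ is the Minkowski sum $P_{\mathcal{B}}=\sum_{I\in\mathcal{B}}\Delta_I\subset\mathbb{R}^S$, where $\Delta_I$ is the convex hull of the coordinate vectors $e_i$, $i\in I$. For a simple $d$-dimensional polytope $P$ with $f_i$ faces of dimension $i$ ($0\le i\le d$), put $f(t)=\sum_{i=0}^d f_it^i$, define $h$ by $h(t+1)=f(t)$, and let $\gamma(P)=\sum_{i=0}^{\lfloor d/2\rfloor}\gamma_it^i\in\mathbb{Z}[t]$ be the unique polynomial with $$h(t)=\sum_{i=0}^{\lfloor d/2\rfloor}\gamma_i\,t^i(1+t)^{d-2i}.$$ Write $\gamma(\mathcal{B})=\gamma(P_{\mathcal{B}})$, and write $\gamma(\mathcal{B}')\le\gamma(\mathcal{B})$ if for every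 $i$ the coefficient of $t^i$ in $\gamma(\mathcal{B}')$ is at most the coefficient of $t^i$ in $\gamma(\mathcal{B})$. A *leaf* is a vertex of degree $1$. Leaves $l,\hat l$ of $G$ *floss* a vertex $v$ if there is a unique path of minimal length in $G$ from $l$ to $\hat l$, and $v$ is the unique vertex of degree at least $3$ on this path. **Theorem 5.1.** Let $G$ be a finite connected simple graph, let $l,\hat l$ be leaves of $G$ that floss a vertex $v$, labelled so that $\mathrm{dist}_G(l,v)\le\mathrm{dist}_G(\hat l,v)$, and let $w$ be the unique neighbour of $l$ (possibly $w=v$). Let $G'$ be the graph obtained from $G$ by the flossing move, that is, by removing the edge $\{l,w\}$ and adding the edge $\{\hat l,l\}$. Then the $\gamma$-polynomials of $\mathcal{B}(G)$ and $\mathcal{B}(G')$ exist and $$\gamma(\mathcal{B}(G'))\le\gamma(\mathcal{B}(G)).$$ -/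

import Mathlib

open Polynomial
open scoped Pointwise

/-! ### Building sets -/

/-- A building set on a finite set `S`: a collection of non-empty subsets of `S` which contains all
singletons and is closed under unions of pairs of members that intersect. -/
structure BuildingSet (S : Type*) [DecidableEq S] where
  sets : Finset (Finset S)
  nonempty_of_mem : ∀ I ∈ sets, I.Nonempty
  union_mem : ∀ I ∈ sets, ∀ J ∈ sets, (I ∩ J).Nonempty → I ∪ J ∈ sets
  singleton_mem : ∀ i : S, {i} ∈ sets

open Classical in
/-- The graphical building set of a graph `G`: the non-empty sets of vertices on which `G` induces a
connected subgraph (`SimpleGraph.Connected` includes non-emptiness). -/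
noncomputable def graphicalBuildingSet {V : Type*} [Fintype V] [DecidableEq V]
    (G : SimpleGraph V) : BuildingSet V where
  sets := Finset.univ.filter fun I : Finset V => (G.induce (I : Set V)).Connected
  nonempty_of_mem := by
    intro I hI
    have h := (Finset.mem_filter.mp hI).2.nonempty
    obtain ⟨x, hx⟩ := h
    exact ⟨x, hx⟩
  union_mem := by
    intro I hI J hJ hIJ
    have h1 := (Finset.mem_filter.mp hI).2
    have h2 := (Finset.mem_filter.mp hJ).2
    refine Finset.mem_filter.mpr ⟨Finset.mem_univ _, ?_⟩
    rw [Finset.coe_union]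
    refine SimpleGraph.induce_union_connected h1.preconnected h2.preconnected ?_
    rw [← Finset.coe_inter]
    exact hIJ
  singleton_mem := by
    intro i
    refine Finset.mem_filter.mpr ⟨Finset.mem_univ _, ?_⟩
    rw [Finset.coe_singleton]
    have : Subsingleton ({i} : Set V) := Set.subsingleton_singleton.coe_sort
    exact { preconnected := SimpleGraph.Preconnected.of_subsingleton, nonempty := ⟨⟨i, rfl⟩⟩ }

/-- The coordinate simplex: the convex hull in `ℝ^S` of the coordinate vectors `e_i`, `i ∈ I`. -/
noncomputable def coordSimplex {S : Type*} [DecidableEq S] (I : Finset S) : Set (S → ℝ) :=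
  convexHull ℝ ((fun i : S => (Pi.single i 1 : S → ℝ)) '' (I : Set S))

/-- The nestohedron of a building set: the Minkowski sum, over all members `I` of the building set,
of the coordinate simplices on `I`. -/
noncomputable def nestohedron {S : Type*} [DecidableEq S] (B : BuildingSet S) : Set (S → ℝ) :=
  ∑ I ∈ B.sets, coordSimplex I

/-! ### The `f`-, `h`- and `γ`-polynomial of a polytope -/

section Polytope

variable {E : Type*} [AddCommGroup E] [Module ℝ E] [TopologicalSpace E]

/-- The dimension of (the affine span of) a set. -/
noncomputable def polyDim (P : Set E) : ℕ :=
  Module.finrank ℝ (vectorSpan ℝ P)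

/-- The non-empty faces of a polytope `P`, i.e. the non-empty sets of maximizers over `P` of linear
functionals. The polytope itself is one of them (take the functional `0`). -/
def polyFaces (P : Set E) : Set (Set E) :=
  {F | IsExposed ℝ P F ∧ F.Nonempty}

/-- The number of `i`-dimensional faces of `P`. -/
noncomputable def faceCount (P : Set E) (i : ℕ) : ℕ :=
  {F ∈ polyFaces P | polyDim F = i}.ncard

/-- The `f`-polynomial `f_0 + f_1 t + ⋯ + f_d t^d`, where `d = dim P` and `f_i` is the number of
`i`-dimensional faces of `P`. -/
noncomputable def fPolynomial (P : Set E) : ℤ[X] :=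
  ∑ i ∈ Finset.range (polyDim P + 1), C (faceCount P i : ℤ) * X ^ i

/-- The `h`-polynomial, determined by `h(t + 1) = f(t)`. -/
noncomputable def hPolynomial (P : Set E) : ℤ[X] :=
  (fPolynomial P).comp (X - 1)

/-- `g = γ_0 + γ_1 t + ⋯ + γ_m t^m`, with `m = ⌊d / 2⌋` and `d = dim P`, is a `γ`-polynomial of `P`:
the `h`-polynomial of `P` equals `∑_{i ≤ m} γ_i t^i (1 + t)^(d - 2 i)`. -/
def IsGammaPolynomial (P : Set E) (g : ℤ[X]) : Prop :=
  g.natDegree ≤ polyDim P / 2 ∧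
    hPolynomial P =
      ∑ i ∈ Finset.range (polyDim P / 2 + 1),
        C (g.coeff i) * X ^ i * (1 + X) ^ (polyDim P - 2 * i)

/-- The `γ`-polynomial is unique. -/
theorem IsGammaPolynomial.unique {P : Set E} {g k : ℤ[X]}
    (hg : IsGammaPolynomial P g) (hk : IsGammaPolynomial P k) : g = k := by
  have key : ∀ n, n < polyDim P / 2 + 1 → g.coeff n = k.coeff n := by
    intro n
    induction n using Nat.strong_induction_on with
    | _ n ih =>
      intro hn
      have h := congrArg (fun p : ℤ[X] => p.coeff n) (hg.2.symm.trans hk.2)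
      simp only [finsetSum_coeff, mul_assoc, coeff_C_mul, coeff_X_pow_mul'] at h
      rw [← Finset.add_sum_erase _ _ (Finset.mem_range.mpr hn),
        ← Finset.add_sum_erase _ _ (Finset.mem_range.mpr hn)] at h
      have hrest : ∀ i ∈ (Finset.range (polyDim P / 2 + 1)).erase n,
          (g.coeff i * if i ≤ n then ((1 + X : ℤ[X]) ^ (polyDim P - 2 * i)).coeff (n - i) else 0) =
          (k.coeff i * if i ≤ n then ((1 + X : ℤ[X]) ^ (polyDim P - 2 * i)).coeff (n - i) else 0) := by
        intro i hi
        have hi1 := Finset.ne_of_mem_erase hi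
        have hi2 := Finset.mem_range.mp (Finset.mem_of_mem_erase hi)
        by_cases hin : i ≤ n
        · rw [ih i (lt_of_le_of_ne hin hi1) hi2]
        · simp [hin]
      rw [Finset.sum_congr rfl hrest] at h
      have h' := add_right_cancel h
      simpa [coeff_zero_eq_eval_zero] using h'
  ext n
  by_cases hn : n < polyDim P / 2 + 1
  · exact key n hn
  · rw [coeff_eq_zero_of_natDegree_lt (by have := hg.1; omega),
      coeff_eq_zero_of_natDegree_lt (by have := hk.1; omega)]

open Classical in
/-- The `γ`-polynomial of `P` (with the junk value `0` if the `h`-polynomial of `P` is not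
symmetric, so that no `γ`-polynomial exists). -/
noncomputable def gammaPolynomial (P : Set E) : ℤ[X] :=
  if h : ∃ g : ℤ[X], IsGammaPolynomial P g then h.choose else 0

theorem IsGammaPolynomial.gammaPolynomial_eq {P : Set E} {g : ℤ[X]}
    (hg : IsGammaPolynomial P g) : gammaPolynomial P = g := by
  have h : ∃ g : ℤ[X], IsGammaPolynomial P g := ⟨g, hg⟩
  rw [gammaPolynomial, dif_pos h]
  exact IsGammaPolynomial.unique h.choose_spec hg

end Polytope

/-! ### Flossing moves -/

/-- The leaves `l`, `lhat` floss the vertex `v`: there is a unique path from `l` to `lhat` of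
minimal length, and `v` is the unique vertex of degree at least `3` on this path. -/
def Floss {V : Type*} [Fintype V] (G : SimpleGraph V) [DecidableRel G.Adj] (l lhat v : V) : Prop :=
  G.degree l = 1 ∧ G.degree lhat = 1 ∧
    ∃ p : G.Walk l lhat,
      (p.IsPath ∧ p.length = G.dist l lhat) ∧
      (∀ q : G.Walk l lhat, q.IsPath → q.length = G.dist l lhat → q = p) ∧
      v ∈ p.support ∧ 3 ≤ G.degree v ∧ ∀ u ∈ p.support, 3 ≤ G.degree u → u = v

/-- Remove the edge `{l, w}` from `G` and add the edge `{lhat, l}`. -/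
def flossingMove {V : Type*} (G : SimpleGraph V) (l lhat w : V) : SimpleGraph V :=
  G.deleteEdges {s(l, w)} ⊔ SimpleGraph.edge lhat l

/-! ### Coefficientwise non-negative polynomials -/

/-! A linear functional `c` selects in each simplex of the Minkowski sum the face on the elements
where `c` is maximal, so faces correspond to patterns `I ↦ argmax of c on I`, with `I` connected.
Sorting the patterns on a connected set `U` by the set `R` of maximizers on `U` gives `f(U) = ∑
X^(|R|-1) f(U \ R)` over non-empty `R` (`facePoly_of_connectedOn`), and `f` is multiplicative over
parts without edges between them (`facePoly_union`). The results on `f` and `γ` rest on these two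
rules.

Let `G'` arise from `G` by joining a vertex to a clique. A set `I` that becomes connected has
exactly two components in `G`, and the rules yield `f_{G'}(U) = f_G(U) + (1 + X) ∑ f_G(I) f_{G'/I}(U
\ I)` over the newly connected `I`, where `G'/I` is the contraction
(`IsCliqueJoin.facePoly_eq_add`). For `γ` this becomes `γ_{G'}(U) = γ_G(U) + X ∑ γ_G(I) γ_{G'/I}(U \
I)`, where `I` now omits components of `U` (`IsCliqueJoin.graphGamma_eq_add`). Joining one edge at a
time shows that `γ` exists and is non-negative.

The path between the two leaves is induced and meets the rest `K` of the graph only at `v`. Hence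
`G` and `G'` both consist of two legs, the root `v` of one of them being joined to a set `Q`, and
the move shifts one vertex from the shorter side to the longer. It suffices that `γ`, as an array in
the leg lengths, is symmetric and increases towards the diagonal. Vertices are removed from `Q` one
at a time. The newly connected sets are initial segments of the legs together with some `K' ⊆ K`,
and contracting such a set again leaves two legs, now with both roots joined to the rest. So the
correction is a sum of two-dimensional convolutions of arrays of this kind
(`graphGamma_legSet_eq_add`), and convolution preserves symmetric unimodality
(`SymmUnimodal.arrayConv`). When `Q` misses `K`, the legs form a separate path and only their total
length matters. Since contraction leads to graphs with both roots joined, that case is settled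
before the case of one joined root. -/

/-- All coefficients of `p` are non-negative. -/
def CoeffNonneg (p : ℤ[X]) : Prop := ∀ i, 0 ≤ p.coeff i

namespace CoeffNonneg

theorem zero : CoeffNonneg 0 := fun i => by simp

theorem one : CoeffNonneg 1 := fun i => by
  rw [coeff_one]; split_ifs <;> norm_num

theorem X : CoeffNonneg X := fun i => by
  rw [coeff_X]; split_ifs <;> norm_num

theorem add {p q : ℤ[X]} (hp : CoeffNonneg p) (hq : CoeffNonneg q) : CoeffNonneg (p + q) :=
  fun i => by rw [coeff_add]; exact add_nonneg (hp i) (hq i)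

theorem mul {p q : ℤ[X]} (hp : CoeffNonneg p) (hq : CoeffNonneg q) : CoeffNonneg (p * q) :=
  fun i => by rw [coeff_mul]; exact Finset.sum_nonneg fun x _ => mul_nonneg (hp _) (hq _)

theorem sum {ι : Type*} {s : Finset ι} {f : ι → ℤ[X]} (h : ∀ i ∈ s, CoeffNonneg (f i)) :
    CoeffNonneg (∑ i ∈ s, f i) :=
  fun n => by rw [finsetSum_coeff]; exact Finset.sum_nonneg fun x hx => h x hx n

end CoeffNonneg

/-! ### Symmetric unimodal arrays and their convolution -/

/-- A two-dimensional array of polynomials with non-negative coefficients which is symmetric and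
increases towards the diagonal along each antidiagonal. -/
structure SymmUnimodal (f : ℕ → ℕ → ℤ[X]) : Prop where
  nonneg : ∀ a b, CoeffNonneg (f a b)
  symm : ∀ a b, f a b = f b a
  mono : ∀ a b, a < b → CoeffNonneg (f (a + 1) b - f a (b + 1))

/-- The two-dimensional convolution of arrays of polynomials. -/
noncomputable def arrayConv (f g : ℕ → ℕ → ℤ[X]) (a b : ℕ) : ℤ[X] :=
  ∑ i ∈ Finset.range (a + 1), ∑ j ∈ Finset.range (b + 1), f i j * g (a - i) (b - j)

namespace SymmUnimodal

variable {f g : ℕ → ℕ → ℤ[X]}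

theorem mono_of_le (hf : SymmUnimodal f) {a b k : ℕ} (h : a + k ≤ b) :
    CoeffNonneg (f (a + k) b - f a (b + k)) := by
  induction k generalizing b with
  | zero => simpa using CoeffNonneg.zero
  | succ k ih =>
    have h1 := hf.mono (a + k) b (by omega)
    have h2 := ih (b := b + 1) (by omega)
    have := h1.add h2
    rw [sub_add_sub_cancel] at this
    rwa [show a + (k + 1) = a + k + 1 by ring, show b + (k + 1) = b + 1 + k by ring]

/-- By symmetry an entry depends only on its antidiagonal and its smaller index, and it grows with
that index. -/
theorem mono_of_min_le (hf : SymmUnimodal f) {a b a' b' : ℕ} (h : a + b = a' + b')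
    (ha : a' ≤ a) (hb : a' ≤ b) : CoeffNonneg (f a b - f a' b') := by
  rcases le_total a b with hab | hab
  · have := hf.mono_of_le (a := a') (b := b) (k := a - a') (by omega)
    rwa [show a' + (a - a') = a by omega, show b + (a - a') = b' by omega] at this
  · have := hf.mono_of_le (a := a') (b := a) (k := b - a') (by omega)
    rw [show a' + (b - a') = b by omega, show a + (b - a') = b' by omega] at this
    rwa [hf.symm a b]

theorem add (hf : SymmUnimodal f) (hg : SymmUnimodal g) :
    SymmUnimodal fun a b => f a b + g a b :=
  ⟨fun a b => (hf.nonneg a b).add (hg.nonneg a b),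
    fun a b => by simp only [hf.symm a b, hg.symm a b],
    fun a b h => by
      have := (hf.mono a b h).add (hg.mono a b h)
      rwa [sub_add_sub_comm] at this⟩

theorem const_mul (hf : SymmUnimodal f) {p : ℤ[X]} (hp : CoeffNonneg p) :
    SymmUnimodal fun a b => p * f a b :=
  ⟨fun a b => hp.mul (hf.nonneg a b), fun a b => by simp only [hf.symm a b],
    fun a b h => by rw [← mul_sub]; exact hp.mul (hf.mono a b h)⟩

theorem sum {ι : Type*} {s : Finset ι} {f : ι → ℕ → ℕ → ℤ[X]}
    (h : ∀ i ∈ s, SymmUnimodal (f i)) : SymmUnimodal fun a b => ∑ i ∈ s, f i a b :=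
  ⟨fun a b => .sum fun i hi => (h i hi).nonneg a b,
    fun a b => Finset.sum_congr rfl fun i hi => (h i hi).symm a b,
    fun a b hab => by
      rw [← Finset.sum_sub_distrib]
      exact .sum fun i hi => (h i hi).mono a b hab⟩

theorem of_antidiagonal {c : ℕ → ℤ[X]} (hc : ∀ n, CoeffNonneg (c n)) :
    SymmUnimodal fun a b => c (a + b) :=
  ⟨fun a b => hc _, fun a b => by simp only [add_comm], fun a b _ => by
    rw [show a + 1 + b = a + (b + 1) by ring, sub_self]; exact .zero⟩

/-- The value at the origin is unconstrained. -/
theorem update_zero (hf : SymmUnimodal f) {z : ℤ[X]} (hz : CoeffNonneg z) :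
    SymmUnimodal fun a b => if a = 0 ∧ b = 0 then z else f a b :=
  ⟨fun a b => by split_ifs; exacts [hz, hf.nonneg a b],
    fun a b => by simp only [and_comm, hf.symm a b],
    fun a b h => by simpa using hf.mono a b h⟩

/-- Subtracting the boundary values and shifting preserves symmetric unimodality. -/
theorem shift (hf : SymmUnimodal f) :
    SymmUnimodal fun a b => f (a + 1) (b + 1) - f 0 (a + 1 + (b + 1)) :=
  ⟨fun a b => hf.mono_of_min_le (by ring) (by omega) (by omega),
    fun a b => by simp only [hf.symm (a + 1) (b + 1), add_comm],
    fun a b h => by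
      have := hf.mono (a + 1) (b + 1) (by omega)
      rwa [show a + 1 + 1 + (b + 1) = a + 1 + (b + 1 + 1) by ring, sub_sub_sub_cancel_right]⟩

/-- The two convolutions share the block `i ≤ a`, `j ≤ b`; what remains is the row `i = a + 1`
against the column `j = b + 1`. For `k ≤ a` the coefficient of `c k` compares `g (a + 1) (b - k)`
with `g (a - k) (b + 1)`, which is farther from the diagonal. The surplus terms of the row are
non-negative. -/
theorem arrayConv_antidiagonal_mono {c : ℕ → ℤ[X]} (hc : ∀ n, CoeffNonneg (c n))
    (hg : SymmUnimodal g) {a b : ℕ} (h : a < b) :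
    CoeffNonneg (arrayConv g (fun i j => c (i + j)) (a + 1) b -
      arrayConv g (fun i j => c (i + j)) a (b + 1)) := by
  have e1 : arrayConv g (fun i j => c (i + j)) (a + 1) b =
      (∑ i ∈ Finset.range (a + 1), ∑ j ∈ Finset.range (b + 1), g i j * c (a + b + 1 - (i + j))) +
        ∑ k ∈ Finset.range (b + 1), g (a + 1) (b - k) * c k := by
    rw [arrayConv, Finset.sum_range_succ]
    congr 1
    · refine Finset.sum_congr rfl fun i hi => Finset.sum_congr rfl fun j hj => ?_
      rw [Finset.mem_range] at hi hj
      rw [show a + 1 - i + (b - j) = a + b + 1 - (i + j) by omega]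
    · rw [← Finset.sum_range_reflect]
      refine Finset.sum_congr rfl fun j hj => ?_
      rw [Finset.mem_range] at hj
      rw [show b + 1 - 1 - j = b - j by omega, show a + 1 - (a + 1) + (b - (b - j)) = j by omega]
  have e2 : arrayConv g (fun i j => c (i + j)) a (b + 1) =
      (∑ i ∈ Finset.range (a + 1), ∑ j ∈ Finset.range (b + 1), g i j * c (a + b + 1 - (i + j))) +
        ∑ k ∈ Finset.range (a + 1), g (a - k) (b + 1) * c k := by
    simp only [arrayConv, Finset.sum_range_succ _ (b + 1)]
    rw [Finset.sum_add_distrib]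
    congr 1
    · refine Finset.sum_congr rfl fun i hi => Finset.sum_congr rfl fun j hj => ?_
      rw [Finset.mem_range] at hi hj
      rw [show a - i + (b + 1 - j) = a + b + 1 - (i + j) by omega]
    · rw [← Finset.sum_range_reflect]
      refine Finset.sum_congr rfl fun j hj => ?_
      rw [Finset.mem_range] at hj
      rw [show a + 1 - 1 - j = a - j by omega, show a - (a - j) + (b + 1 - (b + 1)) = j by omega]
  rw [e1, e2, add_sub_add_left_eq_sub,
    ← Finset.sum_range_add_sum_Ico _ (show a + 1 ≤ b + 1 by omega), add_sub_right_comm,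
    ← Finset.sum_sub_distrib]
  refine CoeffNonneg.add (.sum fun k hk => ?_) (.sum fun k _ => (hg.nonneg _ _).mul (hc _))
  rw [Finset.mem_range] at hk
  rw [← sub_mul]
  exact (hg.mono_of_min_le (by omega) (by omega) (by omega)).mul (hc _)

end SymmUnimodal

theorem arrayConv_comm (f g : ℕ → ℕ → ℤ[X]) : arrayConv f g = arrayConv g f := by
  funext a b
  rw [arrayConv, arrayConv, ← Finset.sum_range_reflect]
  refine Finset.sum_congr rfl fun i hi => ?_
  rw [← Finset.sum_range_reflect]
  refine Finset.sum_congr rfl fun j hj => ?_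
  rw [Finset.mem_range] at hi hj
  rw [mul_comm, show a + 1 - 1 - i = a - i by omega, show b + 1 - 1 - j = b - j by omega,
    show a - (a - i) = i by omega, show b - (b - j) = j by omega]

theorem arrayConv_swap (f g : ℕ → ℕ → ℤ[X]) (a b : ℕ) :
    arrayConv f g a b = arrayConv (fun i j => f j i) (fun i j => g j i) b a := by
  rw [arrayConv, arrayConv, Finset.sum_comm]

/-- Splits `f` into an array constant on antidiagonals, given by its boundary values, and a
remainder that vanishes when an index is `0`; shifting the latter by one in both indices gives the
last term. -/
theorem arrayConv_eq_add_shift (f g : ℕ → ℕ → ℤ[X]) (hf : ∀ a b, f a b = f b a) (a b : ℕ) :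
    arrayConv f g (a + 1) (b + 1) =
      arrayConv (fun i j => f 0 (i + j)) g (a + 1) (b + 1) +
        arrayConv (fun i j => f (i + 1) (j + 1) - f 0 (i + 1 + (j + 1))) g a b := by
  rw [← sub_eq_iff_eq_add', arrayConv, arrayConv, arrayConv, ← Finset.sum_sub_distrib,
    Finset.sum_range_succ']
  simp only [Finset.sum_range_succ' _ (b + 1)]
  simp [hf _ 0, sub_mul]

/-- Monotonicity by induction on `a`: the antidiagonal layer of `f` is handled by
`arrayConv_antidiagonal_mono`, and what is left is the same statement for the shifted array at a
smaller position. -/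
theorem SymmUnimodal.arrayConv {f g : ℕ → ℕ → ℤ[X]} (hf : SymmUnimodal f)
    (hg : SymmUnimodal g) : SymmUnimodal (arrayConv f g) where
  nonneg a b := .sum fun i _ => .sum fun j _ => (hf.nonneg _ _).mul (hg.nonneg _ _)
  symm a b := by
    rw [arrayConv_swap]
    congr 1
    · funext i j; exact hf.symm _ _
    · funext i j; exact hg.symm _ _
  mono a b h := by
    induction a generalizing b f with
    | zero =>
      obtain ⟨b, rfl⟩ : ∃ c, b = c + 1 := ⟨b - 1, by omega⟩
      rw [arrayConv_eq_add_shift f g hf.symm]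
      -- At first index `0` only the row `f 0 _` enters, so the shifted array contributes nothing to
      -- the subtracted term.
      have e : _root_.arrayConv f g 0 (b + 1 + 1) =
          _root_.arrayConv (fun i j => f 0 (i + j)) g 0 (b + 1 + 1) := by
        simp [_root_.arrayConv]
      rw [e, add_sub_right_comm]
      refine CoeffNonneg.add ?_ (.sum fun i _ => .sum fun j _ =>
        (hf.shift.nonneg _ _).mul (hg.nonneg _ _))
      rw [arrayConv_comm]
      exact arrayConv_antidiagonal_mono (fun n => hf.nonneg 0 n) hg (by omega)
    | succ a ih =>
      obtain ⟨b, rfl⟩ : ∃ c, b = c + 1 := ⟨b - 1, by omega⟩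
      rw [arrayConv_eq_add_shift f g hf.symm, arrayConv_eq_add_shift f g hf.symm,
        add_sub_add_comm]
      refine CoeffNonneg.add ?_ (ih hf.shift _ (by omega))
      rw [arrayConv_comm]
      exact arrayConv_antidiagonal_mono (fun n => hf.nonneg 0 n) hg (by omega)

/-! ### Connected finite sets of vertices -/

section ConnectedOn

variable {W : Type*} {G : SimpleGraph W}

/-- There is no edge between `A` and `B`. -/
def NoEdges (G : SimpleGraph W) (A B : Finset W) : Prop := ∀ a ∈ A, ∀ b ∈ B, ¬G.Adj a b

theorem NoEdges.symm {A B : Finset W} (h : NoEdges G A B) : NoEdges G B A :=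
  fun a ha b hb hab => h b hb a ha hab.symm

theorem NoEdges.mono {A B A' B' : Finset W} (h : NoEdges G A B) (hA : A' ⊆ A) (hB : B' ⊆ B) :
    NoEdges G A' B' := fun a ha b hb => h a (hA ha) b (hB hb)

variable [DecidableEq W]

/-- The finite set `U` of vertices is non-empty and cannot be cut without cutting an edge. -/
def ConnectedOn (G : SimpleGraph W) (U : Finset W) : Prop :=
  U.Nonempty ∧ ∀ A ⊆ U, A.Nonempty → A ≠ U → ∃ a ∈ A, ∃ b ∈ U \ A, G.Adj a b

theorem exists_split_of_not_connectedOn {U : Finset W} (hU : U.Nonempty)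
    (h : ¬ConnectedOn G U) : ∃ A B, A.Nonempty ∧ B.Nonempty ∧ Disjoint A B ∧ A ∪ B = U ∧
      NoEdges G A B := by
  simp only [ConnectedOn, hU, true_and, not_forall] at h
  obtain ⟨A, hA, hne, hAU, h⟩ := h
  push Not at h
  refine ⟨A, U \ A, hne, ?_, Finset.disjoint_sdiff, Finset.union_sdiff_of_subset hA, h⟩
  rw [Finset.sdiff_nonempty]
  exact fun h => hAU (hA.antisymm h)

theorem ConnectedOn.subset_or_subset {I A B : Finset W} (hI : ConnectedOn G I) (h : I ⊆ A ∪ B)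
    (hAB : NoEdges G A B) : I ⊆ A ∨ I ⊆ B := by
  rcases (I ∩ A).eq_empty_or_nonempty with h0 | hne
  · right
    intro x hx
    rcases Finset.mem_union.mp (h hx) with hA | hB
    · exact absurd (Finset.mem_inter.mpr ⟨hx, hA⟩) (by simp [h0])
    · exact hB
  · left
    by_contra hIA
    obtain ⟨a, ha, b, hb, hab⟩ := hI.2 (I ∩ A) Finset.inter_subset_left hne
      (fun h => hIA (Finset.inter_eq_left.mp h))
    simp only [Finset.mem_inter, Finset.mem_sdiff, not_and] at ha hb
    have hbB := (Finset.mem_union.mp (h hb.1)).resolve_left (hb.2 hb.1)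
    exact hAB a ha.2 b hbB hab

theorem ConnectedOn.not_split {A B : Finset W} (hA : A.Nonempty) (hB : B.Nonempty)
    (hd : Disjoint A B) (hAB : NoEdges G A B) : ¬ConnectedOn G (A ∪ B) := fun h => by
  rcases h.subset_or_subset subset_rfl hAB with h | h
  · obtain ⟨b, hb⟩ := hB
    exact Finset.disjoint_left.mp hd (h (Finset.mem_union_right _ hb)) hb
  · obtain ⟨a, ha⟩ := hA
    exact Finset.disjoint_left.mp hd ha (h (Finset.mem_union_left _ ha))

theorem connectedOn_singleton (x : W) : ConnectedOn G {x} := by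
  refine ⟨Finset.singleton_nonempty x, fun A hA hne hAx => ?_⟩
  rcases Finset.subset_singleton_iff.mp hA with h | h
  · simp [h] at hne
  · exact absurd h hAx

theorem connectedOn_image_iff {W' : Type*} [DecidableEq W'] {G' : SimpleGraph W'} {f : W → W'}
    {U : Finset W} (hf : Set.InjOn f U)
    (hadj : ∀ x ∈ U, ∀ y ∈ U, (G'.Adj (f x) (f y) ↔ G.Adj x y)) :
    ConnectedOn G' (U.image f) ↔ ConnectedOn G U := by
  constructor
  · rintro ⟨hne, h⟩
    refine ⟨by simpa using hne, fun A hA hA0 hAU => ?_⟩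
    obtain ⟨a, ha, b, hb, hab⟩ := h (A.image f) (Finset.image_subset_image hA) (hA0.image f)
      (fun h => hAU (Finset.image_injOn_powerset_of_injOn hf (by simpa using hA) (by simp) h))
    simp only [Finset.mem_image, Finset.mem_sdiff] at ha hb
    obtain ⟨a, ha, rfl⟩ := ha
    obtain ⟨⟨b, hb, rfl⟩, hb'⟩ := hb
    refine ⟨a, ha, b, ?_, (hadj a (hA ha) b hb).mp hab⟩
    exact Finset.mem_sdiff.mpr ⟨hb, fun h => hb' ⟨b, h, rfl⟩⟩
  · rintro ⟨hne, h⟩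
    refine ⟨hne.image f, fun A hA hA0 hAU => ?_⟩
    obtain ⟨A, hAU', rfl⟩ := Finset.subset_image_iff.mp hA
    obtain ⟨a, ha, b, hb, hab⟩ := h A hAU' (by simpa using hA0) (fun h => hAU (by rw [h]))
    rw [Finset.mem_sdiff] at hb
    refine ⟨f a, Finset.mem_image_of_mem _ ha, f b, ?_, (hadj a (hAU' ha) b hb.1).mpr hab⟩
    simp only [Finset.mem_sdiff, Finset.mem_image, not_exists, not_and]
    refine ⟨⟨b, hb.1, rfl⟩, fun x hx hxb => hb.2 ?_⟩
    rwa [← hf (hAU' hx) hb.1 hxb]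

theorem connectedOn_congr {G' : SimpleGraph W} {U : Finset W}
    (hadj : ∀ x ∈ U, ∀ y ∈ U, (G'.Adj x y ↔ G.Adj x y)) :
    ConnectedOn G' U ↔ ConnectedOn G U := by
  simpa using connectedOn_image_iff (f := id) (Set.injOn_id _) hadj

end ConnectedOn

/-! ### Spans of differences of coordinate vectors -/

section Direction

variable {W : Type*}

/-- The vectors supported on `J`. -/
def coordSubspace (J : Finset W) : Submodule ℝ (W → ℝ) where
  carrier := {x | ∀ i ∉ J, x i = 0}
  add_mem' hx hy i hi := by simp [hx i hi, hy i hi]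
  zero_mem' i _ := rfl
  smul_mem' c x hx i hi := by simp [hx i hi]

theorem coordSubspace_mono {I J : Finset W} (h : I ⊆ J) : coordSubspace I ≤ coordSubspace J :=
  fun _ hx i hi => hx i fun hI => hi (h hI)

variable [DecidableEq W]

/-- The direction of the coordinate simplex on `J`. -/
def coordDirection (J : Finset W) : Submodule ℝ (W → ℝ) :=
  vectorSpan ℝ ((fun i : W => (Pi.single i 1 : W → ℝ)) '' (J : Set W))

instance coordSubspace_finiteDimensional (J : Finset W) :
    FiniteDimensional ℝ (coordSubspace J) := by
  let f : coordSubspace J →ₗ[ℝ] (J → ℝ) :=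
    { toFun := fun x i => x.1 i
      map_add' := fun _ _ => rfl
      map_smul' := fun _ _ => rfl }
  refine FiniteDimensional.of_injective f fun x y h => Subtype.ext (funext fun i => ?_)
  by_cases hi : i ∈ J
  · exact congrFun h ⟨i, hi⟩
  · rw [x.2 i hi, y.2 i hi]

theorem coordSubspace_disjoint {I J : Finset W} (h : Disjoint I J) :
    Disjoint (coordSubspace I) (coordSubspace J) := by
  rw [Submodule.disjoint_def]
  intro x hI hJ
  funext i
  by_cases hi : i ∈ I
  · exact hJ i (Finset.disjoint_left.mp h hi)
  · exact hI i hi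

theorem coordDirection_mono {I J : Finset W} (h : I ⊆ J) : coordDirection I ≤ coordDirection J :=
  vectorSpan_mono ℝ (Set.image_mono (Finset.coe_subset.mpr h))

theorem coordDirection_le (J : Finset W) : coordDirection J ≤ coordSubspace J := by
  rw [coordDirection, vectorSpan_def, Submodule.span_le]
  rintro _ ⟨_, ⟨i, hi, rfl⟩, _, ⟨j, hj, rfl⟩, rfl⟩ k hk
  have h1 : k ≠ i := fun h => hk (h ▸ hi)
  have h2 : k ≠ j := fun h => hk (h ▸ hj)
  simp [h1, h2]

@[simp]
theorem coordDirection_empty : coordDirection (∅ : Finset W) = ⊥ := by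
  simp [coordDirection]

theorem finrank_coordDirection {J : Finset W} (hJ : J.Nonempty) :
    Module.finrank ℝ (coordDirection J) = J.card - 1 := by
  have hli : LinearIndependent ℝ (fun i : W => (Pi.single i 1 : W → ℝ)) := by
    rw [linearIndependent_iff']
    intro s g hg i hi
    have := congrFun hg i
    simpa [Finset.sum_apply, Pi.single_apply, hi] using this
  have h2 : Fintype.card J = J.card - 1 + 1 := by
    have := hJ.card_pos
    rw [Fintype.card_coe]
    omega
  have h3 := (hli.affineIndependent.comp_embedding
    (Function.Embedding.subtype (· ∈ J))).finrank_vectorSpan h2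
  rw [← h3, coordDirection, Set.image_eq_range]
  rfl

theorem finrank_sup_of_disjoint {S T : Submodule ℝ (W → ℝ)} {I J : Finset W} (h : Disjoint I J)
    (hS : S ≤ coordSubspace I) (hT : T ≤ coordSubspace J) :
    Module.finrank ℝ (S ⊔ T : Submodule ℝ (W → ℝ)) =
      Module.finrank ℝ S + Module.finrank ℝ T := by
  have := Submodule.finiteDimensional_of_le hS
  have := Submodule.finiteDimensional_of_le hT
  have hd : S ⊓ T = ⊥ := disjoint_iff.mp ((coordSubspace_disjoint h).mono hS hT)
  have := Submodule.finrank_sup_add_finrank_inf_eq S T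
  rw [hd, finrank_bot] at this
  simpa using this

end Direction

/-! ### Patterns of maximizers -/

section Pattern

variable {W : Type*}

open Classical in
/-- The elements of `I` at which `c` is maximal. -/
noncomputable def argmaxOn (c : W → ℝ) (I : Finset W) : Finset W :=
  I.filter fun i => ∀ j ∈ I, c j ≤ c i

theorem mem_argmaxOn {c : W → ℝ} {I : Finset W} {i : W} :
    i ∈ argmaxOn c I ↔ i ∈ I ∧ ∀ j ∈ I, c j ≤ c i := by
  simp [argmaxOn]

theorem argmaxOn_subset (c : W → ℝ) (I : Finset W) : argmaxOn c I ⊆ I :=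
  fun _ hi => (mem_argmaxOn.mp hi).1

theorem argmaxOn_nonempty (c : W → ℝ) {I : Finset W} (hI : I.Nonempty) :
    (argmaxOn c I).Nonempty := by
  obtain ⟨i, hi, h⟩ := I.exists_max_image c hI
  exact ⟨i, mem_argmaxOn.mpr ⟨hi, h⟩⟩

theorem argmaxOn_congr {c c' : W → ℝ} {I : Finset W} (h : ∀ i ∈ I, c i = c' i) :
    argmaxOn c I = argmaxOn c' I := by
  ext i
  simp only [mem_argmaxOn]
  refine and_congr_right fun hi => forall₂_congr fun j hj => ?_
  rw [h i hi, h j hj]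

variable [DecidableEq W] {G : SimpleGraph W}

open Classical in
/-- The maximizers of `c` on the connected subsets of `U`. -/
noncomputable def argmaxPattern (G : SimpleGraph W) (U : Finset W) (c : W → ℝ) :
    Finset W → Finset W :=
  fun I => if ConnectedOn G I ∧ I ⊆ U then argmaxOn c I else ∅

theorem argmaxPattern_of_connectedOn {U I : Finset W} (h : ConnectedOn G I) (hI : I ⊆ U)
    (c : W → ℝ) : argmaxPattern G U c I = argmaxOn c I := if_pos ⟨h, hI⟩

theorem argmaxPattern_of_not_subset {U I : Finset W} (hI : ¬I ⊆ U) (c : W → ℝ) :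
    argmaxPattern G U c I = ∅ := if_neg fun h => hI h.2

theorem argmaxPattern_of_not_connectedOn {U I : Finset W} (h : ¬ConnectedOn G I) (c : W → ℝ) :
    argmaxPattern G U c I = ∅ := if_neg fun h' => h h'.1

theorem finite_range_argmaxPattern (G : SimpleGraph W) (U : Finset W) :
    (Set.range (argmaxPattern G U)).Finite := by
  classical
  let e : (U.powerset → U.powerset) → Finset W → Finset W :=
    fun r I => if h : I ∈ U.powerset then (r ⟨I, h⟩).1 else ∅
  refine (Set.finite_range e).subset ?_
  rintro _ ⟨c, rfl⟩
  refine ⟨fun I => ⟨argmaxPattern G U c I.1, ?_⟩, ?_⟩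
  · rw [Finset.mem_powerset, argmaxPattern]
    split_ifs with h
    · exact (argmaxOn_subset c _).trans h.2
    · exact Finset.empty_subset _
  · funext I
    simp only [e, Finset.mem_powerset]
    split_ifs with h
    · rfl
    · simp [argmaxPattern, h]

/-- The patterns of maximizers on `U`. -/
noncomputable def argmaxPatterns (G : SimpleGraph W) (U : Finset W) :
    Finset (Finset W → Finset W) :=
  (finite_range_argmaxPattern G U).toFinset

theorem mem_argmaxPatterns {U : Finset W} {A : Finset W → Finset W} :
    A ∈ argmaxPatterns G U ↔ ∃ c, argmaxPattern G U c = A := by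
  simp [argmaxPatterns]

/-- The dimension of the face which belongs to a pattern of maximizers. -/
noncomputable def patternRank (A : Finset W → Finset W) : ℕ :=
  Module.finrank ℝ (⨆ I, coordDirection (A I) : Submodule ℝ (W → ℝ))

/-- The generating polynomial of the patterns of maximizers on `U` by dimension, which is the
`f`-polynomial of the nestohedron of the restriction of the graphical building set to `U`. -/
noncomputable def facePoly (G : SimpleGraph W) (U : Finset W) : ℤ[X] :=
  ∑ A ∈ argmaxPatterns G U, X ^ patternRank A

/-- Forget a pattern of maximizers outside of `U`. -/
def restrictPattern (U : Finset W) (A : Finset W → Finset W) : Finset W → Finset W :=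
  fun I => if I ⊆ U then A I else ∅

theorem restrictPattern_argmaxPattern {U U' : Finset W} (h : U' ⊆ U) (c : W → ℝ) :
    restrictPattern U' (argmaxPattern G U c) = argmaxPattern G U' c := by
  funext I
  by_cases hI : I ⊆ U'
  · rw [restrictPattern, if_pos hI]
    by_cases hc : ConnectedOn G I
    · rw [argmaxPattern_of_connectedOn hc hI, argmaxPattern_of_connectedOn hc (hI.trans h)]
    · rw [argmaxPattern_of_not_connectedOn hc, argmaxPattern_of_not_connectedOn hc]
  · rw [restrictPattern, if_neg hI, argmaxPattern_of_not_subset hI]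

theorem iSup_coordDirection_argmaxPattern_le (U : Finset W) (c : W → ℝ) :
    ⨆ I, coordDirection (argmaxPattern G U c I) ≤ coordSubspace U := by
  refine iSup_le fun I => ?_
  rw [argmaxPattern]
  split_ifs with h
  · exact (coordDirection_le _).trans (coordSubspace_mono ((argmaxOn_subset c I).trans h.2))
  · simp

@[simp]
theorem facePoly_empty : facePoly G ∅ = 1 := by
  have h : argmaxPatterns G ∅ = {fun _ => ∅} := by
    ext A
    have h0 : ∀ c, argmaxPattern G ∅ c = fun _ => ∅ := fun c => by
      funext I
      rw [argmaxPattern, if_neg]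
      rintro ⟨h1, h2⟩
      exact absurd (h1.1.mono h2) (by simp)
    simp [mem_argmaxPatterns, h0, eq_comm]
  have h0 : (⨆ _ : Finset W, coordDirection (∅ : Finset W)) = ⊥ := by simp
  rw [facePoly, h, Finset.sum_singleton, patternRank, h0, finrank_bot, pow_zero]

open Classical in
/-- Extend a pattern by letting `R` consist of larger elements. -/
noncomputable def extendPattern (G : SimpleGraph W) (U R : Finset W) (A : Finset W → Finset W) :
    Finset W → Finset W :=
  fun I => if ConnectedOn G I ∧ I ⊆ U then (if (I ∩ R).Nonempty then I ∩ R else A I) else ∅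

theorem subset_sdiff_of_inter {I U R : Finset W} (hI : I ⊆ U) (h : ¬(I ∩ R).Nonempty) :
    I ⊆ U \ R := by
  rw [Finset.not_nonempty_iff_eq_empty, ← Finset.disjoint_iff_inter_eq_empty] at h
  exact Finset.subset_sdiff.mpr ⟨hI, h⟩

/-- Raise `c` on `R` to one constant above all its values on `U`. -/
theorem exists_argmaxPattern_eq_extendPattern (U R : Finset W) (c : W → ℝ) :
    ∃ c', argmaxPattern G U c' = extendPattern G U R (argmaxPattern G (U \ R) c) := by
  classical
  obtain ⟨M, hM⟩ := (U.image c).exists_le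
  refine ⟨fun i => if i ∈ R then M + 1 else c i, funext fun I => ?_⟩
  by_cases hI : ConnectedOn G I ∧ I ⊆ U
  swap
  · rw [argmaxPattern, extendPattern, if_neg hI, if_neg hI]
  rw [argmaxPattern_of_connectedOn hI.1 hI.2, extendPattern, if_pos hI]
  have hM' : ∀ i ∈ I, c i ≤ M := fun i hi => hM _ (Finset.mem_image_of_mem c (hI.2 hi))
  split_ifs with h1
  · obtain ⟨r, hr⟩ := h1
    rw [Finset.mem_inter] at hr
    ext i
    rw [mem_argmaxOn, Finset.mem_inter]
    refine and_congr_right fun hi => ⟨fun h => ?_, fun h j hj => ?_⟩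
    · by_contra hiR
      have := h r hr.1
      simp only [hr.2, hiR, if_true, if_false] at this
      linarith [hM' i hi]
    · simp only [h, if_true]
      split_ifs
      · exact le_rfl
      · linarith [hM' j hj]
  · have h2 := subset_sdiff_of_inter hI.2 h1
    rw [argmaxPattern_of_connectedOn hI.1 h2]
    exact argmaxOn_congr fun i hi => if_neg (Finset.mem_sdiff.mp (h2 hi)).2

theorem restrictPattern_extendPattern (U R : Finset W) (c : W → ℝ) :
    restrictPattern (U \ R) (extendPattern G U R (argmaxPattern G (U \ R) c)) =
      argmaxPattern G (U \ R) c := by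
  funext I
  rw [restrictPattern]
  split_ifs with hI
  · have h0 : ¬(I ∩ R).Nonempty := by
      rw [Finset.not_nonempty_iff_eq_empty, ← Finset.disjoint_iff_inter_eq_empty]
      exact (Finset.subset_sdiff.mp hI).2
    simp only [extendPattern, if_neg h0]
    split_ifs with h
    · rfl
    · rw [argmaxPattern, if_neg]
      exact fun h' => h ⟨h'.1, h'.2.trans Finset.sdiff_subset⟩
  · simp [argmaxPattern, hI]

/-- If `I` meets the set `R` of global maximizers, its maximizers are `I ∩ R`; otherwise `I` lies in
`U \ R`. So `R` and the pattern on `U \ R` determine the whole pattern. -/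
theorem extendPattern_restrictPattern {U R : Finset W} {c : W → ℝ} (hR : argmaxOn c U = R) :
    extendPattern G U R (restrictPattern (U \ R) (argmaxPattern G U c)) =
      argmaxPattern G U c := by
  funext I
  simp only [extendPattern]
  by_cases hI : ConnectedOn G I ∧ I ⊆ U
  swap
  · rw [if_neg hI, argmaxPattern, if_neg hI]
  rw [if_pos hI]
  split_ifs with h
  · rw [argmaxPattern, if_pos hI]
    obtain ⟨r, hr⟩ := h
    rw [Finset.mem_inter, ← hR, mem_argmaxOn] at hr
    ext i
    rw [iff_comm, mem_argmaxOn, Finset.mem_inter, ← hR, mem_argmaxOn]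
    refine and_congr_right fun hi => ⟨fun h => ⟨hI.2 hi, fun j hj => ?_⟩, fun h j hj => ?_⟩
    · exact (hr.2.2 j hj).trans (h r hr.1)
    · exact h.2 j (hI.2 hj)
  · rw [restrictPattern, if_pos (subset_sdiff_of_inter hI.2 h)]

/-- The set `U` itself contributes the direction of the simplex on `R`, which contains those of all
`I ∩ R`. The other directions are supported on `U \ R`, so the dimensions add. -/
theorem patternRank_extendPattern {U R : Finset W} (hU : ConnectedOn G U) (hRU : R ⊆ U)
    (hR : R.Nonempty) (c : W → ℝ) :
    patternRank (extendPattern G U R (argmaxPattern G (U \ R) c)) =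
      R.card - 1 + patternRank (argmaxPattern G (U \ R) c) := by
  have h : ⨆ I, coordDirection (extendPattern G U R (argmaxPattern G (U \ R) c) I) =
      coordDirection R ⊔ ⨆ I, coordDirection (argmaxPattern G (U \ R) c I) := by
    apply le_antisymm
    · refine iSup_le fun I => ?_
      rw [extendPattern]
      split_ifs with h1 h2
      · exact (coordDirection_mono Finset.inter_subset_right).trans le_sup_left
      · exact (le_iSup (fun I => coordDirection (argmaxPattern G (U \ R) c I)) I).trans le_sup_right
      · simp
    · refine sup_le ?_ (iSup_le fun I => ?_)
      · refine le_trans ?_ (le_iSup _ U)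
        rw [extendPattern, if_pos ⟨hU, subset_rfl⟩, Finset.inter_eq_right.mpr hRU, if_pos hR]
      · refine le_trans ?_ (le_iSup _ I)
        rw [← congrFun (restrictPattern_extendPattern (G := G) U R c) I, restrictPattern]
        split_ifs
        · exact le_rfl
        · simp
  rw [patternRank, h, finrank_sup_of_disjoint (Finset.disjoint_sdiff (s := R) (t := U))
    (coordDirection_le R) (iSup_coordDirection_argmaxPattern_le _ c), finrank_coordDirection hR,
    patternRank]

/-- Sort the patterns by their value `R` at `U`. Every pattern on `U \ R` extends uniquely, and the
extension adds `|R| - 1` to the rank. -/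
theorem facePoly_of_connectedOn {U : Finset W} (hU : ConnectedOn G U) :
    facePoly G U = ∑ R ∈ U.powerset with R.Nonempty, X ^ (R.card - 1) * facePoly G (U \ R) := by
  classical
  have hpU : ∀ c, argmaxPattern G U c U = argmaxOn c U := fun c => by
    rw [argmaxPattern, if_pos ⟨hU, subset_rfl⟩]
  rw [facePoly, ← Finset.sum_fiberwise_of_maps_to (g := fun A => A U)
    (t := U.powerset.filter Finset.Nonempty)]
  swap
  · intro A hA
    obtain ⟨c, rfl⟩ := mem_argmaxPatterns.mp hA
    rw [Finset.mem_filter, Finset.mem_powerset, hpU]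
    exact ⟨argmaxOn_subset c U, argmaxOn_nonempty c hU.1⟩
  refine Finset.sum_congr rfl fun R hR => ?_
  rw [Finset.mem_filter, Finset.mem_powerset] at hR
  rw [facePoly, Finset.mul_sum]
  refine Finset.sum_nbij' (restrictPattern (U \ R)) (extendPattern G U R) ?_ ?_ ?_ ?_ ?_
  · intro A hA
    obtain ⟨c, rfl⟩ := mem_argmaxPatterns.mp (Finset.mem_filter.mp hA).1
    exact mem_argmaxPatterns.mpr ⟨c, (restrictPattern_argmaxPattern Finset.sdiff_subset c).symm⟩
  · intro A hA
    obtain ⟨c, rfl⟩ := mem_argmaxPatterns.mp hA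
    refine Finset.mem_filter.mpr ⟨mem_argmaxPatterns.mpr
      (exists_argmaxPattern_eq_extendPattern U R c), ?_⟩
    rw [extendPattern, if_pos ⟨hU, subset_rfl⟩, Finset.inter_eq_right.mpr hR.1, if_pos hR.2]
  · intro A hA
    rw [Finset.mem_filter] at hA
    obtain ⟨c, rfl⟩ := mem_argmaxPatterns.mp hA.1
    exact extendPattern_restrictPattern ((hpU c).symm.trans hA.2)
  · intro A hA
    obtain ⟨c, rfl⟩ := mem_argmaxPatterns.mp hA
    exact restrictPattern_extendPattern U R c
  · intro A hA
    rw [Finset.mem_filter] at hA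
    obtain ⟨c, rfl⟩ := mem_argmaxPatterns.mp hA.1
    rw [restrictPattern_argmaxPattern Finset.sdiff_subset, ← pow_add,
      ← patternRank_extendPattern hU hR.1 hR.2,
      ← restrictPattern_argmaxPattern Finset.sdiff_subset,
      extendPattern_restrictPattern ((hpU c).symm.trans hA.2)]

/-- Combine patterns on two parts of a set without edges between them. -/
def unionPattern (U : Finset W) (A B : Finset W → Finset W) : Finset W → Finset W :=
  fun I => if I ⊆ U then A I else B I

theorem unionPattern_restrictPattern {U V : Finset W} (h : NoEdges G U V) (c : W → ℝ) :
    unionPattern U (argmaxPattern G U c) (argmaxPattern G V c) = argmaxPattern G (U ∪ V) c := by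
  funext I
  rw [unionPattern]
  by_cases hI : ConnectedOn G I
  swap
  · simp [argmaxPattern_of_not_connectedOn hI]
  by_cases hU : I ⊆ U
  · rw [if_pos hU, argmaxPattern_of_connectedOn hI hU,
      argmaxPattern_of_connectedOn hI (hU.trans Finset.subset_union_left)]
  · have : I ⊆ U ∪ V ↔ I ⊆ V :=
      ⟨fun h' => (hI.subset_or_subset h' h).resolve_left hU,
        fun h' => h'.trans Finset.subset_union_right⟩
    rw [if_neg hU]
    by_cases hV : I ⊆ V
    · rw [argmaxPattern_of_connectedOn hI hV, argmaxPattern_of_connectedOn hI (this.mpr hV)]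
    · rw [argmaxPattern_of_not_subset hV, argmaxPattern_of_not_subset fun h => hV (this.mp h)]

theorem exists_common_argmaxPattern {U V : Finset W} (hd : Disjoint U V) (c c' : W → ℝ) :
    ∃ d, argmaxPattern G U d = argmaxPattern G U c ∧ argmaxPattern G V d = argmaxPattern G V c' := by
  refine ⟨fun i => if i ∈ U then c i else c' i, funext fun I => ?_, funext fun I => ?_⟩
  · rw [argmaxPattern, argmaxPattern]
    split_ifs with h
    · exact argmaxOn_congr fun i hi => if_pos (h.2 hi)
    · rfl
  · rw [argmaxPattern, argmaxPattern]
    split_ifs with h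
    · exact argmaxOn_congr fun i hi => if_neg (Finset.disjoint_right.mp hd (h.2 hi))
    · rfl

theorem patternRank_argmaxPattern_union {U V : Finset W} (hd : Disjoint U V)
    (h : NoEdges G U V) (c : W → ℝ) :
    patternRank (argmaxPattern G (U ∪ V) c) =
      patternRank (argmaxPattern G U c) + patternRank (argmaxPattern G V c) := by
  have e : ⨆ I, coordDirection (argmaxPattern G (U ∪ V) c I) =
      (⨆ I, coordDirection (argmaxPattern G U c I)) ⊔
        ⨆ I, coordDirection (argmaxPattern G V c I) := by
    apply le_antisymm
    · refine iSup_le fun I => ?_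
      rw [← unionPattern_restrictPattern h, unionPattern]
      split_ifs
      · exact (le_iSup (fun I => coordDirection (argmaxPattern G U c I)) I).trans le_sup_left
      · exact (le_iSup (fun I => coordDirection (argmaxPattern G V c I)) I).trans le_sup_right
    · have key : ∀ U' ⊆ U ∪ V, ⨆ I, coordDirection (argmaxPattern G U' c I) ≤
          ⨆ I, coordDirection (argmaxPattern G (U ∪ V) c I) := fun U' hU' => by
        refine iSup_mono fun I => ?_
        rw [← restrictPattern_argmaxPattern hU', restrictPattern]
        split_ifs
        · exact le_rfl
        · simp
      exact sup_le (key U Finset.subset_union_left) (key V Finset.subset_union_right)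
  rw [patternRank, e, finrank_sup_of_disjoint hd (iSup_coordDirection_argmaxPattern_le U c)
    (iSup_coordDirection_argmaxPattern_le V c), patternRank, patternRank]

/-- A connected subset of the union lies in one part, and functionals on disjoint parts can be
prescribed independently; so patterns are pairs of patterns, with additive rank. -/
theorem facePoly_union {U V : Finset W} (hd : Disjoint U V) (h : NoEdges G U V) :
    facePoly G (U ∪ V) = facePoly G U * facePoly G V := by
  rw [facePoly, facePoly, facePoly, Finset.sum_mul_sum, ← Finset.sum_product']
  refine Finset.sum_nbij' (fun A => (restrictPattern U A, restrictPattern V A))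
    (fun p => unionPattern U p.1 p.2) ?_ ?_ ?_ ?_ ?_
  · intro A hA
    obtain ⟨c, rfl⟩ := mem_argmaxPatterns.mp hA
    rw [Finset.mem_product, restrictPattern_argmaxPattern Finset.subset_union_left,
      restrictPattern_argmaxPattern Finset.subset_union_right]
    exact ⟨mem_argmaxPatterns.mpr ⟨c, rfl⟩, mem_argmaxPatterns.mpr ⟨c, rfl⟩⟩
  · rintro ⟨A, B⟩ hAB
    rw [Finset.mem_product] at hAB
    obtain ⟨c, hc⟩ := mem_argmaxPatterns.mp hAB.1
    obtain ⟨c', hc'⟩ := mem_argmaxPatterns.mp hAB.2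
    obtain ⟨d, hd1, hd2⟩ := exists_common_argmaxPattern (G := G) hd c c'
    refine mem_argmaxPatterns.mpr ⟨d, ?_⟩
    rw [← unionPattern_restrictPattern h, hd1, hd2, hc, hc']
  · intro A hA
    obtain ⟨c, rfl⟩ := mem_argmaxPatterns.mp hA
    dsimp only
    rw [restrictPattern_argmaxPattern Finset.subset_union_left,
      restrictPattern_argmaxPattern Finset.subset_union_right, unionPattern_restrictPattern h]
  · rintro ⟨A, B⟩ hAB
    rw [Finset.mem_product] at hAB
    obtain ⟨c, hc⟩ := mem_argmaxPatterns.mp hAB.1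
    obtain ⟨c', hc'⟩ := mem_argmaxPatterns.mp hAB.2
    obtain ⟨d, hd1, hd2⟩ := exists_common_argmaxPattern (G := G) hd c c'
    dsimp only at hc hc' ⊢
    rw [← hc, ← hc', ← hd1, ← hd2, unionPattern_restrictPattern h,
      restrictPattern_argmaxPattern Finset.subset_union_left,
      restrictPattern_argmaxPattern Finset.subset_union_right]
  · intro A hA
    obtain ⟨c, rfl⟩ := mem_argmaxPatterns.mp hA
    dsimp only
    rw [restrictPattern_argmaxPattern Finset.subset_union_left,
      restrictPattern_argmaxPattern Finset.subset_union_right, ← pow_add,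
      patternRank_argmaxPattern_union hd h]

end Pattern

/-! ### Invariance and degree of the face polynomial -/

section FacePoly

variable {W : Type*} [DecidableEq W] {G : SimpleGraph W}

theorem ConnectedOn.union {A B : Finset W} (hA : ConnectedOn G A) (hB : ConnectedOn G B)
    {a b : W} (ha : a ∈ A) (hb : b ∈ B) (hab : G.Adj a b) : ConnectedOn G (A ∪ B) := by
  by_contra h
  obtain ⟨C, D, hC, hD, hd, hCD, hno⟩ :=
    exists_split_of_not_connectedOn (hA.1.mono Finset.subset_union_left) h
  have h1 := hA.subset_or_subset (hCD ▸ Finset.subset_union_left) hno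
  have h2 := hB.subset_or_subset (hCD ▸ Finset.subset_union_right) hno
  have key : ∀ C D : Finset W, D.Nonempty → Disjoint C D → C ∪ D = A ∪ B → A ⊆ C → B ⊆ C →
      False := fun C D hD hd hCD hA hB => by
    obtain ⟨d, hd'⟩ := hD
    have : d ∈ A ∪ B := hCD ▸ Finset.mem_union_right _ hd'
    exact Finset.disjoint_left.mp hd (Finset.union_subset hA hB this) hd'
  rcases h1 with h1 | h1 <;> rcases h2 with h2 | h2
  · exact key C D hD hd hCD h1 h2
  · exact hno a (h1 ha) b (h2 hb) hab
  · exact hno b (h2 hb) a (h1 ha) hab.symm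
  · exact key D C hC hd.symm (by rw [Finset.union_comm, hCD]) h1 h2

theorem exists_component (G : SimpleGraph W) {U : Finset W} {q : W} (hq : q ∈ U) :
    ∃ C ⊆ U, q ∈ C ∧ ConnectedOn G C ∧ NoEdges G C (U \ C) := by
  classical
  obtain ⟨C, hC, hmax⟩ := (U.powerset.filter fun C => q ∈ C ∧ ConnectedOn G C).exists_max_image
    Finset.card ⟨{q}, by simp [hq, connectedOn_singleton]⟩
  simp only [Finset.mem_filter, Finset.mem_powerset] at hC hmax
  refine ⟨C, hC.1, hC.2.1, hC.2.2, fun a ha b hb hab => ?_⟩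
  rw [Finset.mem_sdiff] at hb
  have hu : C ∪ {b} ⊆ U := Finset.union_subset hC.1 (Finset.singleton_subset_iff.mpr hb.1)
  have := hmax (C ∪ {b}) ⟨hu, Finset.mem_union_left _ hC.2.1,
    hC.2.2.union (connectedOn_singleton b) ha (Finset.mem_singleton_self b) hab⟩
  rw [Finset.card_union_of_disjoint (Finset.disjoint_singleton_right.mpr hb.2),
    Finset.card_singleton] at this
  omega

theorem card_lt_card_union_left {A B : Finset W} (hd : Disjoint A B) (hB : B.Nonempty) :
    A.card < (A ∪ B).card := by
  rw [Finset.card_union_of_disjoint hd]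
  have := hB.card_pos
  omega

theorem card_lt_card_union_right {A B : Finset W} (hd : Disjoint A B) (hA : A.Nonempty) :
    B.card < (A ∪ B).card := by
  rw [Finset.union_comm]
  exact card_lt_card_union_left hd.symm hA

/-- The recursion for connected sets and multiplicativity determine the polynomial from the
adjacency relation on `U`. -/
theorem facePoly_image {W' : Type*} [DecidableEq W'] {G' : SimpleGraph W'} {f : W → W'}
    {U : Finset W} (hf : Set.InjOn f U)
    (hadj : ∀ x ∈ U, ∀ y ∈ U, (G'.Adj (f x) (f y) ↔ G.Adj x y)) :
    facePoly G' (U.image f) = facePoly G U := by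
  induction hn : U.card using Nat.strong_induction_on generalizing U with
  | _ n ih =>
    subst hn
    have ih' : ∀ A ⊆ U, A.card < U.card → facePoly G' (A.image f) = facePoly G A :=
      fun A hA hlt => ih _ hlt (hf.mono hA) (fun x hx y hy => hadj x (hA hx) y (hA hy)) rfl
    rcases U.eq_empty_or_nonempty with rfl | hne
    · simp
    by_cases hU : ConnectedOn G U
    · rw [facePoly_of_connectedOn hU,
        facePoly_of_connectedOn ((connectedOn_image_iff hf hadj).mpr hU)]
      symm
      refine Finset.sum_nbij (fun R => R.image f) ?_ ?_ ?_ ?_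
      · intro R hR
        rw [Finset.mem_filter, Finset.mem_powerset] at hR ⊢
        exact ⟨Finset.image_subset_image hR.1, hR.2.image f⟩
      · intro R hR S hS h
        simp only [Finset.coe_filter, Finset.mem_powerset, Set.mem_ofPred_eq] at hR hS
        exact Finset.image_injOn_powerset_of_injOn hf (by simpa using hR.1) (by simpa using hS.1) h
      · intro R hR
        simp only [Finset.coe_filter, Finset.mem_powerset, Set.mem_ofPred_eq] at hR
        obtain ⟨S, hS, rfl⟩ := Finset.subset_image_iff.mp hR.1
        refine ⟨S, ?_, rfl⟩
        simp only [Finset.coe_filter, Finset.mem_powerset, Set.mem_ofPred_eq]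
        exact ⟨hS, by simpa using hR.2⟩
      · intro R hR
        rw [Finset.mem_filter, Finset.mem_powerset] at hR
        rw [Finset.card_image_of_injOn (hf.mono hR.1),
          ← Finset.image_sdiff_of_injOn hf hR.1, ih' _ Finset.sdiff_subset]
        rw [Finset.card_sdiff_of_subset hR.1]
        have := hR.2.card_pos
        have := hne.card_pos
        omega
    · obtain ⟨A, B, hA, hB, hd, rfl, hno⟩ := exists_split_of_not_connectedOn hne hU
      have hl : A ⊆ A ∪ B := Finset.subset_union_left
      have hr : B ⊆ A ∪ B := Finset.subset_union_right
      rw [facePoly_union hd hno, Finset.image_union, facePoly_union,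
        ih' A hl (card_lt_card_union_left hd hB), ih' B hr (card_lt_card_union_right hd hA)]
      · rw [Finset.disjoint_left]
        intro z hz hz'
        obtain ⟨a, ha, rfl⟩ := Finset.mem_image.mp hz
        obtain ⟨b, hb, h⟩ := Finset.mem_image.mp hz'
        have := hf (hr hb) (hl ha) h
        exact Finset.disjoint_left.mp hd ha (this ▸ hb)
      · intro z hz z' hz'
        obtain ⟨a, ha, rfl⟩ := Finset.mem_image.mp hz
        obtain ⟨b, hb, rfl⟩ := Finset.mem_image.mp hz'
        rw [hadj a (hl ha) b (hr hb)]
        exact hno a ha b hb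

theorem facePoly_congr {G' : SimpleGraph W} {U : Finset W}
    (hadj : ∀ x ∈ U, ∀ y ∈ U, (G'.Adj x y ↔ G.Adj x y)) : facePoly G' U = facePoly G U := by
  simpa using facePoly_image (f := id) (Set.injOn_id _) hadj

/-- For connected `U` the term `R = U` of the recursion is `X ^ (|U| - 1)`, and any other term has
degree at most `(|R| - 1) + (|U \ R| - 1)`. The bound for disconnected sets is what the induction
needs for `U \ R`. -/
theorem facePoly_monic_and_natDegree (G : SimpleGraph W) (U : Finset W) :
    (facePoly G U).Monic ∧ (U.Nonempty → (facePoly G U).natDegree + 1 ≤ U.card) ∧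
      (ConnectedOn G U → (facePoly G U).natDegree + 1 = U.card) := by
  induction hn : U.card using Nat.strong_induction_on generalizing U with
  | _ n ih =>
    subst hn
    rcases U.eq_empty_or_nonempty with rfl | hne
    · refine ⟨by simp, by simp, fun h => absurd h.1 (by simp)⟩
    by_cases hU : ConnectedOn G U
    · have hmem : U ∈ U.powerset.filter Finset.Nonempty := by simp [hne]
      have hpos := hne.card_pos
      have e : facePoly G U = X ^ (U.card - 1) +
          ∑ R ∈ (U.powerset.filter Finset.Nonempty).erase U,
            X ^ (R.card - 1) * facePoly G (U \ R) := by
        rw [facePoly_of_connectedOn hU, ← Finset.add_sum_erase _ _ hmem]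
        simp
      have hdeg : (∑ R ∈ (U.powerset.filter Finset.Nonempty).erase U,
          X ^ (R.card - 1) * facePoly G (U \ R)).degree < ((U.card - 1 : ℕ) : WithBot ℕ) := by
        rw [← mem_degreeLT]
        refine Submodule.sum_mem _ fun R hR => ?_
        rw [mem_degreeLT]
        rw [Finset.mem_erase, Finset.mem_filter, Finset.mem_powerset] at hR
        have hR0 := hR.2.2.card_pos
        have hRU : (U \ R).Nonempty := by
          rw [Finset.sdiff_nonempty]
          exact fun h => hR.1 (hR.2.1.antisymm h)
        have hc := Finset.card_sdiff_of_subset hR.2.1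
        have hc' := Finset.card_le_card hR.2.1
        have h1 := (ih _ (by omega) (U \ R) rfl).2.1 hRU
        refine degree_le_natDegree.trans_lt (Nat.cast_lt.mpr ?_)
        have h2 := natDegree_mul_le (p := (X : ℤ[X]) ^ (R.card - 1)) (q := facePoly G (U \ R))
        rw [natDegree_X_pow] at h2
        have := hRU.card_pos
        omega
      have hnat : (facePoly G U).natDegree + 1 = U.card := by
        rw [e, natDegree_add_eq_left_of_degree_lt (by rwa [degree_X_pow]), natDegree_X_pow]
        omega
      exact ⟨by rw [e]; exact monic_X_pow_add hdeg, fun _ => hnat.le, fun _ => hnat⟩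
    · obtain ⟨A, B, hA, hB, hd, rfl, hno⟩ := exists_split_of_not_connectedOn hne hU
      have h1 := ih _ (card_lt_card_union_left hd hB) A rfl
      have h2 := ih _ (card_lt_card_union_right hd hA) B rfl
      rw [facePoly_union hd hno]
      refine ⟨h1.1.mul h2.1, fun _ => ?_, fun h => absurd h hU⟩
      rw [h1.1.natDegree_mul h2.1, Finset.card_union_of_disjoint hd]
      have := h1.2.1 hA
      have := h2.2.1 hB
      omega

theorem facePoly_monic (G : SimpleGraph W) (U : Finset W) : (facePoly G U).Monic :=
  (facePoly_monic_and_natDegree G U).1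

theorem ConnectedOn.natDegree_facePoly {U : Finset W} (h : ConnectedOn G U) :
    (facePoly G U).natDegree + 1 = U.card := (facePoly_monic_and_natDegree G U).2.2 h

theorem natDegree_facePoly_union {A B : Finset W} (hd : Disjoint A B) (h : NoEdges G A B) :
    (facePoly G (A ∪ B)).natDegree = (facePoly G A).natDegree + (facePoly G B).natDegree := by
  rw [facePoly_union hd h, (facePoly_monic G A).natDegree_mul (facePoly_monic G B)]

theorem facePoly_of_noEdges {U : Finset W} (h : NoEdges G U U) : facePoly G U = 1 := by
  induction U using Finset.induction with
  | empty => simp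
  | insert a s ha ih =>
    have h1 : facePoly G {a} = 1 := by
      rw [facePoly_of_connectedOn (connectedOn_singleton a), Finset.sum_eq_single {a}]
      · simp
      · intro R hR hne
        rw [Finset.mem_filter, Finset.mem_powerset] at hR
        rcases Finset.subset_singleton_iff.mp hR.1 with rfl | rfl
        · exact absurd hR.2 (by simp)
        · exact absurd rfl hne
      · intro h
        simp at h
    rw [Finset.insert_eq, facePoly_union (Finset.disjoint_singleton_left.mpr ha), h1,
      ih (h.mono (Finset.subset_insert _ _) (Finset.subset_insert _ _)), one_mul]
    exact h.mono (by simp) (Finset.subset_insert _ _)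

end FacePoly

/-! ### Joining a vertex to a clique -/

section Join

variable {W : Type*}

/-- The graph obtained by contracting `I`, the reconnected complement of `I`: vertices become
adjacent if they both have a neighbour in `I`. -/
def contractGraph (G : SimpleGraph W) (I : Finset W) : SimpleGraph W where
  Adj x y := x ≠ y ∧ (G.Adj x y ∨ ((∃ z ∈ I, G.Adj x z) ∧ ∃ z ∈ I, G.Adj y z))
  symm := ⟨fun _ _ h => ⟨h.1.symm, h.2.imp (fun h => h.symm) fun h => ⟨h.2, h.1⟩⟩⟩
  loopless := ⟨fun _ h => h.1 rfl⟩

/-- `G'` arises from `G` by joining the vertex `q` to all the vertices of the clique `R`. -/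
structure IsCliqueJoin (G G' : SimpleGraph W) (q : W) (R : Set W) : Prop where
  clique : ∀ x ∈ R, ∀ y ∈ R, x ≠ y → G.Adj x y
  adj_iff : ∀ x y, G'.Adj x y ↔ G.Adj x y ∨ (x = q ∧ y ∈ R) ∨ (y = q ∧ x ∈ R)

variable {G G' : SimpleGraph W} {q : W} {R : Set W}

namespace IsCliqueJoin

theorem adj_iff_of_ne (h : IsCliqueJoin G G' q R) {x y : W} (hx : x ≠ q) (hy : y ≠ q) :
    G'.Adj x y ↔ G.Adj x y := by
  simp [h.adj_iff, hx, hy]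

theorem adj_iff_of_notMem (h : IsCliqueJoin G G' q R) {x y : W} (hx : x ∉ R) (hy : y ∉ R) :
    G'.Adj x y ↔ G.Adj x y := by
  simp [h.adj_iff, hx, hy]

theorem noEdges_iff (h : IsCliqueJoin G G' q R) {A B : Finset W} :
    NoEdges G' A B ↔ NoEdges G A B ∧ (q ∈ A → ∀ r ∈ B, r ∉ R) ∧ (q ∈ B → ∀ r ∈ A, r ∉ R) := by
  constructor
  · intro hAB
    exact ⟨fun a ha b hb hab => hAB a ha b hb ((h.adj_iff _ _).mpr (.inl hab)),
      fun hq r hr hR => hAB q hq r hr ((h.adj_iff _ _).mpr (.inr (.inl ⟨rfl, hR⟩))),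
      fun hq r hr hR => hAB r hr q hq ((h.adj_iff _ _).mpr (.inr (.inr ⟨rfl, hR⟩)))⟩
  · rintro ⟨h1, h2, h3⟩ a ha b hb hab
    rcases (h.adj_iff _ _).mp hab with hab | ⟨rfl, hR⟩ | ⟨rfl, hR⟩
    · exact h1 a ha b hb hab
    · exact h2 ha b hb hR
    · exact h3 hb a ha hR

end IsCliqueJoin

variable [DecidableEq W]

/-- Vertices with a neighbour in `I` become adjacent to each other, so in a splitting of `U \ I` at
most one side touches `I`. The other side would already be cut off in `U`. -/
theorem ConnectedOn.sdiff_contractGraph {U I : Finset W} (hU : ConnectedOn G U) (hI : I ⊆ U)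
    (hne : I ≠ U) : ConnectedOn (contractGraph G I) (U \ I) := by
  have hUI : (U \ I).Nonempty := by
    rw [Finset.sdiff_nonempty]
    exact fun h => hne (hI.antisymm h)
  by_contra hc
  obtain ⟨A, B, hA, hB, hd, hAB, hno⟩ := exists_split_of_not_connectedOn hUI hc
  have hA' : A ⊆ U \ I := hAB ▸ Finset.subset_union_left
  have hB' : B ⊆ U \ I := hAB ▸ Finset.subset_union_right
  have hno' : NoEdges G A B := fun a ha b hb hab => hno a ha b hb ⟨hab.ne, .inl hab⟩
  have key : ∀ A B : Finset W, A.Nonempty → B.Nonempty → Disjoint A B → A ∪ B = U \ I →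
      A ⊆ U \ I → NoEdges G A B → NoEdges G A I → False :=
    fun A B hA hB hd hAB hAI h1 h2 => by
      have hU' : A ∪ (B ∪ I) = U := by
        rw [← Finset.union_assoc, hAB, Finset.sdiff_union_of_subset hI]
      refine ConnectedOn.not_split hA (hB.mono (Finset.subset_union_left (s₂ := I))) ?_ ?_
        (hU'.symm ▸ hU)
      · exact Finset.disjoint_union_right.mpr ⟨hd, (Finset.subset_sdiff.mp hAI).2⟩
      · intro a ha b hb
        rcases Finset.mem_union.mp hb with hb | hb
        · exact h1 a ha b hb
        · exact h2 a ha b hb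
  by_cases hAI : NoEdges G A I
  · exact key A B hA hB hd hAB hA' hno' hAI
  · refine key B A hB hA hd.symm (by rw [Finset.union_comm, hAB]) hB' hno'.symm ?_
    intro b hb z hz hbz
    simp only [NoEdges, not_forall, not_not] at hAI
    obtain ⟨a, ha, z', hz', haz⟩ := hAI
    refine hno a ha b hb ⟨fun h => ?_, .inr ⟨⟨z', hz', haz⟩, ⟨z, hz, hbz⟩⟩⟩
    exact Finset.disjoint_left.mp hd ha (h ▸ hb)

theorem NoEdges.sdiff_contractGraph {A B I : Finset W} (h : NoEdges G A B) (hI : I ⊆ A) :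
    NoEdges (contractGraph G I) (A \ I) B := by
  rintro a ha b hb ⟨-, hab | ⟨-, z, hz, hbz⟩⟩
  · exact h a (Finset.mem_sdiff.mp ha).1 b hb hab
  · exact h z (hI hz) b hb hbz.symm

theorem facePoly_contractGraph_of_noEdges {B I : Finset W} (h : NoEdges G I B) :
    facePoly (contractGraph G I) B = facePoly G B := by
  refine facePoly_congr fun x hx y _ => ⟨?_, fun h => ⟨h.ne, .inl h⟩⟩
  rintro ⟨-, hxy | ⟨⟨z, hz, hxz⟩, -⟩⟩
  · exact hxy
  · exact absurd hxz.symm (h z hz x hx)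

/-- The set `I` is connected in `G'`, but not in `G`. -/
def NewlyConnected (G G' : SimpleGraph W) (I : Finset W) : Prop :=
  ConnectedOn G' I ∧ ¬ConnectedOn G I

namespace IsCliqueJoin

theorem facePoly_eq (h : IsCliqueJoin G G' q R) {U : Finset W} (hq : q ∉ U) :
    facePoly G' U = facePoly G U :=
  facePoly_congr fun _ hx _ hy => h.adj_iff_of_ne (fun e => hq (e ▸ hx)) fun e => hq (e ▸ hy)

theorem mem_of_newlyConnected (h : IsCliqueJoin G G' q R) {I : Finset W}
    (hI : NewlyConnected G G' I) : q ∈ I := by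
  by_contra hq
  refine hI.2 ((connectedOn_congr fun _ hx _ hy => ?_).mp hI.1)
  exact h.adj_iff_of_ne (fun e => hq (e ▸ hx)) fun e => hq (e ▸ hy)

theorem exists_mem_of_newlyConnected (h : IsCliqueJoin G G' q R) {I : Finset W}
    (hI : NewlyConnected G G' I) : ∃ r ∈ I, r ∈ R := by
  by_contra! hr
  refine hI.2 ((connectedOn_congr fun x hx y hy => ?_).mp hI.1)
  exact h.adj_iff_of_notMem (hr x hx) (hr y hy)

/-- All new edges run between `q` and a clique. A third component would contain neither `q` nor a
clique vertex, hence would remain isolated in `G'`. -/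
theorem exists_split_of_newlyConnected (h : IsCliqueJoin G G' q R) {I : Finset W}
    (hI : NewlyConnected G G' I) : ∃ A B, ConnectedOn G A ∧ ConnectedOn G B ∧ Disjoint A B ∧
      A ∪ B = I ∧ NoEdges G A B := by
  obtain ⟨A, B, hA, hB, hd, hAB, hno, hqB⟩ : ∃ A B : Finset W, A.Nonempty ∧ B.Nonempty ∧
      Disjoint A B ∧ A ∪ B = I ∧ NoEdges G A B ∧ q ∈ B := by
    obtain ⟨A, B, hA, hB, hd, hAB, hno⟩ := exists_split_of_not_connectedOn hI.1.1 hI.2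
    have hq := h.mem_of_newlyConnected hI
    rw [← hAB, Finset.mem_union] at hq
    rcases hq with hq | hq
    · exact ⟨B, A, hB, hA, hd.symm, by rw [Finset.union_comm, hAB], hno.symm, hq⟩
    · exact ⟨A, B, hA, hB, hd, hAB, hno, hq⟩
  have hqA : q ∉ A := Finset.disjoint_right.mp hd hqB
  obtain ⟨r, hrA, hrR⟩ : ∃ r ∈ A, r ∈ R := by
    by_contra! hr
    refine ConnectedOn.not_split hA hB hd (h.noEdges_iff.mpr ⟨hno, ?_, fun _ => hr⟩) (hAB ▸ hI.1)
    exact fun hq => absurd hq hqA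
  have hR : ∀ s ∈ B, s ∉ R := fun s hs hsR =>
    hno r hrA s hs (h.clique r hrR s hsR fun e => Finset.disjoint_left.mp hd hrA (e ▸ hs))
  refine ⟨A, B, ?_, ?_, hd, hAB, hno⟩
  · by_contra hc
    obtain ⟨C, D, hC, hD, hd', rfl, hno', hDR⟩ : ∃ C D : Finset W, C.Nonempty ∧ D.Nonempty ∧
        Disjoint C D ∧ C ∪ D = A ∧ NoEdges G C D ∧ ∀ s ∈ D, s ∉ R := by
      obtain ⟨C, D, hC, hD, hd', hCD, hno'⟩ := exists_split_of_not_connectedOn hA hc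
      by_cases hDR : ∀ s ∈ D, s ∉ R
      · exact ⟨C, D, hC, hD, hd', hCD, hno', hDR⟩
      · push Not at hDR
        obtain ⟨s, hs, hsR⟩ := hDR
        refine ⟨D, C, hD, hC, hd'.symm, by rw [Finset.union_comm, hCD], hno'.symm, ?_⟩
        intro t ht htR
        exact hno' t ht s hs (h.clique t htR s hsR fun e =>
          Finset.disjoint_left.mp hd' ht (e ▸ hs))
    refine ConnectedOn.not_split (A := D) (B := C ∪ B) hD
      (hC.mono Finset.subset_union_left) ?_ (h.noEdges_iff.mpr ⟨?_, ?_, ?_⟩)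
      (G := G') ?_
    · exact Finset.disjoint_union_right.mpr ⟨hd'.symm, hd.mono_left Finset.subset_union_right⟩
    · intro d hd1 x hx
      rcases Finset.mem_union.mp hx with hx | hx
      · exact hno'.symm d hd1 x hx
      · exact hno d (Finset.mem_union_right _ hd1) x hx
    · exact fun hq => absurd (Finset.mem_union_right _ hq) hqA
    · exact fun _ => hDR
    · rw [← Finset.union_assoc, Finset.union_comm D C, hAB]
      exact hI.1
  · by_contra hc
    obtain ⟨C, D, hC, hD, hd', rfl, hno', hqD⟩ : ∃ C D : Finset W, C.Nonempty ∧ D.Nonempty ∧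
        Disjoint C D ∧ C ∪ D = B ∧ NoEdges G C D ∧ q ∉ D := by
      obtain ⟨C, D, hC, hD, hd', hCD, hno'⟩ := exists_split_of_not_connectedOn hB hc
      by_cases hqD : q ∈ D
      · exact ⟨D, C, hD, hC, hd'.symm, by rw [Finset.union_comm, hCD], hno'.symm,
          Finset.disjoint_right.mp hd' hqD⟩
      · exact ⟨C, D, hC, hD, hd', hCD, hno', hqD⟩
    refine ConnectedOn.not_split (A := D) (B := C ∪ A) hD
      (hC.mono Finset.subset_union_left) ?_ (h.noEdges_iff.mpr ⟨?_, ?_, ?_⟩)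
      (G := G') ?_
    · exact Finset.disjoint_union_right.mpr
        ⟨hd'.symm, (hd.mono_right Finset.subset_union_right).symm⟩
    · intro d hd1 x hx
      rcases Finset.mem_union.mp hx with hx | hx
      · exact hno'.symm d hd1 x hx
      · exact hno.symm d (Finset.mem_union_right _ hd1) x hx
    · exact fun hq => absurd hq hqD
    · exact fun _ s hs => hR s (Finset.mem_union_right _ hs)
    · rw [← Finset.union_assoc, Finset.union_comm D C, Finset.union_comm, hAB]
      exact hI.1

end IsCliqueJoin

/-! ### Weighted sums and the join formula for face polynomials -/

/-- The sum of `X ^ |R| * f (U \ R)` over all subsets `R` of `U`. -/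
noncomputable def weightedSum (f : Finset W → ℤ[X]) (U : Finset W) : ℤ[X] :=
  ∑ R ∈ U.powerset, X ^ R.card * f (U \ R)

/-- The empty `R` contributes `facePoly G U`, and by the recursion the non-empty ones contribute `X`
times it. Together with multiplicativity, each component yields one factor `1 + X`. -/
theorem weightedSum_facePoly_of_connectedOn {U : Finset W} (hU : ConnectedOn G U) :
    weightedSum (facePoly G) U = (1 + X) * facePoly G U := by
  have e : X * facePoly G U =
      ∑ R ∈ U.powerset with R.Nonempty, X ^ R.card * facePoly G (U \ R) := by
    rw [facePoly_of_connectedOn hU, Finset.mul_sum]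
    refine Finset.sum_congr rfl fun R hR => ?_
    have := (Finset.mem_filter.mp hR).2.card_pos
    rw [← mul_assoc, ← pow_succ', Nat.sub_add_cancel this]
  rw [add_mul, e, one_mul, weightedSum, ← Finset.add_sum_erase _ _ (Finset.empty_mem_powerset U)]
  congr 1
  · simp
  · refine Finset.sum_congr ?_ fun _ _ => rfl
    ext R
    simp [Finset.nonempty_iff_ne_empty, and_comm]

theorem weightedSum_facePoly_union {A B : Finset W} (hd : Disjoint A B) (h : NoEdges G A B) :
    weightedSum (facePoly G) (A ∪ B) = weightedSum (facePoly G) A * weightedSum (facePoly G) B := by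
  have e1 : ∀ S ⊆ A ∪ B, S ∩ A ∪ S ∩ B = S := fun S hS => by
    rw [← Finset.inter_union_distrib_left, Finset.inter_eq_left.mpr hS]
  have hd' : ∀ S, Disjoint (S ∩ A) (S ∩ B) := fun S =>
    hd.mono Finset.inter_subset_right Finset.inter_subset_right
  rw [weightedSum, weightedSum, weightedSum, Finset.sum_mul_sum, ← Finset.sum_product']
  refine Finset.sum_nbij' (fun S => (S ∩ A, S ∩ B)) (fun p => p.1 ∪ p.2) ?_ ?_ ?_ ?_ ?_
  · intro S _
    simp [Finset.inter_subset_right]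
  · rintro ⟨S, T⟩ h
    simp only [Finset.mem_product, Finset.mem_powerset] at h ⊢
    exact Finset.union_subset_union h.1 h.2
  · intro S hS
    exact e1 S (Finset.mem_powerset.mp hS)
  · rintro ⟨S, T⟩ h
    simp only [Finset.mem_product, Finset.mem_powerset] at h
    have h1 : T ∩ A = ∅ := Finset.disjoint_iff_inter_eq_empty.mp (hd.symm.mono_left h.2)
    have h2 : S ∩ B = ∅ := Finset.disjoint_iff_inter_eq_empty.mp (hd.mono_left h.1)
    simp only [Finset.union_inter_distrib_right, h1, h2, Finset.inter_eq_left.mpr h.1,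
      Finset.inter_eq_left.mpr h.2, Finset.union_empty, Finset.empty_union]
  · intro S hS
    rw [Finset.mem_powerset] at hS
    have e2 : (A ∪ B) \ S = A \ (S ∩ A) ∪ B \ (S ∩ B) := by
      rw [Finset.sdiff_inter_self_right, Finset.sdiff_inter_self_right, Finset.union_sdiff_distrib]
    have e3 : S.card = (S ∩ A).card + (S ∩ B).card := by
      rw [← Finset.card_union_of_disjoint (hd' S), e1 S hS]
    rw [e2, facePoly_union (hd.mono Finset.sdiff_subset Finset.sdiff_subset)
      (h.mono Finset.sdiff_subset Finset.sdiff_subset), e3, pow_add]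
    ring

open Classical in
/-- The sum over the newly connected sets in the formula for the face polynomial of a join. -/
noncomputable def joinSum (G G' : SimpleGraph W) (U : Finset W) : ℤ[X] :=
  ∑ I ∈ U.powerset with NewlyConnected G G' I, facePoly G I * facePoly (contractGraph G' I) (U \ I)

open Classical in
-- After interchanging the sums, each `I ≠ U` carries the weighted sum of the connected set `U \ I`
-- in the contraction, hence a factor `1 + X`. For `I = U` the inner set is empty and the factor is
-- only `1`, which gives the correction.
theorem weightedSum_joinSum {U : Finset W} (hU : ConnectedOn G' U) :
    weightedSum (joinSum G G') U = (1 + X) * joinSum G G' U -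
      if NewlyConnected G G' U then X * facePoly G U else 0 := by
  have e1 : weightedSum (joinSum G G') U = ∑ I ∈ U.powerset with NewlyConnected G G' I,
      facePoly G I * weightedSum (facePoly (contractGraph G' I)) (U \ I) := by
    simp only [weightedSum, joinSum, Finset.mul_sum]
    rw [Finset.sum_comm' (t' := U.powerset.filter (NewlyConnected G G'))
      (s' := fun I => (U \ I).powerset)]
    · refine Finset.sum_congr rfl fun I _ => Finset.sum_congr rfl fun S _ => ?_
      rw [sdiff_right_comm]
      ring
    · intro S I
      simp only [Finset.mem_powerset, Finset.mem_filter, Finset.subset_sdiff]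
      rw [disjoint_comm]
      tauto
  have e2 : ∀ I ∈ U.powerset.filter (NewlyConnected G G'),
      facePoly G I * weightedSum (facePoly (contractGraph G' I)) (U \ I) =
        (1 + X) * (facePoly G I * facePoly (contractGraph G' I) (U \ I)) -
          if I = U then X * facePoly G U else 0 := by
    intro I hI
    rw [Finset.mem_filter, Finset.mem_powerset] at hI
    split_ifs with h
    · subst h
      simp only [weightedSum, Finset.sdiff_self, Finset.powerset_empty, Finset.sum_singleton,
        Finset.card_empty, facePoly_empty]
      ring
    · rw [weightedSum_facePoly_of_connectedOn (hU.sdiff_contractGraph hI.1 h)]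
      ring
  rw [e1, Finset.sum_congr rfl e2, Finset.sum_sub_distrib, ← Finset.mul_sum, joinSum,
    Finset.sum_ite_eq']
  simp

/-- The effect of joining a vertex to a clique on the face polynomial. -/
theorem IsCliqueJoin.facePoly_eq_add (h : IsCliqueJoin G G' q R) (U : Finset W) :
    facePoly G' U = facePoly G U + (1 + X) * joinSum G G' U := by
  classical
  induction hn : U.card using Nat.strong_induction_on generalizing U with
  | _ n ih =>
    subst hn
    rcases U.eq_empty_or_nonempty with rfl | hne
    · rw [joinSum, Finset.sum_eq_zero]
      · simp
      · intro I hI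
        rw [Finset.mem_filter, Finset.mem_powerset] at hI
        exact absurd (hI.2.1.1.mono hI.1) (by simp)
    by_cases hU : ConnectedOn G' U
    · have e1 := weightedSum_facePoly_of_connectedOn hU
      -- By induction the error of the claimed formula vanishes at `U \ S` for non-empty `S`, so its
      -- weighted sum at `U` is the error at `U` alone. Evaluating the other weighted sums shows
      -- that `X` times this error is `0`.
      have e2 : weightedSum (facePoly G') U = weightedSum (facePoly G) U +
          (1 + X) * weightedSum (joinSum G G') U +
            (facePoly G' U - facePoly G U - (1 + X) * joinSum G G' U) := by
        simp only [weightedSum, ← Finset.add_sum_erase _ _ (Finset.empty_mem_powerset U)]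
        have : ∑ S ∈ U.powerset.erase ∅, X ^ S.card * facePoly G' (U \ S) =
            ∑ S ∈ U.powerset.erase ∅, (X ^ S.card * facePoly G (U \ S) +
              (1 + X) * (X ^ S.card * joinSum G G' (U \ S))) := by
          refine Finset.sum_congr rfl fun S hS => ?_
          rw [Finset.mem_erase, Finset.mem_powerset] at hS
          have hlt : (U \ S).card < U.card := by
            have := (Finset.nonempty_iff_ne_empty.mpr hS.1).card_pos
            have := Finset.card_le_card hS.2
            rw [Finset.card_sdiff_of_subset hS.2]
            omega
          rw [ih _ hlt (U \ S) rfl]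
          ring
        rw [this, Finset.sum_add_distrib, ← Finset.mul_sum]
        simp only [Finset.card_empty, Finset.sdiff_empty]
        ring
      rw [weightedSum_joinSum hU] at e2
      have hX : (X : ℤ[X]) ≠ 0 := X_ne_zero
      apply mul_left_cancel₀ hX
      by_cases hc : ConnectedOn G U
      · rw [if_neg fun h => h.2 hc, weightedSum_facePoly_of_connectedOn hc, e1] at e2
        linear_combination e2
      · have hnew : NewlyConnected G G' U := ⟨hU, hc⟩
        obtain ⟨A, B, hA, hB, hd, hAB, hno⟩ := h.exists_split_of_newlyConnected hnew
        -- There are two components in `G`, hence two factors `1 + X`; the excess over one factor is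
        -- cancelled by the correction term in `weightedSum_joinSum`.
        have e3 : weightedSum (facePoly G) U = (1 + X) ^ 2 * facePoly G U := by
          rw [← hAB, weightedSum_facePoly_union hd hno, weightedSum_facePoly_of_connectedOn hA,
            weightedSum_facePoly_of_connectedOn hB, facePoly_union hd hno]
          ring
        rw [if_pos hnew, e3, e1] at e2
        linear_combination e2
    · obtain ⟨A, B, hA, hB, hd, hAB, hno, hq⟩ : ∃ A B : Finset W, A.Nonempty ∧ B.Nonempty ∧
          Disjoint A B ∧ A ∪ B = U ∧ NoEdges G' A B ∧ q ∉ B := by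
        obtain ⟨A, B, hA, hB, hd, hAB, hno⟩ := exists_split_of_not_connectedOn hne hU
        by_cases hq : q ∈ B
        · exact ⟨B, A, hB, hA, hd.symm, by rw [Finset.union_comm, hAB], hno.symm,
            Finset.disjoint_right.mp hd hq⟩
        · exact ⟨A, B, hA, hB, hd, hAB, hno, hq⟩
      subst hAB
      -- A newly connected set contains `q`, so it lies in `A`, and contracting it does not affect
      -- `B`.
      have e : joinSum G G' (A ∪ B) = joinSum G G' A * facePoly G' B := by
        rw [joinSum, joinSum, Finset.sum_mul]
        refine (Finset.sum_subset ?_ ?_).symm.trans (Finset.sum_congr rfl fun I hI => ?_)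
        · intro I hI
          rw [Finset.mem_filter, Finset.mem_powerset] at hI ⊢
          exact ⟨hI.1.trans Finset.subset_union_left, hI.2⟩
        · intro I hI hI'
          rw [Finset.mem_filter, Finset.mem_powerset] at hI hI'
          refine absurd ⟨(hI.2.1.subset_or_subset hI.1 hno).resolve_right fun hB => ?_, hI.2⟩ hI'
          exact hq (hB (h.mem_of_newlyConnected hI.2))
        · rw [Finset.mem_filter, Finset.mem_powerset] at hI
          rw [Finset.union_sdiff_distrib, Finset.sdiff_eq_self_of_disjoint
            (hd.symm.mono_right hI.1), facePoly_union (hd.mono_left Finset.sdiff_subset)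
            (hno.sdiff_contractGraph hI.1),
            facePoly_contractGraph_of_noEdges (hno.mono hI.1 subset_rfl), mul_assoc]
      rw [facePoly_union hd hno, facePoly_union hd (h.noEdges_iff.mp hno).1, e,
        ih _ (card_lt_card_union_left hd hB) A rfl, h.facePoly_eq hq]
      ring

end Join

/-! ### The `γ`-polynomial of a set of vertices -/

/-- `g` is the `γ`-polynomial of a polytope with `f`-polynomial `p`: if `h(x) = p(x - 1)` is the
`h`-polynomial and `d` the degree, then `h(x) = (1 + x)^d g(x / (1 + x)^2)`. -/
structure IsGammaOf (p g : ℤ[X]) : Prop where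
  natDegree_le : 2 * g.natDegree ≤ p.natDegree
  eval_eq : ∀ x : ℝ, 1 + x ≠ 0 →
    aeval (x - 1) p = (1 + x) ^ p.natDegree * aeval (x / (1 + x) ^ 2) g

namespace IsGammaOf

theorem unique {p g k : ℤ[X]} (hg : IsGammaOf p g) (hk : IsGammaOf p k) : g = k := by
  apply map_injective (algebraMap ℤ ℝ) (algebraMap ℤ ℝ).injective_int
  -- The map `x ↦ x / (1 + x)^2` identifies `x` with `1 / x`, so it is sampled at the points `n + 2
  -- > 1`, where it is injective.
  refine eq_of_infinite_eval_eq _ _ (Set.infinite_of_injective_forall_mem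
    (f := fun n : ℕ => (n + 2 : ℝ) / (1 + (n + 2)) ^ 2) ?_ ?_)
  · intro m n h
    have hm : (0 : ℝ) ≤ m := m.cast_nonneg
    have hn : (0 : ℝ) ≤ n := n.cast_nonneg
    dsimp only at h
    rw [div_eq_div_iff (by positivity) (by positivity)] at h
    have h2 : ((m : ℝ) - n) * (1 - (m + 2) * (n + 2)) = 0 := by linear_combination h
    rcases mul_eq_zero.mp h2 with h3 | h3
    · exact_mod_cast sub_eq_zero.mp h3
    · nlinarith [mul_nonneg hm hn]
  · intro n
    have hn : (1 + (n + 2) : ℝ) ≠ 0 := by positivity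
    have h := (hg.eval_eq _ hn).symm.trans (hk.eval_eq _ hn)
    have := mul_left_cancel₀ (pow_ne_zero _ hn) h
    change eval _ _ = eval _ _
    rwa [eval_map_algebraMap, eval_map_algebraMap]

theorem one : IsGammaOf 1 1 := ⟨by simp, fun x _ => by simp⟩

theorem mul {p q g k : ℤ[X]} (hp : p.Monic) (hq : q.Monic) (hg : IsGammaOf p g)
    (hk : IsGammaOf q k) : IsGammaOf (p * q) (g * k) := by
  refine ⟨?_, fun x hx => ?_⟩
  · rw [hp.natDegree_mul hq]
    have := natDegree_mul_le (p := g) (q := k)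
    have := hg.natDegree_le
    have := hk.natDegree_le
    omega
  · rw [hp.natDegree_mul hq, map_mul, map_mul, hg.eval_eq x hx, hk.eval_eq x hx]
    ring

end IsGammaOf

section Gamma

variable {W : Type*} [DecidableEq W] {G G' : SimpleGraph W} {q : W} {R : Set W}

open Classical in
/-- The newly connected subsets of `U` which are joined to their complement in `U` by an edge. -/
noncomputable def joinSets (G G' : SimpleGraph W) (U : Finset W) : Finset (Finset W) :=
  U.powerset.filter fun I => NewlyConnected G G' I ∧ ¬NoEdges G' I (U \ I)

theorem mem_joinSets {U I : Finset W} :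
    I ∈ joinSets G G' U ↔ I ⊆ U ∧ NewlyConnected G G' I ∧ ¬NoEdges G' I (U \ I) := by
  simp [joinSets]

namespace IsCliqueJoin

theorem subset_of_newlyConnected (h : IsCliqueJoin G G' q R) {U C I : Finset W} (hqC : q ∈ C)
    (hCU : C ⊆ U) (hno : NoEdges G' C (U \ C)) (hIU : I ⊆ U) (hI : NewlyConnected G G' I) :
    I ⊆ C := by
  refine (hI.1.subset_or_subset (B := U \ C) ?_ hno).resolve_right fun hIC => ?_
  · rwa [Finset.union_sdiff_of_subset hCU]
  · exact (Finset.mem_sdiff.mp (hIC (h.mem_of_newlyConnected hI))).2 hqC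

/-- The term `I = C` of the join formula equals `facePoly G U`, which turns the coefficient `1` into
`2 + X`. On the side of `h`, where `X = x - 1`, this is the factor `1 + x`. -/
theorem facePoly_eq_of_newlyConnected (h : IsCliqueJoin G G' q R) {U C : Finset W} (hCU : C ⊆ U)
    (hno : NoEdges G' C (U \ C)) (hC : NewlyConnected G G' C) :
    facePoly G' U = (2 + X) * facePoly G U +
      (1 + X) * ∑ I ∈ joinSets G G' U, facePoly G I * facePoly (contractGraph G' I) (U \ I) := by
  classical
  have hqC := h.mem_of_newlyConnected hC
  have e : U.powerset.filter (NewlyConnected G G') = insert C (joinSets G G' U) := by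
    ext I
    simp only [Finset.mem_filter, Finset.mem_powerset, Finset.mem_insert, mem_joinSets]
    constructor
    · rintro ⟨hIU, hI⟩
      by_cases hIno : NoEdges G' I (U \ I)
      · refine .inl ((h.subset_of_newlyConnected hqC hCU hno hIU hI).antisymm
          (h.subset_of_newlyConnected (h.mem_of_newlyConnected hI) hIU hIno hCU hC))
      · exact .inr ⟨hIU, hI, hIno⟩
    · rintro (rfl | hI)
      · exact ⟨hCU, hC⟩
      · exact ⟨hI.1, hI.2.1⟩
  have e2 : facePoly G C * facePoly (contractGraph G' C) (U \ C) = facePoly G U := by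
    have hq : q ∉ U \ C := fun hq => (Finset.mem_sdiff.mp hq).2 hqC
    rw [facePoly_contractGraph_of_noEdges hno, h.facePoly_eq hq,
      ← facePoly_union Finset.disjoint_sdiff (h.noEdges_iff.mp hno).1,
      Finset.union_sdiff_of_subset hCU]
  rw [h.facePoly_eq_add, joinSum, e, Finset.sum_insert, e2]
  · ring
  · exact fun hmem => (mem_joinSets.mp hmem).2.2 hno

theorem facePoly_eq_of_forall (h : IsCliqueJoin G G' q R) {U : Finset W}
    (hU : ∀ I ⊆ U, NewlyConnected G G' I → ¬NoEdges G' I (U \ I)) :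
    facePoly G' U = facePoly G U +
      (1 + X) * ∑ I ∈ joinSets G G' U, facePoly G I * facePoly (contractGraph G' I) (U \ I) := by
  classical
  rw [h.facePoly_eq_add, joinSum]
  congr 3
  ext I
  simp only [Finset.mem_filter, Finset.mem_powerset, mem_joinSets]
  exact ⟨fun hI => ⟨hI.1, hI.2, hU I hI.1 hI.2⟩, fun hI => ⟨hI.1, hI.2.1⟩⟩

theorem natDegree_add_two_eq_card (h : IsCliqueJoin G G' q R) {I : Finset W}
    (hI : NewlyConnected G G' I) : (facePoly G I).natDegree + 2 = I.card := by
  obtain ⟨A, B, hA, hB, hd, rfl, hno⟩ := h.exists_split_of_newlyConnected hI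
  rw [natDegree_facePoly_union hd hno, Finset.card_union_of_disjoint hd]
  have := hA.natDegree_facePoly
  have := hB.natDegree_facePoly
  omega

/-- With `C` the component of `q` in `G'`, the degree `|C| - 1` is replaced by `|I| - 2`, as `I` has
two components in `G`, plus `|C \ I| - 1`. The loss of two matches the denominator of `x / (1 +
x)^2`, that is, one factor `X` in `γ`. -/
theorem natDegree_facePoly_of_mem_joinSets (h : IsCliqueJoin G G' q R) {U I : Finset W}
    (hI : I ∈ joinSets G G' U) : (facePoly G I).natDegree +
      (facePoly (contractGraph G' I) (U \ I)).natDegree + 2 = (facePoly G' U).natDegree := by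
  obtain ⟨hIU, hI, hIno⟩ := mem_joinSets.mp hI
  obtain ⟨C, hCU, hqC, hC, hno⟩ := exists_component G' (hIU (h.mem_of_newlyConnected hI))
  have hIC := h.subset_of_newlyConnected hqC hCU hno hIU hI
  have hne : I ≠ C := by rintro rfl; exact hIno hno
  have hd : Disjoint C (U \ C) := Finset.disjoint_sdiff
  have e1 : U \ I = C \ I ∪ U \ C := by
    ext x
    simp only [Finset.mem_sdiff, Finset.mem_union]
    have := @hIC x
    have := @hCU x
    tauto
  have e2 : (facePoly G' U).natDegree = (facePoly G' C).natDegree +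
      (facePoly G' (U \ C)).natDegree := by
    rw [← natDegree_facePoly_union hd hno, Finset.union_sdiff_of_subset hCU]
  rw [e1, natDegree_facePoly_union (hd.mono_left Finset.sdiff_subset)
    (hno.sdiff_contractGraph hIC),
    facePoly_contractGraph_of_noEdges (hno.mono hIC subset_rfl), e2]
  have h1 := h.natDegree_add_two_eq_card hI
  have h2 := (hC.sdiff_contractGraph hIC hne).natDegree_facePoly
  have h3 := hC.natDegree_facePoly
  have h4 := Finset.card_sdiff_of_subset hIC
  have h5 := Finset.card_le_card hIC
  omega

theorem natDegree_facePoly_of_newlyConnected (h : IsCliqueJoin G G' q R) {U C : Finset W}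
    (hCU : C ⊆ U) (hno : NoEdges G' C (U \ C)) (hC : NewlyConnected G G' C) :
    (facePoly G' U).natDegree = (facePoly G U).natDegree + 1 := by
  have hq : q ∉ U \ C := fun hq => (Finset.mem_sdiff.mp hq).2 (h.mem_of_newlyConnected hC)
  have hd : Disjoint C (U \ C) := Finset.disjoint_sdiff
  rw [← Finset.union_sdiff_of_subset hCU, natDegree_facePoly_union hd hno,
    natDegree_facePoly_union hd (h.noEdges_iff.mp hno).1, h.facePoly_eq hq]
  have := h.natDegree_add_two_eq_card hC
  have := hC.1.natDegree_facePoly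
  omega

theorem natDegree_facePoly_of_forall (h : IsCliqueJoin G G' q R) {U : Finset W}
    (hU : ∀ I ⊆ U, NewlyConnected G G' I → ¬NoEdges G' I (U \ I)) :
    (facePoly G' U).natDegree = (facePoly G U).natDegree := by
  by_cases hq : q ∈ U
  · obtain ⟨C, hCU, hqC, hC, hno⟩ := exists_component G' hq
    have hC' : ConnectedOn G C := by
      by_contra hc
      exact hU C hCU ⟨hC, hc⟩ hno
    have hq' : q ∉ U \ C := fun hq => (Finset.mem_sdiff.mp hq).2 hqC
    have hd : Disjoint C (U \ C) := Finset.disjoint_sdiff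
    rw [← Finset.union_sdiff_of_subset hCU, natDegree_facePoly_union hd hno,
      natDegree_facePoly_union hd (h.noEdges_iff.mp hno).1, h.facePoly_eq hq']
    have := hC.natDegree_facePoly
    have := hC'.natDegree_facePoly
    omega
  · rw [h.facePoly_eq hq]

/-- The effect of joining a vertex to a clique on the `γ`-polynomial. -/
theorem isGammaOf_add (h : IsCliqueJoin G G' q R) {U : Finset W} {g k : Finset W → ℤ[X]}
    (hgU : IsGammaOf (facePoly G U) (g U))
    (hg : ∀ I ∈ joinSets G G' U, IsGammaOf (facePoly G I) (g I))
    (hk : ∀ I ∈ joinSets G G' U, IsGammaOf (facePoly (contractGraph G' I) (U \ I)) (k I)) :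
    IsGammaOf (facePoly G' U) (g U + X * ∑ I ∈ joinSets G G' U, g I * k I) := by
  have hsum : ∀ x : ℝ, 1 + x ≠ 0 → x * aeval (x - 1)
      (∑ I ∈ joinSets G G' U, facePoly G I * facePoly (contractGraph G' I) (U \ I)) =
      (1 + x) ^ (facePoly G' U).natDegree *
        aeval (x / (1 + x) ^ 2) (X * ∑ I ∈ joinSets G G' U, g I * k I) := fun x hx => by
    rw [map_mul, aeval_X, map_sum, map_sum, ← mul_assoc, Finset.mul_sum, Finset.mul_sum]
    refine Finset.sum_congr rfl fun I hI => ?_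
    rw [map_mul, map_mul, (hg I hI).eval_eq x hx, (hk I hI).eval_eq x hx,
      ← h.natDegree_facePoly_of_mem_joinSets hI]
    field_simp
    ring
  have hle : (facePoly G U).natDegree ≤ (facePoly G' U).natDegree := by
    by_cases hU : ∀ I ⊆ U, NewlyConnected G G' I → ¬NoEdges G' I (U \ I)
    · exact (h.natDegree_facePoly_of_forall hU).ge
    · push Not at hU
      obtain ⟨C, hCU, hC, hno⟩ := hU
      have := h.natDegree_facePoly_of_newlyConnected hCU hno hC
      omega
  refine ⟨?_, fun x hx => ?_⟩
  · have h1 : (g U).natDegree ≤ (facePoly G' U).natDegree / 2 := by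
      have := hgU.natDegree_le
      omega
    have h2 : (X * ∑ I ∈ joinSets G G' U, g I * k I).natDegree ≤
        (facePoly G' U).natDegree / 2 := by
      rw [Finset.mul_sum]
      refine natDegree_sum_le_of_forall_le _ _ fun I hI => ?_
      have h1 := natDegree_mul_le (p := (X : ℤ[X])) (q := g I * k I)
      have h2 := natDegree_mul_le (p := g I) (q := k I)
      have h3 := (hg I hI).natDegree_le
      have h4 := (hk I hI).natDegree_le
      have h5 := h.natDegree_facePoly_of_mem_joinSets hI
      rw [natDegree_X] at h1
      omega
    have := natDegree_add_le_of_degree_le h1 h2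
    omega
  · rw [map_add, mul_add, ← hsum x hx]
    -- If no component of `U` is new, the degree is unchanged. Otherwise it rises by one while the
    -- old `h`-polynomial gains a factor `1 + x`, so the contribution `g U` is the same in both
    -- cases.
    by_cases hU : ∀ I ⊆ U, NewlyConnected G G' I → ¬NoEdges G' I (U \ I)
    · rw [h.natDegree_facePoly_of_forall hU, h.facePoly_eq_of_forall hU, map_add, map_mul,
        hgU.eval_eq x hx]
      simp
    · push Not at hU
      obtain ⟨C, hCU, hC, hno⟩ := hU
      rw [h.natDegree_facePoly_of_newlyConnected hCU hno hC,
        h.facePoly_eq_of_newlyConnected hCU hno hC, map_add, map_mul, map_mul,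
        hgU.eval_eq x hx]
      simp only [map_add, aeval_X, map_one, map_ofNat]
      ring

end IsCliqueJoin

/-! ### Existence, non-negativity and recursion of the `γ`-polynomial -/

open Classical in
-- Delete one edge and use the join formula: induction on `|U|`, and for fixed `U` on the number of
-- adjacent ordered pairs. The graph varies because the formula involves contractions.
theorem exists_isGammaOf_facePoly (G : SimpleGraph W) (U : Finset W) :
    ∃ g, CoeffNonneg g ∧ IsGammaOf (facePoly G U) g := by
  induction hn : U.card using Nat.strong_induction_on generalizing U G with
  | _ n ih =>
    subst hn
    induction hm : ((U ×ˢ U).filter fun p => G.Adj p.1 p.2).card using Nat.strong_induction_on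
      generalizing G with
    | _ m ihm =>
      subst hm
      by_cases hno : NoEdges G U U
      · exact ⟨1, .one, by rw [facePoly_of_noEdges hno]; exact .one⟩
      simp only [NoEdges, not_forall, not_not] at hno
      obtain ⟨x, hx, y, hy, hxy⟩ := hno
      -- Restoring a single edge is a join to a clique with one vertex.
      have hj : IsCliqueJoin (G.deleteEdges {s(x, y)}) G x {y} := by
        refine ⟨fun a ha b hb hab => absurd (ha.trans hb.symm) hab, fun a b => ?_⟩
        simp only [SimpleGraph.deleteEdges_adj, Set.mem_singleton_iff, Sym2.eq_iff]
        constructor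
        · intro hab
          by_cases h1 : a = x ∧ b = y
          · exact .inr (.inl h1)
          by_cases h2 : a = y ∧ b = x
          · exact .inr (.inr h2.symm)
          · exact .inl ⟨hab, by tauto⟩
        · rintro (h | ⟨rfl, rfl⟩ | ⟨rfl, rfl⟩)
          · exact h.1
          · exact hxy
          · exact hxy.symm
      obtain ⟨g₀, hg₀, hg₀'⟩ := (fun hlt => ihm _ hlt (G.deleteEdges {s(x, y)}) rfl) <| by
        refine Finset.card_lt_card ⟨fun p hp => ?_, fun h => ?_⟩
        · simp only [Finset.mem_filter] at hp ⊢
          exact ⟨hp.1, (SimpleGraph.deleteEdges_adj.mp hp.2).1⟩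
        · have := @h (x, y) (Finset.mem_filter.mpr ⟨Finset.mem_product.mpr ⟨hx, hy⟩, hxy⟩)
          simp at this
      have hlt2 : ∀ I ∈ joinSets (G.deleteEdges {s(x, y)}) G U, I.card < U.card := fun I hI => by
        obtain ⟨hIU, hI, hIno⟩ := mem_joinSets.mp hI
        refine Finset.card_lt_card (hIU.ssubset_of_ne ?_)
        rintro rfl
        exact hIno (by simp [NoEdges])
      have hex : ∀ I, ∃ g, I ∈ insert U (joinSets (G.deleteEdges {s(x, y)}) G U) →
          CoeffNonneg g ∧ IsGammaOf (facePoly (G.deleteEdges {s(x, y)}) I) g := fun I => by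
        by_cases hIU : I = U
        · exact ⟨g₀, fun _ => hIU ▸ ⟨hg₀, hg₀'⟩⟩
        by_cases hI : I ∈ joinSets (G.deleteEdges {s(x, y)}) G U
        · obtain ⟨g, hg⟩ := ih _ (hlt2 I hI) (G.deleteEdges {s(x, y)}) I rfl
          exact ⟨g, fun _ => hg⟩
        · exact ⟨0, fun h => by simp [hIU, hI] at h⟩
      choose g hg using hex
      have hex' : ∀ I, ∃ k, I ∈ joinSets (G.deleteEdges {s(x, y)}) G U →
          CoeffNonneg k ∧ IsGammaOf (facePoly (contractGraph G I) (U \ I)) k := fun I => by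
        by_cases hI : I ∈ joinSets (G.deleteEdges {s(x, y)}) G U
        · obtain ⟨hIU, hI', -⟩ := mem_joinSets.mp hI
          have : (U \ I).card < U.card := by
            rw [Finset.card_sdiff_of_subset hIU]
            have := hI'.1.1.card_pos
            have := Finset.card_le_card hIU
            omega
          obtain ⟨k, hk⟩ := ih _ this (contractGraph G I) (U \ I) rfl
          exact ⟨k, fun _ => hk⟩
        · exact ⟨0, fun h => absurd h hI⟩
      choose k hk using hex'
      refine ⟨_, ?_, hj.isGammaOf_add (hg U (Finset.mem_insert_self _ _)).2
        (fun I hI => (hg I (Finset.mem_insert_of_mem hI)).2) fun I hI => (hk I hI).2⟩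
      exact (hg U (Finset.mem_insert_self _ _)).1.add (CoeffNonneg.X.mul
        (.sum fun I hI => (hg I (Finset.mem_insert_of_mem hI)).1.mul (hk I hI).1))

/-- The `γ`-polynomial of the graphical building set of the graph induced on `U`. -/
noncomputable def graphGamma (G : SimpleGraph W) (U : Finset W) : ℤ[X] :=
  (exists_isGammaOf_facePoly G U).choose

theorem graphGamma_nonneg (G : SimpleGraph W) (U : Finset W) : CoeffNonneg (graphGamma G U) :=
  (exists_isGammaOf_facePoly G U).choose_spec.1

theorem isGammaOf_graphGamma (G : SimpleGraph W) (U : Finset W) :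
    IsGammaOf (facePoly G U) (graphGamma G U) :=
  (exists_isGammaOf_facePoly G U).choose_spec.2

theorem graphGamma_union {A B : Finset W} (hd : Disjoint A B) (h : NoEdges G A B) :
    graphGamma G (A ∪ B) = graphGamma G A * graphGamma G B := by
  refine (isGammaOf_graphGamma G (A ∪ B)).unique ?_
  rw [facePoly_union hd h]
  exact (isGammaOf_graphGamma G A).mul (facePoly_monic G A) (facePoly_monic G B)
    (isGammaOf_graphGamma G B)

theorem graphGamma_image {W' : Type*} [DecidableEq W'] {G' : SimpleGraph W'} {f : W → W'}
    {U : Finset W} (hf : Set.InjOn f U)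
    (hadj : ∀ x ∈ U, ∀ y ∈ U, (G'.Adj (f x) (f y) ↔ G.Adj x y)) :
    graphGamma G' (U.image f) = graphGamma G U := by
  refine (isGammaOf_graphGamma G' _).unique ?_
  rw [facePoly_image hf hadj]
  exact isGammaOf_graphGamma G U

theorem IsCliqueJoin.graphGamma_eq_add (h : IsCliqueJoin G G' q R) (U : Finset W) :
    graphGamma G' U = graphGamma G U + X * ∑ I ∈ joinSets G G' U,
      graphGamma G I * graphGamma (contractGraph G' I) (U \ I) :=
  (isGammaOf_graphGamma G' U).unique (h.isGammaOf_add (isGammaOf_graphGamma G U)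
    (fun _ _ => isGammaOf_graphGamma _ _) fun _ _ => isGammaOf_graphGamma _ _)

end Gamma

/-! ### Graphs with two legs -/

section Legs

variable {M : Type*}

/-- The graph which consists of a graph `Γ` on `M` and two infinite paths, the legs, with adjacent
roots `(false, 0)` and `(true, 0)`; the root `(s, 0)` is joined to all the vertices in `Q` if
`s ∈ δ`. -/
def legGraph (δ : Set Bool) (Γ : SimpleGraph M) (Q : Set M) : SimpleGraph ((Bool × ℕ) ⊕ M) where
  Adj
    | .inl p, .inl p' =>
      (p.1 = p'.1 ∧ (p.2 + 1 = p'.2 ∨ p'.2 + 1 = p.2)) ∨ (p.1 ≠ p'.1 ∧ p.2 = 0 ∧ p'.2 = 0)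
    | .inl p, .inr x => p.2 = 0 ∧ p.1 ∈ δ ∧ x ∈ Q
    | .inr x, .inl p => p.2 = 0 ∧ p.1 ∈ δ ∧ x ∈ Q
    | .inr x, .inr y => Γ.Adj x y
  symm := ⟨by
    rintro (p | x) (p' | y) h
    · exact h.imp (fun h => ⟨h.1.symm, h.2.symm⟩) fun h => ⟨h.1.symm, h.2.2, h.2.1⟩
    · exact h
    · exact h
    · exact Γ.symm.symm _ _ h⟩
  loopless := ⟨by
    rintro (p | x) h
    · rcases h with h | h
      · omega
      · exact h.1 rfl
    · exact Γ.loopless.irrefl x h⟩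

section Adj

variable {δ : Set Bool} {Γ : SimpleGraph M} {Q : Set M}

@[simp]
theorem legGraph_adj_inl_inl {p p' : Bool × ℕ} : (legGraph δ Γ Q).Adj (.inl p) (.inl p') ↔
    (p.1 = p'.1 ∧ (p.2 + 1 = p'.2 ∨ p'.2 + 1 = p.2)) ∨ (p.1 ≠ p'.1 ∧ p.2 = 0 ∧ p'.2 = 0) :=
  Iff.rfl

@[simp]
theorem legGraph_adj_inl_inr {p : Bool × ℕ} {x : M} :
    (legGraph δ Γ Q).Adj (.inl p) (.inr x) ↔ p.2 = 0 ∧ p.1 ∈ δ ∧ x ∈ Q := Iff.rfl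

@[simp]
theorem legGraph_adj_inr_inl {p : Bool × ℕ} {x : M} :
    (legGraph δ Γ Q).Adj (.inr x) (.inl p) ↔ p.2 = 0 ∧ p.1 ∈ δ ∧ x ∈ Q := Iff.rfl

@[simp]
theorem legGraph_adj_inr_inr {x y : M} :
    (legGraph δ Γ Q).Adj (.inr x) (.inr y) ↔ Γ.Adj x y := Iff.rfl

end Adj

/-- The vertices of `K` and of the legs up to the lengths `a` and `b`. -/
def legSet (a b : ℕ) (K : Finset M) : Finset ((Bool × ℕ) ⊕ M) :=
  (((Finset.univ : Finset Bool) ×ˢ Finset.range (max a b)).filter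
    fun p => p.2 < cond p.1 b a).disjSum K

@[simp]
theorem inl_mem_legSet {a b : ℕ} {K : Finset M} {p : Bool × ℕ} :
    .inl p ∈ legSet a b K ↔ p.2 < cond p.1 b a := by
  obtain ⟨s, k⟩ := p
  cases s <;> simp [legSet] <;> omega

@[simp]
theorem inr_mem_legSet {a b : ℕ} {K : Finset M} {x : M} : .inr x ∈ legSet a b K ↔ x ∈ K := by
  simp [legSet]

theorem legSet_subset_iff {a b i j : ℕ} {K K' : Finset M} :
    legSet i j K' ⊆ legSet a b K ↔ i ≤ a ∧ j ≤ b ∧ K' ⊆ K := by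
  constructor
  · intro h
    refine ⟨?_, ?_, fun x hx => inr_mem_legSet.mp (h (inr_mem_legSet.mpr hx))⟩
    · by_contra hi
      have := h (inl_mem_legSet (p := (false, a)).mpr (by simpa using hi))
      simp at this
    · by_contra hj
      have := h (inl_mem_legSet (p := (true, b)).mpr (by simpa using hj))
      simp at this
  · rintro ⟨hi, hj, hK⟩ (⟨s, k⟩ | x) h
    · rw [inl_mem_legSet] at h ⊢
      cases s <;> simp only [cond_true, cond_false] at h ⊢ <;> omega
    · rw [inr_mem_legSet] at h ⊢
      exact hK h

theorem legSet_injective {a b i j : ℕ} {K K' : Finset M} (h : legSet i j K' = legSet a b K) :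
    i = a ∧ j = b ∧ K' = K := by
  have h1 := legSet_subset_iff.mp h.subset
  have h2 := legSet_subset_iff.mp h.superset
  exact ⟨le_antisymm h1.1 h2.1, le_antisymm h1.2.1 h2.2.1, h1.2.2.antisymm h2.2.2⟩

/-- Some leg of positive length has its root in `δ`. -/
def LegActive (δ : Set Bool) (a b : ℕ) : Prop := ∃ s ∈ δ, 0 < cond s b a

variable {δ : Set Bool} {Γ : SimpleGraph M} {Q : Set M}

/-- The vertices which become adjacent to the roots when `K` and a part of the legs are
contracted. -/
def linkSet (Γ : SimpleGraph M) (Q : Set M) (K : Finset M) : Set M :=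
  {x | x ∈ Q ∨ ∃ z ∈ K, Γ.Adj x z}

/-- The graph on `M` after `K` and a part of the legs are contracted. -/
def linkGraph (Γ : SimpleGraph M) (Q : Set M) (K : Finset M) : SimpleGraph M where
  Adj x y := x ≠ y ∧ (Γ.Adj x y ∨ (x ∈ linkSet Γ Q K ∧ y ∈ linkSet Γ Q K))
  symm := ⟨fun _ _ h => ⟨h.1.symm, h.2.imp (fun h => h.symm) fun h => ⟨h.2, h.1⟩⟩⟩
  loopless := ⟨fun _ h => h.1 rfl⟩

theorem exists_adj_legSet_inr_iff {i j : ℕ} {K : Finset M} (hact : LegActive δ i j) {x : M} :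
    (∃ z ∈ legSet i j K, (legGraph δ Γ Q).Adj (.inr x) z) ↔ x ∈ linkSet Γ Q K := by
  constructor
  · rintro ⟨p | z, hz, hxz⟩
    · exact .inl hxz.2.2
    · exact .inr ⟨z, inr_mem_legSet.mp hz, hxz⟩
  · rintro (hx | ⟨z, hz, hxz⟩)
    · obtain ⟨s, hs, hlen⟩ := hact
      exact ⟨.inl (s, 0), by simpa using hlen, rfl, hs, hx⟩
    · exact ⟨.inr z, inr_mem_legSet.mpr hz, hxz⟩

theorem eq_zero_of_exists_adj_legSet {i j : ℕ} {K : Finset M}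
    {s : Bool} {k : ℕ} :
    (∃ z ∈ legSet i j K, (legGraph δ Γ Q).Adj (.inl (s, k + cond s j i)) z) → k = 0 := by
  rintro ⟨⟨s', m⟩ | z, hz, hxz⟩
  · rw [inl_mem_legSet] at hz
    simp only [legGraph_adj_inl_inl] at hxz
    rcases hxz with ⟨rfl, h⟩ | ⟨h1, h2, h3⟩
    · dsimp only at hz
      omega
    · omega
  · have := hxz.1
    dsimp only at this
    omega

theorem exists_adj_legSet_root {i j : ℕ} {K : Finset M} (hact : LegActive δ i j) (s : Bool) :
    ∃ z ∈ legSet i j K, (legGraph δ Γ Q).Adj (.inl (s, cond s j i)) z := by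
  rcases Nat.eq_zero_or_pos (cond s j i) with h0 | hpos
  · obtain ⟨s', -, hlen⟩ := hact
    have hs : s ≠ s' := by rintro rfl; omega
    exact ⟨.inl (s', 0), by simpa using hlen, .inr ⟨hs, h0, rfl⟩⟩
  · refine ⟨.inl (s, cond s j i - 1), ?_, .inl ⟨rfl, .inr ?_⟩⟩
    · rw [inl_mem_legSet]
      dsimp only
      omega
    · dsimp only
      omega

theorem ncard_inter_diff_singleton_lt {K K' : Finset M} (hK : K' ⊆ K) {q : M} (hqK : q ∈ K)
    (hq : q ∈ Q) : ((K' : Set M) ∩ (Q \ {q})).ncard < ((K : Set M) ∩ Q).ncard := by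
  refine Set.ncard_lt_ncard ⟨fun x hx => ⟨hK hx.1, hx.2.1⟩, fun h => ?_⟩
    (K.finite_toSet.inter_of_left Q)
  exact (h ⟨hqK, hq⟩).2.2 rfl

variable [DecidableEq M]

/-- Every connected component of `Γ` on `K` meets `Q`. -/
def Attachable (Γ : SimpleGraph M) (Q : Set M) (K : Finset M) : Prop :=
  ∀ A ⊆ K, A.Nonempty → ∃ x ∈ A, x ∈ Q ∨ ∃ y ∈ K \ A, Γ.Adj x y

/-- The legs together form a path through the adjacent roots, so a part without outgoing edges
contains all of it or nothing. -/
theorem leg_mem_of_noEdges {a b : ℕ} {K : Finset M} {A : Finset ((Bool × ℕ) ⊕ M)}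
    (hno : NoEdges (legGraph δ Γ Q) A (legSet a b K \ A)) {p p' : Bool × ℕ} (hp : .inl p ∈ A)
    (hpA : .inl p ∈ legSet a b K) (hp' : .inl p' ∈ legSet a b K) : .inl p' ∈ A := by
  have step : ∀ r r' : Bool × ℕ, .inl r' ∈ legSet a b K →
      (legGraph δ Γ Q).Adj (.inl r) (.inl r') → .inl r ∈ A → .inl r' ∈ A :=
    fun r r' hr' hadj hr => by
      by_contra h
      exact hno _ hr _ (Finset.mem_sdiff.mpr ⟨hr', h⟩) hadj
  have down : ∀ s k, k < cond s b a → .inl (s, k) ∈ A → .inl (s, 0) ∈ A := fun s k => by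
    induction k with
    | zero => exact fun _ h => h
    | succ k ih =>
      intro hk h
      exact ih (by omega) (step (s, k + 1) (s, k) (by simp; omega) (by simp) h)
  have up : ∀ s k, k < cond s b a → .inl (s, 0) ∈ A → .inl (s, k) ∈ A := fun s k => by
    induction k with
    | zero => exact fun _ h => h
    | succ k ih =>
      intro hk h
      exact step (s, k) (s, k + 1) (by simpa using hk) (by simp) (ih (by omega) h)
  obtain ⟨s, k⟩ := p
  obtain ⟨s', k'⟩ := p'
  rw [inl_mem_legSet] at hpA hp'
  refine up s' k' hp' ?_
  have h0 := down s k hpA hp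
  by_cases hs : s = s'
  · exact hs ▸ h0
  · exact step (s, 0) (s', 0) (by rw [inl_mem_legSet]; dsimp only at hp' ⊢; omega)
      (by simp [hs]) h0

/-- The legs cannot be torn apart, so a cut separates some vertices of `K` from them. An active root
makes all of `Q` adjacent to the legs, whence the condition does not depend on the lengths. -/
theorem connectedOn_legSet_iff {a b : ℕ} {K : Finset M} (hact : LegActive δ a b) :
    ConnectedOn (legGraph δ Γ Q) (legSet a b K) ↔ Attachable Γ Q K := by
  obtain ⟨s, hs, hlen⟩ := hact
  have hroot : .inl (s, 0) ∈ legSet a b K := by simpa using hlen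
  constructor
  · intro h A hA hne
    obtain ⟨x, hx, y, hy, hxy⟩ := h.2 (A.image .inr)
      (fun z hz => by
        obtain ⟨x, hx, rfl⟩ := Finset.mem_image.mp hz
        exact inr_mem_legSet.mpr (hA hx))
      (hne.image _) (fun h => by
        rw [← h] at hroot
        simp at hroot)
    obtain ⟨x, hx', rfl⟩ := Finset.mem_image.mp hx
    refine ⟨x, hx', ?_⟩
    rw [Finset.mem_sdiff] at hy
    rcases y with p | y
    · exact .inl hxy.2.2
    · refine .inr ⟨y, Finset.mem_sdiff.mpr ⟨inr_mem_legSet.mp hy.1, fun hyA => hy.2 ?_⟩, hxy⟩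
      exact Finset.mem_image_of_mem _ hyA
  · intro h
    by_contra hc
    obtain ⟨A, B, hA, hB, hd, hAB, hno⟩ := exists_split_of_not_connectedOn ⟨_, hroot⟩ hc
    wlog hrA : .inl (s, 0) ∈ A generalizing A B with H
    · refine H B A hB hA hd.symm (by rw [Finset.union_comm, hAB]) hno.symm ?_
      rw [← hAB, Finset.mem_union] at hroot
      exact hroot.resolve_left hrA
    have hBA : legSet a b K \ A = B := by
      rw [← hAB, Finset.union_sdiff_cancel_left hd]
    have hBK : ∀ z ∈ B, ∃ x ∈ K, z = .inr x := by
      rintro (p | x) hz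
      · have hz' : .inl p ∈ legSet a b K := hAB ▸ Finset.mem_union_right _ hz
        exact absurd hz (Finset.disjoint_left.mp hd
          (leg_mem_of_noEdges (hBA.symm ▸ hno) hrA hroot hz'))
      · exact ⟨x, inr_mem_legSet.mp (hAB ▸ Finset.mem_union_right _ hz), rfl⟩
    obtain ⟨z, hz⟩ := hB
    obtain ⟨x, hx, rfl⟩ := hBK z hz
    obtain ⟨y, hy, hyQ⟩ := h (K.filter fun x => .inr x ∈ B) (Finset.filter_subset _ _)
      ⟨x, Finset.mem_filter.mpr ⟨hx, hz⟩⟩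
    rw [Finset.mem_filter] at hy
    rcases hyQ with hyQ | ⟨w, hw, hyw⟩
    · exact hno _ hrA _ hy.2 ⟨rfl, hs, hyQ⟩
    · simp only [Finset.mem_sdiff, Finset.mem_filter, not_and] at hw
      have hwU : .inr w ∈ A ∪ B := by rw [hAB]; exact inr_mem_legSet.mpr hw.1
      have hwA := (Finset.mem_union.mp hwU).resolve_right (hw.2 hw.1)
      exact hno _ hwA _ hy.2 hyw.symm

/-- The two roots are adjacent, so those in `δ` form a clique even when both are attached; this is
why joins to cliques, and not only single edges, are needed. -/
theorem isCliqueJoin_legGraph {q : M} (hq : q ∈ Q) :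
    IsCliqueJoin (legGraph δ Γ (Q \ {q})) (legGraph δ Γ Q) (.inr q)
      {z | ∃ s ∈ δ, z = .inl (s, 0)} := by
  constructor
  · rintro _ ⟨s, hs, rfl⟩ _ ⟨s', hs', rfl⟩ hne
    have : s ≠ s' := fun h => hne (by rw [h])
    simp [this]
  · rintro (⟨s, k⟩ | x) (⟨s', k'⟩ | y)
    · simp
    · by_cases hy : y = q
      · subst hy
        cases s <;> simp [hq, and_comm]
      · simp [hy]
    · by_cases hx : x = q
      · subst hx
        cases s' <;> simp [hq, and_comm]
      · simp [hx]
    · simp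

theorem exists_forall_iff_lt {P : ℕ → Prop} {a : ℕ} (hP : ∀ k, P (k + 1) → P k)
    (ha : ∀ k, P k → k < a) : ∃ i, ∀ k, P k ↔ k < i := by
  classical
  have hex : ∃ k, ¬P k := ⟨a, fun h => lt_irrefl a (ha a h)⟩
  refine ⟨Nat.find hex, fun k => ⟨fun hk => ?_, fun hk => ?_⟩⟩
  · by_contra hlt
    push Not at hlt
    have : ∀ m n, P (n + m) → P n := fun m => by
      induction m with
      | zero => exact fun n h => h
      | succ m ih => exact fun n h => ih n (hP _ h)
    refine Nat.find_spec hex (this (k - Nat.find hex) _ ?_)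
    rwa [Nat.add_sub_cancel' hlt]
  · by_contra hP
    exact Nat.find_min hex hk hP

/-- The part of a leg beyond position `k` can be left only through position `k`, and `q` lies
outside it. -/
theorem leg_mem_of_succ_mem {I : Finset ((Bool × ℕ) ⊕ M)} (hI : ConnectedOn (legGraph δ Γ Q) I)
    {q : M} (hq : .inr q ∈ I) {s : Bool} {k : ℕ} (hk : .inl (s, k + 1) ∈ I) :
    .inl (s, k) ∈ I := by
  classical
  obtain ⟨x, hx, y, hy, hxy⟩ := hI.2 (I.filter fun z => ∃ k' > k, z = .inl (s, k'))
    (Finset.filter_subset _ _) ⟨_, Finset.mem_filter.mpr ⟨hk, k + 1, by simp, rfl⟩⟩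
    (fun h => by
      rw [← h] at hq
      simp at hq)
  simp only [Finset.mem_sdiff, Finset.mem_filter, not_and, not_exists] at hx hy
  obtain ⟨-, k', hk', rfl⟩ := hx
  rcases y with ⟨s', m⟩ | y
  · simp only [legGraph_adj_inl_inl] at hxy
    rcases hxy with ⟨rfl, h | h⟩ | h
    · exact absurd rfl (hy.2 hy.1 m (by omega))
    · have : ¬m > k := fun hm => hy.2 hy.1 m hm rfl
      obtain rfl : m = k := by omega
      exact hy.1
    · omega
  · have := hxy.1
    dsimp only at this
    omega

theorem exists_eq_legSet {I : Finset ((Bool × ℕ) ⊕ M)} (hI : ConnectedOn (legGraph δ Γ Q) I)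
    {q : M} (hq : .inr q ∈ I) : ∃ i j K, I = legSet i j K := by
  have bound : ∀ s, ∃ a, ∀ k, .inl (s, k) ∈ I → k < a := fun s => by
    refine ⟨(I.sup fun z => Sum.elim (fun p => p.2) (fun _ => 0) z) + 1, fun k hk => ?_⟩
    exact Nat.lt_succ_of_le
      (Finset.le_sup (f := fun z => Sum.elim (fun p : Bool × ℕ => p.2) (fun _ => 0) z) hk)
  have key : ∀ s, ∃ i, ∀ k, .inl (s, k) ∈ I ↔ k < i := fun s => by
    obtain ⟨a, ha⟩ := bound s
    exact exists_forall_iff_lt (fun k hk => leg_mem_of_succ_mem hI hq hk) ha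
  obtain ⟨i, hi⟩ := key false
  obtain ⟨j, hj⟩ := key true
  refine ⟨i, j, I.toRight, ?_⟩
  ext z
  rcases z with ⟨s, k⟩ | x
  · cases s <;> simp [hi, hj]
  · simp

theorem noEdges_legSet_iff {a b i j : ℕ} {K K' : Finset M} (hact : LegActive δ i j) (hi : i ≤ a)
    (hj : j ≤ b) :
    NoEdges (legGraph δ Γ Q) (legSet i j K') (legSet a b K \ legSet i j K') ↔
      (a - i = 0 ∧ b - j = 0) ∧ ∀ x ∈ K \ K', x ∉ linkSet Γ Q K' := by
  have e : NoEdges (legGraph δ Γ Q) (legSet i j K') (legSet a b K \ legSet i j K') ↔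
      ∀ y ∈ legSet a b K \ legSet i j K', ¬∃ z ∈ legSet i j K', (legGraph δ Γ Q).Adj y z :=
    ⟨fun h y hy ⟨z, hz, hyz⟩ => h z hz y hy hyz.symm,
      fun h z hz y hy hzy => h y hy ⟨z, hz, hzy.symm⟩⟩
  rw [e]
  constructor
  · intro h
    refine ⟨?_, fun x hx hxl => ?_⟩
    · have key : ∀ s, ¬cond s j i < cond s b a := fun s hs =>
        h (.inl (s, cond s j i)) (by simpa using hs) (exists_adj_legSet_root hact s)
      have h1 := key false
      have h2 := key true
      simp only [cond_true, cond_false] at h1 h2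
      omega
    · rw [Finset.mem_sdiff] at hx
      exact h (.inr x) (by simpa using hx) ((exists_adj_legSet_inr_iff hact).mpr hxl)
  · rintro ⟨h0, h⟩ (⟨s, k⟩ | x) hy
    · simp only [Finset.mem_sdiff, inl_mem_legSet] at hy
      cases s <;> simp only [cond_true, cond_false] at hy <;> omega
    · rw [exists_adj_legSet_inr_iff hact]
      exact h x (by simpa using hy)

/-- The vertices touching the contracted set become a clique: the first surviving vertex of each leg
and the link set in `M`. Shifting the legs back by `i` and `j` makes those vertices the roots, both
attached to the link set. -/
theorem graphGamma_contractGraph_legSet {a b i j : ℕ} {K K' : Finset M}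
    (hact : LegActive δ i j) (hi : i ≤ a) (hj : j ≤ b) :
    graphGamma (contractGraph (legGraph δ Γ Q) (legSet i j K')) (legSet a b K \ legSet i j K') =
      graphGamma (legGraph Set.univ (linkGraph Γ Q K') (linkSet Γ Q K'))
        (legSet (a - i) (b - j) (K \ K')) := by
  let f : (Bool × ℕ) ⊕ M → (Bool × ℕ) ⊕ M := Sum.map (fun p => (p.1, p.2 + cond p.1 j i)) id
  have hf : Function.Injective f := by
    refine Sum.map_injective.mpr ⟨?_, Function.injective_id⟩
    rintro ⟨s, k⟩ ⟨s', k'⟩ h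
    simp only [Prod.mk.injEq] at h
    obtain ⟨rfl, h⟩ := h
    simpa using h
  have himg : legSet a b K \ legSet i j K' = (legSet (a - i) (b - j) (K \ K')).image f := by
    ext z
    rw [Finset.mem_sdiff, Finset.mem_image]
    constructor
    · rcases z with ⟨s, k⟩ | x
      · rw [inl_mem_legSet, inl_mem_legSet]
        intro h
        refine ⟨.inl (s, k - cond s j i), ?_, ?_⟩
        · rw [inl_mem_legSet]
          cases s <;> simp only [cond_true, cond_false] at h ⊢ <;> omega
        · simp only [f, Sum.map_inl]
          rw [Nat.sub_add_cancel (not_lt.mp h.2)]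
      · rw [inr_mem_legSet, inr_mem_legSet]
        exact fun h => ⟨.inr x, by simpa using h, rfl⟩
    · rintro ⟨⟨s, k⟩ | x, hz, rfl⟩
      · simp only [f, Sum.map_inl, inl_mem_legSet] at hz ⊢
        cases s <;> simp only [cond_true, cond_false] at hz ⊢ <;> omega
      · simpa [f] using hz
  have hleg : ∀ s k, (∃ z ∈ legSet i j K',
      (legGraph δ Γ Q).Adj (.inl (s, k + cond s j i)) z) ↔ k = 0 := fun s k => by
    refine ⟨eq_zero_of_exists_adj_legSet, ?_⟩
    rintro rfl
    rw [zero_add]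
    exact exists_adj_legSet_root hact s
  have hM : ∀ x, (∃ z ∈ legSet i j K', (legGraph δ Γ Q).Adj (.inr x) z) ↔ x ∈ linkSet Γ Q K' :=
    fun x => exists_adj_legSet_inr_iff hact
  rw [himg]
  refine graphGamma_image hf.injOn fun x hx y hy => ?_
  rcases x with ⟨s, k⟩ | x <;> rcases y with ⟨s', k'⟩ | y
  · simp only [contractGraph, f, Sum.map_inl, hleg, legGraph_adj_inl_inl]
    by_cases hs : s = s'
    · subst hs
      simp
      omega
    · simp [hs]
      omega
  · simp only [contractGraph, f, Sum.map_inl, Sum.map_inr, hleg, hM, id, legGraph_adj_inl_inr]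
    simp [linkSet]
    tauto
  · simp only [contractGraph, f, Sum.map_inl, Sum.map_inr, hleg, hM, id, legGraph_adj_inr_inl]
    simp [linkSet]
    tauto
  · simp only [contractGraph, f, Sum.map_inr, hM, id, legGraph_adj_inr_inr, linkGraph]
    simp

/-! ### Recursion in the attaching set and unimodality in the leg lengths -/

open Classical in
/-- The array of `γ`-polynomials of the graph with two legs after contraction, where the case in
which nothing was adjacent to the contracted set is left out. -/
noncomputable def linkArray (Γ : SimpleGraph M) (Q : Set M) (K K' : Finset M) (a b : ℕ) : ℤ[X] :=
  if a = 0 ∧ b = 0 then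
    if ∀ x ∈ K \ K', x ∉ linkSet Γ Q K' then 0
    else graphGamma (legGraph Set.univ (linkGraph Γ Q K') (linkSet Γ Q K')) (legSet 0 0 (K \ K'))
  else graphGamma (legGraph Set.univ (linkGraph Γ Q K') (linkSet Γ Q K')) (legSet a b (K \ K'))

open Classical in
/-- The array of `γ`-polynomials of the graph with two legs, restricted to active lengths. -/
noncomputable def activeArray (δ : Set Bool) (Γ : SimpleGraph M) (Q : Set M) (K : Finset M)
    (a b : ℕ) : ℤ[X] :=
  if LegActive δ a b then graphGamma (legGraph δ Γ Q) (legSet a b K) else 0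

open Classical in
-- The zeros built into the two arrays encode the conditions on the summands: the legs of `I` reach
-- an attached root, and `I` has an edge to its complement.
theorem activeArray_mul_linkArray {q : M} {a b i j : ℕ} {K K' : Finset M} (hi : i ≤ a)
    (hj : j ≤ b) :
    activeArray δ Γ (Q \ {q}) K' i j * linkArray Γ Q K K' (a - i) (b - j) =
      if LegActive δ i j ∧
        ¬NoEdges (legGraph δ Γ Q) (legSet i j K') (legSet a b K \ legSet i j K') then
        graphGamma (legGraph δ Γ (Q \ {q})) (legSet i j K') *
          graphGamma (contractGraph (legGraph δ Γ Q) (legSet i j K'))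
            (legSet a b K \ legSet i j K')
      else 0 := by
  by_cases hact : LegActive δ i j
  swap
  · simp [activeArray, hact]
  rw [activeArray, if_pos hact, noEdges_legSet_iff hact hi hj,
    graphGamma_contractGraph_legSet hact hi hj, linkArray]
  by_cases h0 : a - i = 0 ∧ b - j = 0
  · by_cases hl : ∀ x ∈ K \ K', x ∉ linkSet Γ Q K'
    · rw [if_pos h0, if_pos hl, if_neg fun h => h.2 ⟨h0, hl⟩, mul_zero]
    · rw [if_pos h0, if_neg hl, if_pos ⟨hact, fun h => hl h.2⟩, h0.1, h0.2]
  · rw [if_neg h0, if_pos ⟨hact, fun h => h0 h.1⟩]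

open Classical in
-- A newly connected set contains `q` and an attached root, so it consists of initial segments of
-- the legs of lengths `i`, `j` and some `K'`. Whether it is new depends on `K'` only, and the
-- complement has legs `a - i`, `b - j`; summing over `i`, `j` gives a convolution.
theorem graphGamma_legSet_eq_add {q : M} (hq : q ∈ Q) (a b : ℕ) (K : Finset M) :
    graphGamma (legGraph δ Γ Q) (legSet a b K) =
      graphGamma (legGraph δ Γ (Q \ {q})) (legSet a b K) +
        X * ∑ K' ∈ K.powerset with Attachable Γ Q K' ∧ ¬Attachable Γ (Q \ {q}) K',
          arrayConv (activeArray δ Γ (Q \ {q}) K') (linkArray Γ Q K K') a b := by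
  have hj := isCliqueJoin_legGraph (δ := δ) (Γ := Γ) hq
  rw [hj.graphGamma_eq_add]
  congr 2
  simp only [arrayConv]
  have e : ∑ K' ∈ K.powerset with Attachable Γ Q K' ∧ ¬Attachable Γ (Q \ {q}) K',
      ∑ i ∈ Finset.range (a + 1), ∑ j ∈ Finset.range (b + 1),
        activeArray δ Γ (Q \ {q}) K' i j * linkArray Γ Q K K' (a - i) (b - j) =
      ∑ t ∈ ((K.powerset.filter fun K' => Attachable Γ Q K' ∧ ¬Attachable Γ (Q \ {q}) K') ×ˢ
        Finset.range (a + 1) ×ˢ Finset.range (b + 1)) with LegActive δ t.2.1 t.2.2 ∧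
          ¬NoEdges (legGraph δ Γ Q) (legSet t.2.1 t.2.2 t.1)
            (legSet a b K \ legSet t.2.1 t.2.2 t.1),
        graphGamma (legGraph δ Γ (Q \ {q})) (legSet t.2.1 t.2.2 t.1) *
          graphGamma (contractGraph (legGraph δ Γ Q) (legSet t.2.1 t.2.2 t.1))
            (legSet a b K \ legSet t.2.1 t.2.2 t.1) := by
    symm
    rw [Finset.sum_filter, Finset.sum_product]
    refine Finset.sum_congr rfl fun K' _ => ?_
    rw [Finset.sum_product]
    refine Finset.sum_congr rfl fun i hi => Finset.sum_congr rfl fun j hj => ?_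
    rw [Finset.mem_range, Nat.lt_succ_iff] at hi hj
    symm
    exact activeArray_mul_linkArray hi hj
  rw [e]
  symm
  refine Finset.sum_nbij (fun t => legSet t.2.1 t.2.2 t.1) ?_ ?_ ?_ fun _ _ => rfl
  · rintro ⟨K', i, j⟩ ht
    simp only [Finset.mem_filter, Finset.mem_product, Finset.mem_powerset, Finset.mem_range,
      Nat.lt_succ_iff] at ht
    obtain ⟨⟨⟨hK, hA, hA'⟩, hi, hj⟩, hact, hno⟩ := ht
    refine mem_joinSets.mpr ⟨legSet_subset_iff.mpr ⟨hi, hj, hK⟩, ⟨?_, ?_⟩, hno⟩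
    · exact (connectedOn_legSet_iff hact).mpr hA
    · exact fun h => hA' ((connectedOn_legSet_iff hact).mp h)
  · rintro ⟨K', i, j⟩ - ⟨K'', i', j'⟩ - h
    obtain ⟨rfl, rfl, rfl⟩ := legSet_injective h
    rfl
  · intro I hI
    obtain ⟨hIU, hI, hno⟩ := mem_joinSets.mp hI
    obtain ⟨i, j, K', rfl⟩ := exists_eq_legSet hI.1 (hj.mem_of_newlyConnected hI)
    have hact : LegActive δ i j := by
      obtain ⟨_, hr, s, hs, rfl⟩ := hj.exists_mem_of_newlyConnected hI
      exact ⟨s, hs, by simpa using hr⟩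
    obtain ⟨hi, hj, hK⟩ := legSet_subset_iff.mp hIU
    refine ⟨(K', i, j), ?_, rfl⟩
    rw [Finset.mem_coe, Finset.mem_filter]
    simp only [Finset.mem_filter, Finset.mem_product, Finset.mem_powerset, Finset.mem_range,
      Nat.lt_succ_iff]
    refine ⟨⟨⟨hK, ?_, ?_⟩, hi, hj⟩, hact, hno⟩
    · exact (connectedOn_legSet_iff hact).mp hI.1
    · exact fun h => hI.2 ((connectedOn_legSet_iff hact).mpr h)

theorem graphGamma_legSet_empty (a b : ℕ) :
    graphGamma (legGraph δ Γ Q) (legSet a b ∅) =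
      graphGamma (legGraph δ Γ Q) (legSet 0 (a + b) ∅) := by
  let f : (Bool × ℕ) ⊕ M → (Bool × ℕ) ⊕ M :=
    Sum.map (fun p => (true, cond p.1 (p.2 + a) (a - 1 - p.2))) id
  have hf : Set.InjOn f (legSet a b (∅ : Finset M)) := by
    rintro (⟨s, k⟩ | x) hx (⟨s', k'⟩ | y) hy h
    · simp only [Finset.mem_coe, inl_mem_legSet] at hx hy
      simp only [f, Sum.map_inl, Sum.inl.injEq, Prod.mk.injEq, true_and] at h ⊢
      cases s <;> cases s' <;> simp only [cond_true, cond_false] at hx hy h <;> simp <;> omega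
    · simp at hy
    · simp at hx
    · simp at hx
  have himg : legSet 0 (a + b) (∅ : Finset M) = (legSet a b ∅).image f := by
    ext z
    rw [Finset.mem_image]
    constructor
    · rcases z with ⟨s, k⟩ | x
      · rw [inl_mem_legSet]
        intro h
        cases s
        · simp at h
        · simp only [cond_true] at h
          by_cases hk : k < a
          · exact ⟨.inl (false, a - 1 - k), by simp; omega, by simp [f]; omega⟩
          · exact ⟨.inl (true, k - a), by simp; omega, by simp [f]; omega⟩
      · simp
    · rintro ⟨⟨s, k⟩ | x, hz, rfl⟩
      · simp only [f, Sum.map_inl, inl_mem_legSet, cond_true] at hz ⊢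
        cases s <;> simp only [cond_true, cond_false] at hz ⊢ <;> omega
      · simp at hz
  rw [himg]
  refine (graphGamma_image hf fun x hx y hy => ?_).symm
  rcases x with ⟨s, k⟩ | x <;> rcases y with ⟨s', k'⟩ | y
  · rw [inl_mem_legSet] at hx hy
    simp only [f, Sum.map_inl, legGraph_adj_inl_inl]
    cases s <;> cases s' <;> simp only [cond_true, cond_false] at hx hy ⊢ <;> simp <;> omega
  · simp at hy
  · simp at hx
  · simp at hx

/-- With nothing attached, the legs form a separate path on `a + b` vertices. This is the base case,
an array constant on antidiagonals. -/
theorem graphGamma_legSet_of_forall_notMem {K : Finset M} (hK : ∀ x ∈ K, x ∉ Q) (a b : ℕ) :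
    graphGamma (legGraph δ Γ Q) (legSet a b K) =
      graphGamma (legGraph δ Γ Q) (legSet 0 0 K) *
        graphGamma (legGraph δ Γ Q) (legSet 0 (a + b) ∅) := by
  have e : legSet a b K = legSet 0 0 K ∪ legSet a b ∅ := by
    ext (⟨s, k⟩ | x)
    · cases s <;> simp
    · simp
  rw [e, graphGamma_union, graphGamma_legSet_empty]
  · rw [Finset.disjoint_left]
    rintro (⟨s, k⟩ | x) h1 h2
    · cases s <;> simp at h1
    · simp at h2
  · rintro (⟨s, k⟩ | x) h1 (⟨s', k'⟩ | y) h2 h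
    · cases s <;> simp at h1
    · simp at h2
    · exact hK x (inr_mem_legSet.mp h1) h.2.2
    · simp at h2

theorem symmUnimodal_linkArray {K K' : Finset M}
    (h : SymmUnimodal fun a b => graphGamma
      (legGraph Set.univ (linkGraph Γ Q K') (linkSet Γ Q K')) (legSet a b (K \ K'))) :
    SymmUnimodal (linkArray Γ Q K K') := by
  refine h.update_zero (z := _) ?_
  split_ifs
  · exact .zero
  · exact graphGamma_nonneg _ _

theorem mem_of_attachable {K : Finset M} {q : M} (h : Attachable Γ Q K)
    (h' : ¬Attachable Γ (Q \ {q}) K) : q ∈ K := by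
  by_contra hq
  refine h' fun A hA hne => ?_
  obtain ⟨x, hx, hxQ⟩ := h A hA hne
  exact ⟨x, hx, hxQ.imp_left fun hxQ => ⟨hxQ, fun e => hq (e ▸ hA hx)⟩⟩

/-- Induction on `|K|`, then on `|K ∩ Q|`. Removing `q` from `Q` handles the same `K`; contraction
shrinks `K` because `q ∈ K'`, but changes `Γ` and `Q` freely. -/
theorem symmUnimodal_graphGamma_legSet_univ (Γ : SimpleGraph M) (Q : Set M) (K : Finset M) :
    SymmUnimodal fun a b => graphGamma (legGraph Set.univ Γ Q) (legSet a b K) := by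
  classical
  induction hn : K.card using Nat.strong_induction_on generalizing K Γ Q with
  | _ n ih =>
    subst hn
    induction hm : ((K : Set M) ∩ Q).ncard using Nat.strong_induction_on generalizing Q with
    | _ m ihm =>
      subst hm
      by_cases hK : ∀ x ∈ K, x ∉ Q
      · rw [show (fun a b => graphGamma (legGraph Set.univ Γ Q) (legSet a b K)) = _ from
          funext₂ fun a b => graphGamma_legSet_of_forall_notMem hK a b]
        exact (SymmUnimodal.of_antidiagonal
          (c := fun n => graphGamma (legGraph Set.univ Γ Q) (legSet 0 n ∅))
          fun n => graphGamma_nonneg _ _).const_mul (graphGamma_nonneg _ _)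
      push Not at hK
      obtain ⟨q, hqK, hq⟩ := hK
      simp only [graphGamma_legSet_eq_add hq]
      have key : ∀ K' ⊆ K, SymmUnimodal fun a b =>
          graphGamma (legGraph Set.univ Γ (Q \ {q})) (legSet a b K') := fun K' hK' => by
        rcases hK'.eq_or_ssubset with rfl | hlt
        · exact ihm _ (ncard_inter_diff_singleton_lt subset_rfl hqK hq) _ rfl
        · exact ih _ (Finset.card_lt_card hlt) Γ _ K' rfl
      refine (key K subset_rfl).add (SymmUnimodal.const_mul (.sum fun K' hK' => ?_) .X)
      rw [Finset.mem_filter, Finset.mem_powerset] at hK'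
      refine SymmUnimodal.arrayConv ?_ (symmUnimodal_linkArray (ih _ ?_ _ _ _ rfl))
      -- With both roots attached only the lengths `(0, 0)` are inactive, and unimodality puts no
      -- constraint on the value there.
      · have e : activeArray Set.univ Γ (Q \ {q}) K' = fun a b => if a = 0 ∧ b = 0 then 0 else
            graphGamma (legGraph Set.univ Γ (Q \ {q})) (legSet a b K') := by
          funext a b
          have : LegActive Set.univ a b ↔ ¬(a = 0 ∧ b = 0) := by
            simp [LegActive]
            omega
          rw [activeArray, if_congr this rfl rfl, ite_not]
        rw [e]
        exact (key K' hK'.1).update_zero .zero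
      · refine Finset.card_lt_card ⟨Finset.sdiff_subset, fun h => ?_⟩
        exact (Finset.mem_sdiff.mp (h hqK)).2 (mem_of_attachable hK'.2.1 hK'.2.2)

/-- The attached root belongs to the `true` leg, so the array is indexed by the numbers of vertices
on either side of that root. Contractions fall under the case of two attached roots, hence induction
on `|K ∩ Q|` suffices. -/
theorem symmUnimodal_graphGamma_legSet_true (Γ : SimpleGraph M) (Q : Set M) (K : Finset M) :
    SymmUnimodal fun a b => graphGamma (legGraph {true} Γ Q) (legSet a (b + 1) K) := by
  classical
  induction hm : ((K : Set M) ∩ Q).ncard using Nat.strong_induction_on generalizing Q K with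
  | _ m ihm =>
    subst hm
    by_cases hK : ∀ x ∈ K, x ∉ Q
    · rw [show (fun a b => graphGamma (legGraph {true} Γ Q) (legSet a (b + 1) K)) = _ from
        funext₂ fun a b => graphGamma_legSet_of_forall_notMem hK a (b + 1)]
      simp only [← add_assoc]
      exact (SymmUnimodal.of_antidiagonal
        (c := fun n => graphGamma (legGraph {true} Γ Q) (legSet 0 (n + 1) ∅))
        fun n => graphGamma_nonneg _ _).const_mul (graphGamma_nonneg _ _)
    push Not at hK
    obtain ⟨q, hqK, hq⟩ := hK
    simp only [graphGamma_legSet_eq_add hq]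
    refine (ihm _ (ncard_inter_diff_singleton_lt subset_rfl hqK hq) _ _ rfl).add
      (SymmUnimodal.const_mul (.sum fun K' hK' => ?_) .X)
    rw [Finset.mem_filter, Finset.mem_powerset] at hK'
    -- The summands with `j = 0` vanish since the `true` leg is then inactive; dropping them shifts
    -- the second index of the first array by one.
    have e : (fun a b => arrayConv (activeArray {true} Γ (Q \ {q}) K') (linkArray Γ Q K K') a
        (b + 1)) = arrayConv (fun a b => graphGamma (legGraph {true} Γ (Q \ {q}))
          (legSet a (b + 1) K')) (linkArray Γ Q K K') := by
      funext a b
      simp only [arrayConv, Finset.sum_range_succ' _ (b + 1)]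
      refine Finset.sum_congr rfl fun i _ => ?_
      simp [activeArray, LegActive]
    rw [e]
    exact (ihm _ (ncard_inter_diff_singleton_lt hK'.1 hqK hq) _ _ rfl).arrayConv
      (symmUnimodal_linkArray (symmUnimodal_graphGamma_legSet_univ _ _ _))

end Legs

/-! ### Faces of nestohedra -/

section MaxFace

variable {V : Type*} [Fintype V]

/-- The set of maximizers over `P` of the linear functional with coefficients `c`. -/
def maxFace (c : V → ℝ) (P : Set (V → ℝ)) : Set (V → ℝ) :=
  {x ∈ P | ∀ y ∈ P, c ⬝ᵥ y ≤ c ⬝ᵥ x}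

theorem maxFace_add (c : V → ℝ) (P Q : Set (V → ℝ)) :
    maxFace c (P + Q) = maxFace c P + maxFace c Q := by
  ext z
  constructor
  · rintro ⟨⟨x, hx, y, hy, rfl⟩, h⟩
    refine ⟨x, ⟨hx, fun x' hx' => ?_⟩, y, ⟨hy, fun y' hy' => ?_⟩, rfl⟩
    · have := h _ (Set.add_mem_add hx' hy)
      simpa [dotProduct_add] using this
    · have := h _ (Set.add_mem_add hx hy')
      simpa [dotProduct_add] using this
  · rintro ⟨x, ⟨hx, hx'⟩, y, ⟨hy, hy'⟩, rfl⟩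
    refine ⟨Set.add_mem_add hx hy, ?_⟩
    rintro _ ⟨x', h1, y', h2, rfl⟩
    simp only [dotProduct_add]
    exact add_le_add (hx' x' h1) (hy' y' h2)

theorem maxFace_sum {ι : Type*} (c : V → ℝ) (s : Finset ι) (P : ι → Set (V → ℝ)) :
    maxFace c (∑ i ∈ s, P i) = ∑ i ∈ s, maxFace c (P i) := by
  classical
  induction s using Finset.induction with
  | empty =>
    ext x
    simp only [maxFace, Finset.sum_empty, Set.mem_zero]
    exact ⟨fun h => h.1, fun h => ⟨h, fun y hy => by rw [h, Set.mem_zero.mp hy]⟩⟩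
  | insert i s hi ih => rw [Finset.sum_insert hi, Finset.sum_insert hi, maxFace_add, ih]

theorem polyFaces_eq [DecidableEq V] (P : Set (V → ℝ)) :
    polyFaces P = {F | ∃ c, F = maxFace c P ∧ F.Nonempty} := by
  ext F
  constructor
  · rintro ⟨hF, hne⟩
    obtain ⟨l, hl⟩ := hF hne
    refine ⟨fun i => l (Pi.single i 1), ?_, hne⟩
    have h : ∀ x, (fun i => l (Pi.single i 1)) ⬝ᵥ x = l x := fun x => by
      conv_rhs => rw [← Finset.univ_sum_single x, map_sum]
      refine Finset.sum_congr rfl fun i _ => ?_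
      rw [mul_comm, ← smul_eq_mul, ← map_smul]
      congr 1
      ext j
      simp [Pi.single_apply]
    rw [hl]
    simp only [maxFace, h]
  · rintro ⟨c, rfl, hne⟩
    refine ⟨fun _ => ⟨LinearMap.toContinuousLinearMap (dotProductBilin ℝ ℝ c), rfl⟩, hne⟩

end MaxFace

/-! ### Directions of Minkowski sums -/

section VectorSpan

variable {E : Type*} [AddCommGroup E]

theorem nonempty_finsetSum {ι : Type*} {s : Finset ι} {P : ι → Set E} (h : ∀ i ∈ s, (P i).Nonempty) :
    (∑ i ∈ s, P i).Nonempty := by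
  choose! f hf using h
  exact ⟨_, Set.finsetSum_mem_finsetSum s P f fun i hi => hf i hi⟩

variable [Module ℝ E]

theorem vectorSpan_add_of_nonempty {A B : Set E} (hA : A.Nonempty) (hB : B.Nonempty) :
    vectorSpan ℝ (A + B) = vectorSpan ℝ A ⊔ vectorSpan ℝ B := by
  obtain ⟨a₀, ha₀⟩ := hA
  obtain ⟨b₀, hb₀⟩ := hB
  apply le_antisymm
  · rw [vectorSpan_def, Submodule.span_le]
    rintro _ ⟨_, ⟨a, ha, b, hb, rfl⟩, _, ⟨a', ha', b', hb', rfl⟩, rfl⟩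
    have : a + b -ᵥ (a' + b') = (a -ᵥ a') + (b -ᵥ b') := by
      simp only [vsub_eq_sub]
      abel
    change a + b -ᵥ (a' + b') ∈ _
    rw [this]
    refine Submodule.add_mem_sup ?_ ?_
    · exact vsub_mem_vectorSpan ℝ ha ha'
    · exact vsub_mem_vectorSpan ℝ hb hb'
  · refine sup_le ?_ ?_
    · rw [vectorSpan_def, Submodule.span_le]
      rintro _ ⟨a, ha, a', ha', rfl⟩
      have := vsub_mem_vectorSpan ℝ (Set.add_mem_add ha hb₀) (Set.add_mem_add ha' hb₀)
      simpa using this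
    · rw [vectorSpan_def, Submodule.span_le]
      rintro _ ⟨b, hb, b', hb', rfl⟩
      have := vsub_mem_vectorSpan ℝ (Set.add_mem_add ha₀ hb) (Set.add_mem_add ha₀ hb')
      simpa using this

theorem vectorSpan_sum {ι : Type*} {s : Finset ι} {P : ι → Set E}
    (h : ∀ i ∈ s, (P i).Nonempty) :
    vectorSpan ℝ (∑ i ∈ s, P i) = ⨆ i ∈ s, vectorSpan ℝ (P i) := by
  classical
  induction s using Finset.induction with
  | empty =>
    simp [← Set.singleton_zero, vectorSpan_singleton]
  | insert i s hi ih =>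
    have hs : ∀ j ∈ s, (P j).Nonempty := fun j hj => h j (Finset.mem_insert_of_mem hj)
    rw [Finset.sum_insert hi, vectorSpan_add_of_nonempty (h i (Finset.mem_insert_self i s))
      (nonempty_finsetSum hs), ih hs, Finset.iSup_insert]

end VectorSpan

/-! ### Faces of coordinate simplices -/

section CoordSimplex

variable {V : Type*} [DecidableEq V]

theorem vectorSpan_coordSimplex (I : Finset V) :
    vectorSpan ℝ (coordSimplex I) = coordDirection I := by
  rw [coordSimplex, coordDirection, ← direction_affineSpan, affineSpan_convexHull,
    direction_affineSpan]

theorem single_mem_coordSimplex {I : Finset V} {i : V} (hi : i ∈ I) :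
    Pi.single i 1 ∈ coordSimplex I := subset_convexHull ℝ _ ⟨i, hi, rfl⟩

theorem coordSimplex_nonempty {I : Finset V} (hI : I.Nonempty) : (coordSimplex I).Nonempty :=
  hI.elim fun _ hi => ⟨_, single_mem_coordSimplex hi⟩

variable [Fintype V]

theorem mem_coordSimplex {I : Finset V} {x : V → ℝ} :
    x ∈ coordSimplex I ↔ (∀ i, 0 ≤ x i) ∧ (∀ i ∉ I, x i = 0) ∧ ∑ i, x i = 1 := by
  constructor
  · intro hx
    have hc : Convex ℝ {x : V → ℝ | (∀ i, 0 ≤ x i) ∧ (∀ i ∉ I, x i = 0) ∧ ∑ i, x i = 1} := by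
      rintro x ⟨h1, h2, h3⟩ y ⟨k1, k2, k3⟩ a b ha hb hab
      refine ⟨fun i => ?_, fun i hi => ?_, ?_⟩
      · have := h1 i
        have := k1 i
        simp only [Pi.add_apply, Pi.smul_apply, smul_eq_mul]
        positivity
      · simp [h2 i hi, k2 i hi]
      · simp [Finset.sum_add_distrib, ← Finset.mul_sum, h3, k3, hab]
    refine convexHull_min ?_ hc hx
    rintro _ ⟨i, hi, rfl⟩
    refine ⟨fun j => ?_, fun j hj => ?_, ?_⟩
    · by_cases hij : j = i
      · subst hij; simp
      · simp [hij]
    · have : j ≠ i := fun h => hj (h ▸ hi)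
      simp [this]
    · simp
  · rintro ⟨h1, h2, h3⟩
    have e : x = ∑ i ∈ I, x i • (Pi.single i 1 : V → ℝ) := by
      funext j
      by_cases hj : j ∈ I <;> simp [Finset.sum_apply, Pi.single_apply, hj, h2]
    rw [e]
    refine (convex_convexHull ℝ _).sum_mem (fun i _ => h1 i) ?_ fun i hi =>
      single_mem_coordSimplex hi
    rw [← h3]
    exact Finset.sum_subset (Finset.subset_univ I) fun i _ hi => h2 i hi

/-- The whole mass at `i` is moved to `j`. A maximizer of `c` therefore has no mass at an `i` with
`c i < c j` for some `j ∈ I`. -/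
theorem add_sub_single_mem_coordSimplex {I : Finset V} {x : V → ℝ} (hx : x ∈ coordSimplex I)
    {i j : V} (hj : j ∈ I) :
    x + x i • (Pi.single j 1 - Pi.single i 1 : V → ℝ) ∈ coordSimplex I := by
  obtain ⟨h1, h2, h3⟩ := mem_coordSimplex.mp hx
  refine mem_coordSimplex.mpr ⟨fun k => ?_, fun k hk => ?_, ?_⟩
  · have hi := h1 i
    have hk := h1 k
    simp only [Pi.add_apply, Pi.smul_apply, Pi.sub_apply, Pi.single_apply, smul_eq_mul]
    by_cases hki : k = i
    · subst hki
      split_ifs <;> simp [hi]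
    · rw [if_neg hki]
      split_ifs <;> simp <;> linarith
  · have hkj : k ≠ j := fun h => hk (h ▸ hj)
    by_cases hki : k = i
    · subst hki
      simp [h2 k hk]
    · simp [h2 k hk, hkj, hki]
  · simp [Finset.sum_add_distrib, ← Finset.mul_sum, h3, Finset.sum_sub_distrib]

theorem maxFace_coordSimplex (c : V → ℝ) (I : Finset V) :
    maxFace c (coordSimplex I) = coordSimplex (argmaxOn c I) := by
  ext x
  constructor
  · rintro ⟨hx, h⟩
    obtain ⟨h1, h2, h3⟩ := mem_coordSimplex.mp hx
    refine mem_coordSimplex.mpr ⟨h1, fun i hi => ?_, h3⟩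
    by_cases hiI : i ∈ I
    · simp only [mem_argmaxOn, hiI, true_and, not_forall, not_le] at hi
      obtain ⟨j, hj, hij⟩ := hi
      have := h _ (add_sub_single_mem_coordSimplex hx (i := i) hj)
      simp only [dotProduct_add, dotProduct_smul, dotProduct_sub, dotProduct_single, mul_one,
        smul_eq_mul] at this
      have h0 := h1 i
      nlinarith
    · exact h2 i hiI
  · intro hx
    obtain ⟨h1, h2, h3⟩ := mem_coordSimplex.mp hx
    refine ⟨mem_coordSimplex.mpr ⟨h1, fun i hi => h2 i fun h => hi (argmaxOn_subset c I h), h3⟩,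
      fun y hy => ?_⟩
    obtain ⟨k1, k2, k3⟩ := mem_coordSimplex.mp hy
    obtain ⟨m, hm⟩ : ∃ m, m ∈ argmaxOn c I := by
      by_contra! h
      rw [Finset.sum_eq_zero fun i _ => h2 i (h i)] at h3
      exact zero_ne_one h3
    rw [mem_argmaxOn] at hm
    have e1 : c ⬝ᵥ y ≤ ∑ i, c m * y i := Finset.sum_le_sum fun i _ => by
      by_cases hi : i ∈ I
      · exact mul_le_mul_of_nonneg_right (hm.2 i hi) (k1 i)
      · simp [k2 i hi]
    have e2 : c ⬝ᵥ x = ∑ i, c m * x i := Finset.sum_congr rfl fun i _ => by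
      by_cases hi : i ∈ argmaxOn c I
      · rw [mem_argmaxOn] at hi
        rw [le_antisymm (hm.2 i hi.1) (hi.2 m hm.1)]
      · simp [h2 i hi]
    rw [← Finset.mul_sum, k3] at e1
    rw [← Finset.mul_sum, h3] at e2
    exact e1.trans e2.ge

end CoordSimplex

/-! ### Faces of the nestohedron as patterns, and its `γ`-polynomial -/

section Nestohedron

variable {V : Type*} [DecidableEq V] {G : SimpleGraph V}

theorem induce_connected_iff_connectedOn {I : Finset V} :
    (G.induce (I : Set V)).Connected ↔ ConnectedOn G I := by
  classical
  constructor
  · intro h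
    obtain ⟨⟨x, hx⟩⟩ := h.nonempty
    refine ⟨⟨x, hx⟩, fun A hA hne hAI => ?_⟩
    obtain ⟨a, ha⟩ := hne
    obtain ⟨b, hb, hbA⟩ : ∃ b ∈ I, b ∉ A := by
      by_contra! hb
      exact hAI (hA.antisymm hb)
    obtain ⟨p⟩ := h.preconnected ⟨a, hA ha⟩ ⟨b, hb⟩
    obtain ⟨d, -, hd1, hd2⟩ := p.exists_boundary_dart {z | z.1 ∈ A} ha hbA
    exact ⟨d.fst.1, hd1, d.snd.1, Finset.mem_sdiff.mpr ⟨d.snd.2, hd2⟩, d.adj⟩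
  · rintro ⟨⟨x, hx⟩, h⟩
    rw [SimpleGraph.connected_iff_exists_forall_reachable]
    refine ⟨⟨x, hx⟩, ?_⟩
    by_contra! hr
    obtain ⟨⟨y, hy⟩, hr⟩ := hr
    obtain ⟨a, ha, b, hb, hab⟩ := h
      (I.filter fun z => ∃ hz : z ∈ I, (G.induce (I : Set V)).Reachable ⟨x, hx⟩ ⟨z, hz⟩)
      (Finset.filter_subset _ _) ⟨x, Finset.mem_filter.mpr ⟨hx, hx, .rfl⟩⟩ (fun h => by
        rw [← h, Finset.mem_coe, Finset.mem_filter] at hy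
        obtain ⟨_, _, hy⟩ := hy
        exact hr hy)
    rw [Finset.mem_filter] at ha
    obtain ⟨-, ha, har⟩ := ha
    rw [Finset.mem_sdiff, Finset.mem_filter, not_and] at hb
    refine hb.2 hb.1 ⟨hb.1, har.trans (SimpleGraph.Adj.reachable ?_)⟩
    exact hab

variable [Fintype V]

theorem mem_graphicalBuildingSet {I : Finset V} :
    I ∈ (graphicalBuildingSet G).sets ↔ ConnectedOn G I := by
  simp only [graphicalBuildingSet, Finset.mem_filter, Finset.mem_univ, true_and]
  exact induce_connected_iff_connectedOn

/-- The face of the nestohedron which belongs to a pattern of maximizers. -/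
noncomputable def patternFace (G : SimpleGraph V) (A : Finset V → Finset V) : Set (V → ℝ) :=
  ∑ I ∈ (graphicalBuildingSet G).sets, coordSimplex (A I)

theorem maxFace_nestohedron (c : V → ℝ) :
    maxFace c (nestohedron (graphicalBuildingSet G)) =
      patternFace G (argmaxPattern G Finset.univ c) := by
  rw [nestohedron, maxFace_sum, patternFace]
  refine Finset.sum_congr rfl fun I hI => ?_
  rw [maxFace_coordSimplex, argmaxPattern_of_connectedOn (mem_graphicalBuildingSet.mp hI)
    (Finset.subset_univ I)]

theorem argmaxPattern_nonempty (c : V → ℝ) {I : Finset V}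
    (hI : I ∈ (graphicalBuildingSet G).sets) :
    (argmaxPattern G Finset.univ c I).Nonempty := by
  rw [mem_graphicalBuildingSet] at hI
  rw [argmaxPattern_of_connectedOn hI (Finset.subset_univ I)]
  exact argmaxOn_nonempty c hI.1

theorem patternFace_nonempty (c : V → ℝ) :
    (patternFace G (argmaxPattern G Finset.univ c)).Nonempty :=
  nonempty_finsetSum fun _ hI => coordSimplex_nonempty (argmaxPattern_nonempty c hI)

theorem polyFaces_nestohedron :
    polyFaces (nestohedron (graphicalBuildingSet G)) =
      patternFace G '' (argmaxPatterns G Finset.univ : Set (Finset V → Finset V)) := by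
  rw [polyFaces_eq]
  ext F
  simp only [Set.mem_image, Finset.mem_coe, mem_argmaxPatterns, maxFace_nestohedron]
  constructor
  · rintro ⟨c, rfl, -⟩
    exact ⟨_, ⟨c, rfl⟩, rfl⟩
  · rintro ⟨_, ⟨c, rfl⟩, rfl⟩
    exact ⟨c, rfl, patternFace_nonempty c⟩

theorem polyDim_patternFace (c : V → ℝ) :
    polyDim (patternFace G (argmaxPattern G Finset.univ c)) =
      patternRank (argmaxPattern G Finset.univ c) := by
  have e : vectorSpan ℝ (patternFace G (argmaxPattern G Finset.univ c)) =
      ⨆ I, coordDirection (argmaxPattern G Finset.univ c I) := by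
    rw [patternFace, vectorSpan_sum fun _ hI =>
      coordSimplex_nonempty (argmaxPattern_nonempty c hI)]
    simp only [vectorSpan_coordSimplex]
    refine iSup_congr fun I => ?_
    by_cases hI : I ∈ (graphicalBuildingSet G).sets
    · simp [hI]
    · rw [mem_graphicalBuildingSet] at hI
      simp [argmaxPattern_of_not_connectedOn hI]
  rw [polyDim, e, patternRank]

/-- The face determines the pattern. A sum of coordinate vectors selected by the pattern of `c` lies
in the common face, so it maximizes `c'`; exchanging just the summand for `I` shows that its element
maximizes `c'` on `I`. -/
theorem argmaxPattern_subset_of_patternFace_eq {c c' : V → ℝ}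
    (h : patternFace G (argmaxPattern G Finset.univ c) =
      patternFace G (argmaxPattern G Finset.univ c')) (I : Finset V) :
    argmaxPattern G Finset.univ c I ⊆ argmaxPattern G Finset.univ c' I := by
  classical
  by_cases hI : ConnectedOn G I
  swap
  · simp [argmaxPattern_of_not_connectedOn hI]
  intro i hi
  have hI' := mem_graphicalBuildingSet.mpr hI
  have hex : ∀ J, ∃ k, J ∈ (graphicalBuildingSet G).sets → k ∈ argmaxPattern G Finset.univ c J :=
    fun J => by
      by_cases hJ : J ∈ (graphicalBuildingSet G).sets
      · obtain ⟨k, hk⟩ := argmaxPattern_nonempty c hJ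
        exact ⟨k, fun _ => hk⟩
      · exact ⟨i, fun h => absurd h hJ⟩
  choose f hf using hex
  have hsub : ∀ J, J ∈ (graphicalBuildingSet G).sets → ∀ k ∈ argmaxPattern G Finset.univ c J,
      k ∈ J := fun J hJ k hk => by
    rw [argmaxPattern_of_connectedOn (mem_graphicalBuildingSet.mp hJ) (Finset.subset_univ J)] at hk
    exact argmaxOn_subset c J hk
  -- The selection `f` with its value at `I` replaced by `k`; the test points for `i` and `j` differ
  -- in this summand alone.
  let g : V → Finset V → V := fun k J => if J = I then k else f J
  have hg : ∀ k, ∀ J ∈ (graphicalBuildingSet G).sets, k ∈ I → g k J ∈ J := fun k J hJ hk => by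
    by_cases hJI : J = I
    · simpa [g, hJI] using hk
    · simpa [g, hJI] using hsub J hJ _ (hf J hJ)
  have hx : ∑ J ∈ (graphicalBuildingSet G).sets, (Pi.single (g i J) 1 : V → ℝ) ∈
      patternFace G (argmaxPattern G Finset.univ c) := by
    refine Set.finsetSum_mem_finsetSum _ _ _ fun J hJ => single_mem_coordSimplex ?_
    by_cases hJI : J = I
    · subst hJI
      simpa [g] using hi
    · simpa [g, hJI] using hf J hJ
  rw [h, ← maxFace_nestohedron] at hx
  rw [argmaxPattern_of_connectedOn hI (Finset.subset_univ I), mem_argmaxOn]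
  refine ⟨hsub I hI' i hi, fun j hj => ?_⟩
  have hy := hx.2 (∑ J ∈ (graphicalBuildingSet G).sets, (Pi.single (g j J) 1 : V → ℝ))
    (Set.finsetSum_mem_finsetSum _ _ _ fun J hJ => single_mem_coordSimplex (hg j J hJ hj))
  have e : ∀ k, c' ⬝ᵥ (∑ J ∈ (graphicalBuildingSet G).sets, (Pi.single (g k J) 1 : V → ℝ)) =
      c' k + ∑ J ∈ (graphicalBuildingSet G).sets.erase I, c' (f J) := fun k => by
    rw [dotProduct_sum, ← Finset.add_sum_erase _ _ hI']
    congr 1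
    · simp [g]
    · refine Finset.sum_congr rfl fun J hJ => ?_
      simp [g, Finset.ne_of_mem_erase hJ]
  rw [e, e] at hy
  exact le_of_add_le_add_right hy

theorem patternFace_injOn :
    Set.InjOn (patternFace G) (argmaxPatterns G Finset.univ : Set (Finset V → Finset V)) := by
  intro A hA B hB h
  obtain ⟨c, rfl⟩ := mem_argmaxPatterns.mp hA
  obtain ⟨c', rfl⟩ := mem_argmaxPatterns.mp hB
  funext I
  exact (argmaxPattern_subset_of_patternFace_eq h I).antisymm
    (argmaxPattern_subset_of_patternFace_eq h.symm I)

theorem faceCount_nestohedron (i : ℕ) :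
    faceCount (nestohedron (graphicalBuildingSet G)) i =
      ((argmaxPatterns G Finset.univ).filter fun A => patternRank A = i).card := by
  rw [faceCount, polyFaces_nestohedron, ← Set.ncard_coe_finset, ← (patternFace_injOn.mono
    (Finset.coe_subset.mpr (Finset.filter_subset _ _))).ncard_image]
  congr 1
  ext F
  simp only [Set.mem_image, Finset.mem_coe, Finset.mem_filter, Set.mem_ofPred_eq]
  constructor
  · rintro ⟨⟨A, hA, rfl⟩, hF⟩
    obtain ⟨c, rfl⟩ := mem_argmaxPatterns.mp hA
    exact ⟨_, ⟨hA, by rw [← polyDim_patternFace, hF]⟩, rfl⟩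
  · rintro ⟨A, ⟨hA, hA'⟩, rfl⟩
    obtain ⟨c, rfl⟩ := mem_argmaxPatterns.mp hA
    exact ⟨⟨_, hA, rfl⟩, by rw [polyDim_patternFace, hA']⟩

theorem nestohedron_eq_patternFace :
    nestohedron (graphicalBuildingSet G) = patternFace G (argmaxPattern G Finset.univ 0) := by
  rw [← maxFace_nestohedron]
  ext x
  simp [maxFace]

theorem patternRank_le_polyDim (c : V → ℝ) : patternRank (argmaxPattern G Finset.univ c) ≤
    polyDim (nestohedron (graphicalBuildingSet G)) := by
  rw [← polyDim_patternFace, ← maxFace_nestohedron]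
  exact Submodule.finrank_mono (vectorSpan_mono ℝ fun x hx => hx.1)

theorem fPolynomial_nestohedron :
    fPolynomial (nestohedron (graphicalBuildingSet G)) = facePoly G Finset.univ := by
  rw [fPolynomial, facePoly, ← Finset.sum_fiberwise_of_maps_to (g := patternRank)
    (t := Finset.range (polyDim (nestohedron (graphicalBuildingSet G)) + 1))]
  · refine Finset.sum_congr rfl fun i _ => ?_
    rw [faceCount_nestohedron, Finset.sum_congr rfl fun A hA => by
      rw [(Finset.mem_filter.mp hA).2]]
    simp
  · intro A hA
    obtain ⟨c, rfl⟩ := mem_argmaxPatterns.mp hA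
    exact Finset.mem_range_succ_iff.mpr (patternRank_le_polyDim c)

theorem natDegree_facePoly_univ :
    (facePoly G Finset.univ).natDegree = polyDim (nestohedron (graphicalBuildingSet G)) := by
  apply le_antisymm
  · refine natDegree_sum_le_of_forall_le _ _ fun A hA => ?_
    obtain ⟨c, rfl⟩ := mem_argmaxPatterns.mp hA
    rw [natDegree_X_pow]
    exact patternRank_le_polyDim c
  · apply le_natDegree_of_ne_zero
    have h0 : argmaxPattern G Finset.univ 0 ∈ argmaxPatterns G Finset.univ :=
      mem_argmaxPatterns.mpr ⟨0, rfl⟩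
    rw [facePoly, finsetSum_coeff]
    refine (Finset.sum_pos' (fun A _ => ?_) ⟨_, h0, ?_⟩).ne'
    · rw [coeff_X_pow]
      split_ifs <;> simp
    · rw [← polyDim_patternFace, ← nestohedron_eq_patternFace]
      simp

theorem isGammaPolynomial_of_isGammaOf {g : ℤ[X]} (h : IsGammaOf (facePoly G Finset.univ) g) :
    IsGammaPolynomial (nestohedron (graphicalBuildingSet G)) g := by
  have hdeg := h.natDegree_le
  have heval := h.eval_eq
  rw [natDegree_facePoly_univ] at hdeg heval
  refine ⟨by omega, ?_⟩
  rw [hPolynomial, fPolynomial_nestohedron]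
  apply map_injective (algebraMap ℤ ℝ) (algebraMap ℤ ℝ).injective_int
  -- The rational identity holds where `1 + x ≠ 0`; agreement at all positive reals gives the
  -- polynomial identity.
  refine eq_of_infinite_eval_eq _ _ ((Set.Ioi_infinite (0 : ℝ)).mono fun x hx => ?_)
  have hx1 : 1 + x ≠ 0 := by
    rw [Set.mem_Ioi] at hx
    positivity
  change eval _ _ = eval _ _
  rw [eval_map_algebraMap, eval_map_algebraMap, aeval_comp]
  simp only [map_sub, aeval_X, map_one]
  rw [heval x hx1, aeval_eq_sum_range' (n := polyDim (nestohedron (graphicalBuildingSet G)) / 2 + 1)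
    (by omega), map_sum, Finset.mul_sum]
  refine Finset.sum_congr rfl fun i hi => ?_
  rw [Finset.mem_range] at hi
  obtain ⟨e, he⟩ : ∃ e, polyDim (nestohedron (graphicalBuildingSet G)) = 2 * i + e :=
    ⟨_, (Nat.add_sub_cancel' (by omega)).symm⟩
  rw [he, Nat.add_sub_cancel_left]
  simp only [map_mul, map_pow, map_add, map_one, aeval_X, aeval_C, zsmul_eq_mul, div_pow]
  rw [← pow_mul, pow_add]
  field_simp
  simp [mul_comm]

theorem gammaPolynomial_nestohedron :
    gammaPolynomial (nestohedron (graphicalBuildingSet G)) = graphGamma G Finset.univ :=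
  (isGammaPolynomial_of_isGammaOf (isGammaOf_graphGamma G _)).gammaPolynomial_eq

theorem isGammaPolynomial_gammaPolynomial_nestohedron :
    IsGammaPolynomial (nestohedron (graphicalBuildingSet G))
      (gammaPolynomial (nestohedron (graphicalBuildingSet G))) := by
  rw [gammaPolynomial_nestohedron]
  exact isGammaPolynomial_of_isGammaOf (isGammaOf_graphGamma G _)

end Nestohedron

/-! ### Flossing moves -/

theorem flossingMove_adj {V : Type*} [DecidableEq V] {G : SimpleGraph V} {l lhat w x y : V} :
    (flossingMove G l lhat w).Adj x y ↔
    (G.Adj x y ∧ ¬(x = l ∧ y = w ∨ x = w ∧ y = l)) ∨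
      ((x = lhat ∧ y = l ∨ x = l ∧ y = lhat) ∧ x ≠ y) := by
  simp [flossingMove, SimpleGraph.edge_adj, eq_comm]
  tauto

section Flossing

variable {V : Type*} [Fintype V] [DecidableEq V]

/-- A graph with an induced path `P 0, …, P n` whose vertices other than `P m` have no neighbours
outside of the path is a graph with two legs. -/
theorem graphGamma_univ_eq_legGraph {G Γ : SimpleGraph V} {Q : Set V} {K : Finset V} {P : ℕ → V}
    {n m : ℕ} (hm : m ≤ n) (hinj : ∀ i ≤ n, ∀ j ≤ n, P i = P j → i = j)
    (hadj : ∀ i ≤ n, ∀ j ≤ n, (G.Adj (P i) (P j) ↔ i + 1 = j ∨ j + 1 = i))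
    (hK : ∀ x, x ∈ K ↔ ∀ i ≤ n, P i ≠ x) (hleg : ∀ i ≤ n, i ≠ m → ∀ x ∈ K, ¬G.Adj (P i) x)
    (hΓ : ∀ x ∈ K, ∀ y ∈ K, (G.Adj x y ↔ Γ.Adj x y)) (hQ : ∀ x ∈ K, (G.Adj (P m) x ↔ x ∈ Q)) :
    graphGamma G Finset.univ =
      graphGamma (legGraph {true} Γ Q) (legSet m (n - m + 1) K) := by
  -- The `true` leg runs from `P m` up to `P n` and has `n - m + 1` vertices; the `false` leg runs
  -- from `P (m - 1)` down to `P 0`.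
  let t : Bool × ℕ → ℕ := fun p => cond p.1 (m + p.2) (m - 1 - p.2)
  let f : (Bool × ℕ) ⊕ V → V := Sum.elim (fun p => P (t p)) id
  have ht : ∀ p : Bool × ℕ, .inl p ∈ legSet m (n - m + 1) K → t p ≤ n := fun p hp => by
    obtain ⟨s, k⟩ := p
    rw [inl_mem_legSet] at hp
    cases s <;> simp only [t, cond_true, cond_false] at hp ⊢ <;> omega
  have himg : Finset.univ = (legSet m (n - m + 1) K).image f := by
    ext x
    simp only [Finset.mem_univ, Finset.mem_image, true_iff]
    by_cases hx : x ∈ K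
    · exact ⟨.inr x, inr_mem_legSet.mpr hx, rfl⟩
    · rw [hK] at hx
      push Not at hx
      obtain ⟨i, hi, rfl⟩ := hx
      by_cases him : i < m
      · refine ⟨.inl (false, m - 1 - i), by simp; omega, ?_⟩
        simp only [f, t, Sum.elim_inl, cond_false]
        congr 1
        omega
      · refine ⟨.inl (true, i - m), by simp; omega, ?_⟩
        simp only [f, t, Sum.elim_inl, cond_true]
        congr 1
        omega
  have hfinj : Set.InjOn f (legSet m (n - m + 1) K) := by
    rintro (⟨s, k⟩ | x) hx (⟨s', k'⟩ | y) hy h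
    · have h := hinj _ (ht _ hx) _ (ht _ hy) h
      rw [Finset.mem_coe, inl_mem_legSet] at hx hy
      cases s <;> cases s' <;> simp only [t, cond_true, cond_false] at hx hy h <;> simp <;> omega
    · exact absurd h ((hK y).mp (inr_mem_legSet.mp hy) _ (ht _ hx))
    · exact absurd h.symm ((hK x).mp (inr_mem_legSet.mp hx) _ (ht _ hy))
    · exact congrArg _ h
  have hmix : ∀ (p : Bool × ℕ) (x : V), .inl p ∈ legSet m (n - m + 1) K → x ∈ K →
      (G.Adj (P (t p)) x ↔ p.2 = 0 ∧ p.1 ∈ ({true} : Set Bool) ∧ x ∈ Q) := fun p x hp hx => by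
    by_cases h : t p = m
    · rw [h, hQ x hx]
      obtain ⟨s, k⟩ := p
      rw [inl_mem_legSet] at hp
      cases s <;> simp only [t, cond_true, cond_false] at hp h
      · omega
      · obtain rfl : k = 0 := by omega
        simp
    · refine iff_of_false (hleg _ (ht p hp) h x hx) ?_
      rintro ⟨h1, h2, -⟩
      rw [Set.mem_singleton_iff] at h2
      exact h (by simp [t, h1, h2])
  rw [himg]
  refine graphGamma_image hfinj fun x hx y hy => ?_
  rcases x with p | x <;> rcases y with p' | y
  · simp only [f, Sum.elim_inl, legGraph_adj_inl_inl]
    rw [hadj _ (ht p hx) _ (ht p' hy)]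
    obtain ⟨s, k⟩ := p
    obtain ⟨s', k'⟩ := p'
    rw [inl_mem_legSet] at hx hy
    cases s <;> cases s' <;> simp only [t, cond_true, cond_false] at hx hy ⊢ <;> simp <;> omega
  · exact hmix p y hx (inr_mem_legSet.mp hy)
  · rw [SimpleGraph.adj_comm]
    exact hmix p' x hy (inr_mem_legSet.mp hx)
  · exact hΓ x (inr_mem_legSet.mp hx) y (inr_mem_legSet.mp hy)

variable {G : SimpleGraph V} [DecidableRel G.Adj]

/-- A vertex of degree at most `2` on a path between leaves is adjacent to its neighbours on the
path only. -/
theorem exists_of_adj_getVert {l l' : V} {p : G.Walk l l'} (hp : p.IsPath) (hl : G.degree l = 1)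
    (hl' : G.degree l' = 1) {i : ℕ} (hi : i ≤ p.length) (hlen : 0 < p.length)
    (hdeg : G.degree (p.getVert i) ≤ 2) {x : V} (hx : G.Adj (p.getVert i) x) :
    ∃ j ≤ p.length, (i + 1 = j ∨ j + 1 = i) ∧ p.getVert j = x := by
  have hmem := (G.mem_neighborFinset _ _).mpr hx
  have hsucc : ∀ k < p.length, p.getVert (k + 1) ∈ G.neighborFinset (p.getVert k) ∧
      p.getVert k ∈ G.neighborFinset (p.getVert (k + 1)) := fun k hk => by
    rw [G.mem_neighborFinset, G.mem_neighborFinset]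
    exact ⟨p.adj_getVert_succ hk, (p.adj_getVert_succ hk).symm⟩
  rcases Nat.eq_zero_or_pos i with rfl | hpos
  · refine ⟨1, hlen, .inl rfl, ?_⟩
    have h1 := (hsucc 0 hlen).1
    rw [p.getVert_zero] at hmem h1
    exact Finset.card_le_one.mp hl.le _ h1 _ hmem
  rcases hi.eq_or_lt with rfl | hlt
  · refine ⟨p.length - 1, by omega, .inr (by omega), ?_⟩
    have h1 := (hsucc (p.length - 1) (by omega)).2
    rw [Nat.sub_add_cancel hlen, p.getVert_length] at h1
    rw [p.getVert_length] at hmem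
    exact Finset.card_le_one.mp hl'.le _ h1 _ hmem
  · have h1 := (hsucc i hlt).1
    have h2 := (hsucc (i - 1) (by omega)).2
    rw [Nat.sub_add_cancel hpos] at h2
    have hne : p.getVert (i + 1) ≠ p.getVert (i - 1) := fun h => by
      have := hp.getVert_injOn (show i + 1 ≤ p.length by omega)
        (show i - 1 ≤ p.length by omega) h
      omega
    have e : ({p.getVert (i + 1), p.getVert (i - 1)} : Finset V) =
        G.neighborFinset (p.getVert i) := by
      refine Finset.eq_of_subset_of_card_le ?_ ?_
      · exact Finset.insert_subset h1 (Finset.singleton_subset_iff.mpr h2)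
      · rw [Finset.card_pair hne]
        exact hdeg
    rw [← e, Finset.mem_insert, Finset.mem_singleton] at hmem
    rcases hmem with rfl | rfl
    · exact ⟨i + 1, hlt, .inl rfl, rfl⟩
    · exact ⟨i - 1, by omega, .inr (by omega), rfl⟩

theorem graphGamma_flossingMove_le (hG : G.Connected) {l lhat v w : V}
    (hfloss : Floss G l lhat v) (hdist : G.dist l v ≤ G.dist lhat v) (hw : G.Adj l w) :
    CoeffNonneg (graphGamma G Finset.univ -
      graphGamma (flossingMove G l lhat w) Finset.univ) := by
  obtain ⟨hl, hlhat, p, ⟨hp, hlen⟩, -, hv, hdeg, huniq⟩ := hfloss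
  obtain ⟨m, rfl, hm⟩ := SimpleGraph.Walk.mem_support_iff_exists_getVert.mp hv
  set n := p.length with hn
  have hinj : ∀ i ≤ n, ∀ j ≤ n, p.getVert i = p.getVert j → i = j :=
    fun i hi j hj h => hp.getVert_injOn hi hj h
  have hm0 : m ≠ 0 := by
    rintro rfl
    rw [p.getVert_zero] at hdeg
    omega
  have hmn : m ≠ n := fun h => by
    rw [h, hn, p.getVert_length] at hdeg
    omega
  -- Path vertices other than `v` have degree at most `2`, so the path already accounts for all
  -- their neighbours. Hence the path is induced and attached to the rest only at `v`.
  have hnbr : ∀ i ≤ n, i ≠ m → ∀ x, G.Adj (p.getVert i) x →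
      ∃ j ≤ n, (i + 1 = j ∨ j + 1 = i) ∧ p.getVert j = x := fun i hi him x hx => by
    refine exists_of_adj_getVert hp hl hlhat hi (by omega) ?_ hx
    by_contra! h3
    exact him (hinj i hi m hm (huniq _ (p.getVert_mem_support i) h3))
  have hadj : ∀ i ≤ n, ∀ j ≤ n,
      (G.Adj (p.getVert i) (p.getVert j) ↔ i + 1 = j ∨ j + 1 = i) := by
    have key : ∀ i ≤ n, i ≠ m → ∀ j ≤ n,
        (G.Adj (p.getVert i) (p.getVert j) ↔ i + 1 = j ∨ j + 1 = i) := fun i hi him j hj => by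
      constructor
      · intro h
        obtain ⟨k, hk, hik, hkj⟩ := hnbr i hi him _ h
        rwa [← hinj k hk j hj hkj]
      · rintro (rfl | rfl)
        · exact p.adj_getVert_succ (by omega)
        · exact (p.adj_getVert_succ (by omega)).symm
    intro i hi j hj
    by_cases him : i = m
    · by_cases hjm : j = m
      · subst him hjm
        simp
      · rw [G.adj_comm, key j hj hjm i hi, or_comm]
    · exact key i hi him j hj
  -- The triangle inequality and the comparison of distances give `n ≤ 2 * dist lhat v ≤ 2 * (n -
  -- m)`.
  have hle : m ≤ n - m := by
    have h1 : G.dist lhat (p.getVert m) ≤ n - m := by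
      rw [G.dist_comm]
      exact (G.dist_le (p.drop m)).trans (by simp [hn])
    have h2 := hG.dist_triangle (u := l) (v := p.getVert m) (w := lhat)
    rw [G.dist_comm (u := p.getVert m), ← hlen] at h2
    omega
  have hl0 : p.getVert 0 = l := p.getVert_zero
  have hln : p.getVert n = lhat := p.getVert_length
  have hw1 : w = p.getVert 1 := by
    obtain ⟨j, hj, h | h, rfl⟩ := hnbr 0 (by omega) hm0.symm w (hl0.symm ▸ hw)
    · rw [← h]
    · omega
  let K : Finset V := Finset.univ.filter fun x => ∀ i ≤ n, p.getVert i ≠ x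
  have hK : ∀ x, x ∈ K ↔ ∀ i ≤ n, p.getVert i ≠ x := by simp [K]
  have e1 : graphGamma G Finset.univ = graphGamma
      (legGraph {true} G {x | G.Adj (p.getVert m) x}) (legSet m (n - m + 1) K) := by
    refine graphGamma_univ_eq_legGraph hm hinj hadj hK (fun i hi him x hx hix => ?_)
      (fun _ _ _ _ => Iff.rfl) fun _ _ => Iff.rfl
    obtain ⟨j, hj, -, hjx⟩ := hnbr i hi him x hix
    exact (hK x).mp hx j hj hjx
  -- After the move the path is `P 1, …, P n, P 0`: the leaf `l` comes after `lhat`, and `v` has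
  -- position `m - 1`.
  let r : ℕ → ℕ := fun i => if i = n then 0 else i + 1
  have hr : ∀ i ≤ n, r i ≤ n := fun i hi => by
    simp only [r]
    split_ifs <;> omega
  have hpv : ∀ i ≤ n, ∀ j ≤ n, (p.getVert i = p.getVert j ↔ i = j) :=
    fun i hi j hj => ⟨hinj i hi j hj, fun h => by rw [h]⟩
  have hpl : ∀ i ≤ n, (p.getVert i = l ↔ i = 0) := fun i hi =>
    ⟨fun h => hinj i hi 0 (by omega) (h.trans hl0.symm), fun h => h ▸ hl0⟩
  have hplhat : ∀ i ≤ n, (p.getVert i = lhat ↔ i = n) := fun i hi =>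
    ⟨fun h => hinj i hi n le_rfl (h.trans hln.symm), fun h => h ▸ hln⟩
  have hpw : ∀ i ≤ n, (p.getVert i = w ↔ i = 1) := fun i hi =>
    ⟨fun h => hinj i hi 1 (by omega) (h.trans hw1), fun h => h ▸ hw1.symm⟩
  have hKx : ∀ x ∈ K, x ≠ l ∧ x ≠ lhat := fun x hx =>
    ⟨fun h => (hK x).mp hx 0 (by omega) (hl0.trans h.symm),
      fun h => (hK x).mp hx n le_rfl (hln.trans h.symm)⟩
  have hflK : ∀ x y, y ∈ K → ((flossingMove G l lhat w).Adj x y ↔ G.Adj x y ∧ ¬(x = l ∧ y = w)) :=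
    fun x y hy => by
      rw [flossingMove_adj]
      have := hKx y hy
      tauto
  have hwK : w ∉ K := fun h => (hK w).mp h 1 (by omega) hw1.symm
  have e2 : graphGamma (flossingMove G l lhat w) Finset.univ = graphGamma
      (legGraph {true} G {x | G.Adj (p.getVert m) x}) (legSet (m - 1) (n - m + 1 + 1) K) := by
    have hrm : r (m - 1) = m := by
      simp only [r]
      rw [if_neg (by omega)]
      omega
    rw [show n - m + 1 + 1 = n - (m - 1) + 1 by omega]
    refine graphGamma_univ_eq_legGraph (P := fun i => p.getVert (r i)) (by omega) ?_ ?_ ?_ ?_ ?_ ?_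
    · intro i hi j hj h
      have := hinj _ (hr i hi) _ (hr j hj) h
      simp only [r] at this
      split_ifs at this <;> omega
    · intro i hi j hj
      rw [flossingMove_adj, hadj _ (hr i hi) _ (hr j hj)]
      simp only [ne_eq, hpv _ (hr i hi) _ (hr j hj), hpl _ (hr i hi), hpl _ (hr j hj),
        hpw _ (hr i hi), hpw _ (hr j hj), hplhat _ (hr i hi), hplhat _ (hr j hj)]
      simp only [r]
      split_ifs <;> grind
    · intro x
      rw [hK]
      refine ⟨fun h i hi => h _ (hr i hi), fun h i hi => ?_⟩
      rcases Nat.eq_zero_or_pos i with rfl | hpos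
      · simpa [r] using h n le_rfl
      · have := h (i - 1) (by omega)
        simp only [r] at this
        rwa [if_neg (by omega), Nat.sub_add_cancel hpos] at this
    · intro i hi him x hx hix
      rw [hflK _ _ hx] at hix
      have hne : r i ≠ m := by
        simp only [r]
        split_ifs <;> omega
      obtain ⟨j, hj, -, hjx⟩ := hnbr _ (hr i hi) hne x hix.1
      exact (hK x).mp hx j hj hjx
    · intro x hx y hy
      rw [hflK _ _ hy]
      exact ⟨fun h => h.1, fun h => ⟨h, fun h' => (hKx x hx).1 h'.1⟩⟩
    · intro x hx
      simp only [hrm]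
      rw [hflK _ _ hx]
      exact ⟨fun h => h.1, fun h => ⟨h, fun h' => hwK (h'.2 ▸ hx)⟩⟩
  rw [e1, e2]
  -- The side lengths at `v` pass from `(m, n - m)` to `(m - 1, n - m + 1)`, away from the diagonal
  -- because `m ≤ n - m`.
  have := (symmUnimodal_graphGamma_legSet_true G {x | G.Adj (p.getVert m) x} K).mono (m - 1)
    (n - m) (by omega)
  rwa [Nat.sub_add_cancel (by omega)] at this

end Flossing

theorem theorem5p1 {V : Type*} [Fintype V] [DecidableEq V]
    (G : SimpleGraph V) [DecidableRel G.Adj] (hG : G.Connected)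
    (l lhat v w : V) (hfloss : Floss G l lhat v)
    (hdist : G.dist l v ≤ G.dist lhat v) (hw : G.Adj l w) :
    IsGammaPolynomial (nestohedron (graphicalBuildingSet G))
        (gammaPolynomial (nestohedron (graphicalBuildingSet G))) ∧
      IsGammaPolynomial (nestohedron (graphicalBuildingSet (flossingMove G l lhat w)))
        (gammaPolynomial (nestohedron (graphicalBuildingSet (flossingMove G l lhat w)))) ∧
      ∀ i : ℕ,
        (gammaPolynomial
          (nestohedron (graphicalBuildingSet (flossingMove G l lhat w)))).coeff i ≤
        (gammaPolynomial (nestohedron (graphicalBuildingSet G))).coeff i := by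
  refine ⟨isGammaPolynomial_gammaPolynomial_nestohedron,
    isGammaPolynomial_gammaPolynomial_nestohedron, fun i => ?_⟩
  rw [gammaPolynomial_nestohedron, gammaPolynomial_nestohedron]
  have := graphGamma_flossingMove_le hG hfloss hdist hw i
  rwa [coeff_sub, sub_nonneg] at this
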